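/- Let $d\ge 2$ be an integer and let $q\ge \frac{4d}{d-1}$ be a real number. Let $\sigma$ denote the usual surface measure on the unit sphere $\mathbb S^{d-1}\subset\mathbb R^d$, and let $\omega_{d-1}=\sigma(\mathbb S^{d-1})$. For $0\ne f\in L^2(\mathbb S^{d-1})$ (complex-valued) put $$\widehat{f\sigma}(x)=\int_{\mathbb S^{d-1}} f(\omega)e^{-ix\cdot\omega}\,d\sigma(\omega),\qquad x\in\mathbb R^d,$$ $$K_f(\xi)=\int_{\mathbb R^d} e^{iz\cdot\xi}\,|\widehat{f\sigma}(z)|^{q-2}\,dz,\qquad \xi\in\mathbb R^d,$$ $$(T_f g)(\omega)=\int_{\mathbb S^{d-1}} g(\nu)K_f(\omega-\nu)\,d\sigma(\nu),\qquad g\in L^2(\mathbb S^{d-1}).$$ Then $\widehat{f\sigma}\in L^{q-2}(\mathbb R^d)$, the integral defining $(T_fg)(\omega)$ converges absolutely for every $g\in L^2(\mathbb S^{d-1})$ and $\sigma$-almost every $\omega$, and $T_f$ is a bounded linear operator on $L^2(\mathbb S^{d-1})$. Moreover $T_f$ is trace class, that is, $\sum_i\langle |T_f|e_i,e_i\rangle<\infty$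 for every orthonormal basis $(e_i)$ of $L^2(\mathbb S^{d-1})$, where $|T_f|=(T_f^*T_f)^{1/2}$; and its trace is $$\operatorname{tr}(T_f)=\sum_i\langle T_fe_i,e_i\rangle=\omega_{d-1}\,\|\widehat{f\sigma}\|_{L^{q-2}(\mathbb R^d)}^{q-2}$$ for every orthonormal basis $(e_i)$. -/

import Mathlib

open MeasureTheory

noncomputable section

namespace FourierExtension

/-- The unit sphere `S^{d-1}` of `ℝ^d`. -/
abbrev UnitSphere (d : ℕ) : Type :=
  Metric.sphere (0 : EuclideanSpace ℝ (Fin d)) 1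

/-- The usual (unnormalized) surface measure on `S^{d-1}`, so that the total mass of `S^1` is
`2π`, of `S^2` is `4π`, and so on. -/
abbrev surfaceMeasure (d : ℕ) : Measure (UnitSphere d) :=
  (volume : Measure (EuclideanSpace ℝ (Fin d))).toSphere

/-- The total surface area of the sphere `S^{d-1}`. -/
def sphereArea (d : ℕ) : ℝ := (surfaceMeasure d).real Set.univ

/-- The complex Hilbert space `L²(S^{d-1})`. -/
abbrev SphereL2 (d : ℕ) : Type := Lp ℂ 2 (surfaceMeasure d)

/-- The extension operator `f ↦ (fσ)^`, where
`(fσ)^(x) = ∫ f(ω) e^{-i x·ω} dσ(ω)` for `x ∈ ℝ^d`. -/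
def extension {d : ℕ} (f : SphereL2 d) (x : EuclideanSpace ℝ (Fin d)) : ℂ :=
  ∫ ω : UnitSphere d,
    f ω * Complex.exp (-(Complex.I * ((inner ℝ x (ω : EuclideanSpace ℝ (Fin d)) : ℝ) : ℂ)))
    ∂(surfaceMeasure d)

/-- The kernel `K_f(ξ) = ∫ e^{i z·ξ} |(fσ)^(z)|^{q-2} dz`. -/
def kernel {d : ℕ} (q : ℝ) (f : SphereL2 d) (ξ : EuclideanSpace ℝ (Fin d)) : ℂ :=
  ∫ z : EuclideanSpace ℝ (Fin d),
    Complex.exp (Complex.I * ((inner ℝ z ξ : ℝ) : ℂ)) * ((‖extension f z‖ ^ (q - 2) : ℝ) : ℂ)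

/-- `T` is the integral operator `g ↦ ∫ g(ν) K(ω - ν) dσ(ν)` on `L²(S^{d-1})`: the integrals
converge, and they represent the class `T g`. Such a `T` is unique if it exists. -/
def IsConvolutionOperator {d : ℕ} (K : EuclideanSpace ℝ (Fin d) → ℂ)
    (T : SphereL2 d →L[ℂ] SphereL2 d) : Prop :=
  ∀ g : SphereL2 d,
    (∀ᵐ ω : UnitSphere d ∂(surfaceMeasure d),
      Integrable (fun ν : UnitSphere d =>
        g ν * K ((ω : EuclideanSpace ℝ (Fin d)) - (ν : EuclideanSpace ℝ (Fin d))))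
        (surfaceMeasure d)) ∧
    (∀ᵐ ω : UnitSphere d ∂(surfaceMeasure d),
      T g ω = ∫ ν : UnitSphere d,
        g ν * K ((ω : EuclideanSpace ℝ (Fin d)) - (ν : EuclideanSpace ℝ (Fin d)))
        ∂(surfaceMeasure d))

universe u

/-- A bounded operator `T` on a complex Hilbert space is trace class if, with
`|T| = (T* T)^{1/2}`, the sum `∑ ⟨|T| e_i, e_i⟩` is finite for every orthonormal basis `(e_i)`
(equivalently, for one such basis). -/
def IsTraceClass {H : Type u} [NormedAddCommGroup H] [InnerProductSpace ℂ H] [CompleteSpace H]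
    (T : H →L[ℂ] H) : Prop :=
  ∀ (ι : Type u) (e : HilbertBasis ι ℂ H),
    Summable fun i : ι => (inner ℂ (e i) (CFC.abs T (e i))).re

/-- `T` has trace `τ`: for every orthonormal basis `(e_i)`, the sum `∑ ⟨T e_i, e_i⟩` converges
unconditionally to `τ`. (Mathlib's inner product is linear in its second argument.) -/
def HasTrace {H : Type u} [NormedAddCommGroup H] [InnerProductSpace ℂ H] [CompleteSpace H]
    (T : H →L[ℂ] H) (τ : ℂ) : Prop :=
  ∀ (ι : Type u) (e : HilbertBasis ι ℂ H), HasSum (fun i : ι => inner ℂ (e i) (T (e i))) τ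

end FourierExtension

end

noncomputable section

namespace FourierExtension

open Set ENNReal

/-! Write `w = |f̂σ|^(q-2)`. Unfolding the kernel gives `⟨g, T g⟩ = ∫ w |ĝσ|²`. Hence, as soon as
`w` is integrable, the kernel is bounded and continuous, `T` is bounded and positive, and `|T| = T`.
For each `z` the number `ĝσ(z)` is the inner product of `g` with a unimodular function, whose
squared norm is `ω_{d-1}`. Parseval gives `∑ |ê_iσ(z)|² = ω_{d-1}` for every orthonormal basis and
every `z`, and integrating against `w` gives the trace (`inner_isConvolutionOperator`,
`hasSum_integral_sphereTransform_sq`).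

The depth lies in the integrability of `w`, which is the Stein–Tomas extension theorem at the
endpoint `p = 2(d+1)/(d-1)`, the value of `q-2` at `q = 4d/(d-1)` (`memLp_sphereTransform`). Larger
`q` follow because `f̂σ` is bounded.

The endpoint is reached by real methods. Since `∑ ω_j² = 1`, it suffices to treat the measures `ω_j²
dσ`. By the `T T*` argument, restriction to such a measure is a bound for the bilinear form whose
kernel is its Fourier transform at `x - y`. Slice space along `x_j`. Between slices at distance
`|τ|` the kernel is at most `C |τ|^(-(d-1)/2)`, an `L¹ × L¹` bound. Because `|ω_j| dσ` projects to
Lebesgue measure on the hyperplane, Plancherel gives an `L² × L²` bound uniform in `τ`.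
Interpolation by layers (`bilinKernel_le`) yields `|τ|^(-α)` on `L^r × L^r`. At `r = p'` one has `α
= 2 - 2/r`, exactly the exponent of the diagonal Hardy–Littlewood–Sobolev inequality in `τ`
(`lintegral_lintegral_abs_sub_rpow_le`). Duality turns restriction into extension.

The decay of the kernel comes from an energy estimate for the Bessel equation satisfied by `∫
cos(r⟨ω,u⟩) dσ` (`energy_bound`). That equation itself follows from the invariance of `σ` under
reflections. -/

/-! ### Layer cake and fractional integration on the line -/

lemma lintegral_Ioc_rpow {s : ℝ} (hs : -1 < s) {δ : ℝ} (hδ : 0 ≤ δ) :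
    ∫⁻ t in Ioc 0 δ, ENNReal.ofReal (t ^ s) = ENNReal.ofReal (δ ^ (s + 1) / (s + 1)) := by
  rw [← ofReal_integral_eq_lintegral_ofReal]
  · rw [← intervalIntegral.integral_of_le hδ, integral_rpow (Or.inl hs),
      Real.zero_rpow (by linarith), sub_zero]
  · exact (intervalIntegral.intervalIntegrable_rpow' hs).1
  · filter_upwards [ae_restrict_mem measurableSet_Ioc] with t ht
    exact Real.rpow_nonneg ht.1.le _

/-- Split at distance `δ = |E|` from `s`. The near part is an explicit integral over an interval,
and on the far part the integrand is at most `δ^(-α)` on a set of measure at most `δ`. -/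
lemma lintegral_abs_sub_rpow_le {α : ℝ} (h0 : 0 < α) (h1 : α < 1) (s : ℝ) (E : Set ℝ) :
    ∫⁻ t in E, ENNReal.ofReal (|t - s| ^ (-α)) ≤
      ENNReal.ofReal (2 / (1 - α) + 1) * volume E ^ (1 - α) := by
  have hc : 0 < 2 / (1 - α) := by have : 0 < 1 - α := by linarith
                                  positivity
  rcases eq_or_ne (volume E) 0 with h | hE0
  · rw [Measure.restrict_eq_zero.2 h]; simp
  rcases eq_or_ne (volume E) ⊤ with h | hEt
  · rw [h, ENNReal.top_rpow_of_pos (by linarith), ENNReal.mul_top]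
    · exact le_top
    · rw [Ne, ENNReal.ofReal_eq_zero]; linarith
  set δ := (volume E).toReal with hδ
  have hδ0 : 0 < δ := ENNReal.toReal_pos hE0 hEt
  have hEδ : volume E = ENNReal.ofReal δ := (ENNReal.ofReal_toReal hEt).symm
  have key : ∫⁻ t in Icc (-δ) δ, ENNReal.ofReal (|t| ^ (-α))
      ≤ ENNReal.ofReal (2 / (1 - α)) * volume E ^ (1 - α) := by
    have hsub : Icc (-δ) δ ⊆ Ico (-δ) 0 ∪ (Ioc 0 δ ∪ {0}) := by
      intro t ht
      rcases lt_trichotomy t 0 with h | h | h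
      · exact Or.inl ⟨ht.1, h⟩
      · exact Or.inr (Or.inr h)
      · exact Or.inr (Or.inl ⟨h, ht.2⟩)
    have hp : ∫⁻ t in Ioc 0 δ, ENNReal.ofReal (|t| ^ (-α)) =
        ENNReal.ofReal (δ ^ (-α + 1) / (-α + 1)) := by
      rw [← lintegral_Ioc_rpow (by linarith) hδ0.le]
      refine setLIntegral_congr_fun measurableSet_Ioc fun t ht => ?_
      simp only [abs_of_pos ht.1]
    have hn : ∫⁻ t in Ico (-δ) 0, ENNReal.ofReal (|t| ^ (-α)) =
        ENNReal.ofReal (δ ^ (-α + 1) / (-α + 1)) := by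
      rw [← hp]
      have := (Measure.measurePreserving_neg (volume : Measure ℝ)).setLIntegral_comp_preimage_emb
        (MeasurableEquiv.neg ℝ).measurableEmbedding
        (fun t => ENNReal.ofReal (|t| ^ (-α))) (Ioc 0 δ)
      rw [← this]
      simp
    calc _ ≤ ∫⁻ t in Ico (-δ) 0 ∪ (Ioc 0 δ ∪ {0}), ENNReal.ofReal (|t| ^ (-α)) :=
          lintegral_mono_set hsub
      _ ≤ _ + (_ + _) := (lintegral_union_le _ _ _).trans
          (add_le_add le_rfl (lintegral_union_le _ _ _))
      _ = ENNReal.ofReal (δ ^ (-α + 1) / (-α + 1)) + ENNReal.ofReal (δ ^ (-α + 1) / (-α + 1)) := by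
          rw [hn, hp]; simp
      _ = _ := by
          rw [hEδ, ENNReal.ofReal_rpow_of_pos hδ0, ← ENNReal.ofReal_mul hc.le, neg_add_eq_sub,
            ← ENNReal.ofReal_add] <;>
          first
          | (congr 1; ring; done)
          | (have : 0 < 1 - α := by linarith
             positivity)
  have hsub : E ⊆ (fun t => t - s) ⁻¹' Icc (-δ) δ ∪ (E \ (fun t => t - s) ⁻¹' Icc (-δ) δ) := by
    rw [union_sdiff_self]; exact subset_union_right
  rw [ENNReal.ofReal_add hc.le zero_le_one, add_mul]
  refine (lintegral_mono_set hsub).trans ((lintegral_union_le _ _ _).trans (add_le_add ?_ ?_))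
  · refine le_trans (le_of_eq ?_) key
    exact (measurePreserving_sub_right volume s).setLIntegral_comp_preimage_emb
      (MeasurableEquiv.subRight s).measurableEmbedding (fun t => ENNReal.ofReal (|t| ^ (-α))) _
  · calc _ ≤ ∫⁻ t in (E \ (fun t => t - s) ⁻¹' Icc (-δ) δ), ENNReal.ofReal (δ ^ (-α)) := by
          refine setLIntegral_mono measurable_const fun t ht => ENNReal.ofReal_le_ofReal ?_
          refine Real.rpow_le_rpow_of_nonpos hδ0 ?_ (by linarith)
          by_contra hlt
          exact ht.2 (abs_le.1 (not_le.1 hlt).le)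
      _ ≤ ENNReal.ofReal (δ ^ (-α)) * volume E := by
          rw [setLIntegral_const]; gcongr; exact sdiff_subset
      _ = _ := by
          rw [hEδ, ENNReal.ofReal_rpow_of_pos hδ0, ENNReal.ofReal_one, one_mul,
            ← ENNReal.ofReal_mul (by positivity), ← Real.rpow_add_one hδ0.ne', neg_add_eq_sub]

lemma indicator_Iio_uncurry {X : Type*} (f : X → ℝ) :
    (fun p : X × ℝ => (Iio (f p.1)).indicator (1 : ℝ → ℝ≥0∞) p.2) =
      {p : X × ℝ | p.2 < f p.1}.indicator 1 := by
  ext p; simp [indicator]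

lemma measurable_indicator_Iio {X : Type*} [MeasurableSpace X] {f : X → ℝ} (hf : Measurable f) :
    Measurable (fun p : X × ℝ => (Iio (f p.1)).indicator (1 : ℝ → ℝ≥0∞) p.2) := by
  rw [indicator_Iio_uncurry]
  exact measurable_one.indicator (measurableSet_lt measurable_snd (hf.comp measurable_fst))

lemma lintegral_indicator_Iio_mul {X : Type*} [MeasurableSpace X] {μ : Measure X}
    {f : X → ℝ} (hf : Measurable f) (G : X → ℝ≥0∞) (a : ℝ) :
    ∫⁻ x, (Iio (f x)).indicator (1 : ℝ → ℝ≥0∞) a * G x ∂μ = ∫⁻ x in {x | a < f x}, G x ∂μ := by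
  rw [← lintegral_indicator (measurableSet_lt measurable_const hf)]
  refine lintegral_congr fun s => ?_
  by_cases h : a < f s <;> simp [h, indicator]

/-- The layer cake formula with a weight. -/
lemma lintegral_ofReal_mul_eq_lintegral_setLIntegral {X : Type*} [MeasurableSpace X]
    {μ : Measure X} [SFinite μ] {f : X → ℝ} (hf : Measurable f) {G : X → ℝ≥0∞}
    (hG : Measurable G) :
    ∫⁻ x, ENNReal.ofReal (f x) * G x ∂μ = ∫⁻ a in Ioi (0 : ℝ), ∫⁻ x in {x | a < f x}, G x ∂μ := by
  have h1 : ∀ c : ℝ, ∫⁻ a in Ioi (0 : ℝ), (Iio c).indicator (1 : ℝ → ℝ≥0∞) a =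
      ENNReal.ofReal c := fun c => by
    rw [lintegral_indicator_one measurableSet_Iio, Measure.restrict_apply measurableSet_Iio,
      inter_comm, Ioi_inter_Iio, Real.volume_Ioo, sub_zero]
  simp_rw [← lintegral_indicator_Iio_mul hf G]
  rw [lintegral_lintegral_swap]
  · refine lintegral_congr fun x => ?_
    rw [lintegral_mul_const _ (measurable_one.indicator measurableSet_Iio), h1]
  · exact (((measurable_indicator_Iio hf).comp measurable_swap).mul
      (hG.comp measurable_snd)).aemeasurable

lemma measurable_setLIntegral_lt {X Y : Type*} [MeasurableSpace X] [MeasurableSpace Y]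
    {μ : Measure X} [SFinite μ] {f : X → ℝ} (hf : Measurable f) {k : Y → X → ℝ≥0∞}
    (hk : Measurable (Function.uncurry k)) :
    Measurable (fun p : Y × ℝ => ∫⁻ x in {x | p.2 < f x}, k p.1 x ∂μ) := by
  simp_rw [← lintegral_indicator_Iio_mul hf]
  refine Measurable.lintegral_prod_right' (ν := μ) (f := fun q : (Y × ℝ) × X =>
    (Iio (f q.2)).indicator (1 : ℝ → ℝ≥0∞) q.1.2 * Function.uncurry k (q.1.1, q.2)) ?_
  exact ((measurable_indicator_Iio hf).comp
    (measurable_snd.prodMk (measurable_snd.comp measurable_fst))).mul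
    (hk.comp ((measurable_fst.comp measurable_fst).prodMk measurable_snd))

/-- Reduces a bilinear estimate to pairs of superlevel sets. -/
lemma lintegral_lintegral_mul_mul_eq_layer_cake {X Y : Type*} [MeasurableSpace X]
    [MeasurableSpace Y] {μ : Measure X} {ν : Measure Y} [SFinite μ] [SFinite ν] {f : X → ℝ}
    {g : Y → ℝ} (hf : Measurable f) (hg : Measurable g) {k : X → Y → ℝ≥0∞}
    (hk : Measurable (Function.uncurry k)) :
    ∫⁻ x, ∫⁻ y, ENNReal.ofReal (f x) * (ENNReal.ofReal (g y) * k x y) ∂ν ∂μ =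
      ∫⁻ a in Ioi (0 : ℝ), ∫⁻ b in Ioi (0 : ℝ),
        ∫⁻ x in {x | a < f x}, ∫⁻ y in {y | b < g y}, k x y ∂ν ∂μ := by
  have hm := measurable_setLIntegral_lt (μ := ν) hg hk
  have hk1 : ∀ x, Measurable (k x) := fun x => hk.comp measurable_prodMk_left
  calc _ = ∫⁻ x, ENNReal.ofReal (f x) *
        (∫⁻ b in Ioi (0 : ℝ), ∫⁻ y in {y | b < g y}, k x y ∂ν) ∂μ := by
        refine lintegral_congr fun x => ?_
        rw [lintegral_const_mul (ENNReal.ofReal (f x)) (f := fun y => ENNReal.ofReal (g y) * k x y)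
          (hg.ennreal_ofReal.mul (hk1 x)),
          lintegral_ofReal_mul_eq_lintegral_setLIntegral hg (hk1 x)]
    _ = _ := by
        rw [lintegral_ofReal_mul_eq_lintegral_setLIntegral hf
          (Measurable.lintegral_prod_right' (ν := volume.restrict (Ioi (0 : ℝ))) hm)]
        refine lintegral_congr fun a => ?_
        rw [lintegral_lintegral_swap hm.aemeasurable]

/-- Serves regions split along the diagonal or a hyperbola: the second half is stated with the roles
of the levels exchanged, and Tonelli exchanges them back. -/
lemma lintegral_lintegral_mul_add_swap {X : Type*} [MeasurableSpace X] {μ : Measure X} [SFinite μ]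
    {F G : X → X → ℝ≥0∞} (hF : Measurable (Function.uncurry F))
    (hG : Measurable (Function.uncurry G)) (c : ℝ≥0∞) :
    ∫⁻ a, ∫⁻ b, c * (F a b + G b a) ∂μ ∂μ =
      c * (∫⁻ a, ∫⁻ b, F a b ∂μ ∂μ) + c * (∫⁻ a, ∫⁻ b, G a b ∂μ ∂μ) := by
  have h1 : ∀ a, Measurable (F a) := fun a => hF.comp measurable_prodMk_left
  have h2 : ∀ b, Measurable fun a => G a b := fun b => hG.comp measurable_prodMk_right
  have e : ∀ a, ∫⁻ b, c * (F a b + G b a) ∂μ = c * (∫⁻ b, F a b ∂μ + ∫⁻ b, G b a ∂μ) := fun a => by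
    rw [← lintegral_add_left (h1 a)]
    exact lintegral_const_mul c ((h1 a).add (h2 a))
  have m1 : Measurable fun a => ∫⁻ b, F a b ∂μ := Measurable.lintegral_prod_right' hF
  have m2 : Measurable fun a => ∫⁻ b, G b a ∂μ := Measurable.lintegral_prod_left' hG
  simp_rw [e]
  refine (lintegral_const_mul c (m1.add m2)).trans ?_
  simp only [Pi.add_apply]
  rw [lintegral_add_left m1, mul_add]
  congr 2
  exact lintegral_lintegral_swap (f := fun a b => G b a) (hG.comp measurable_swap).aemeasurable

/-- Hardy–Littlewood–Sobolev inequality on the line, in the diagonal case. -/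
theorem lintegral_lintegral_abs_sub_rpow_le {r α : ℝ} (hr1 : 1 < r) (hr2 : r < 2)
    (hα : α = 2 - 2 / r) :
    ∃ C : ℝ, 0 < C ∧ ∀ f : ℝ → ℝ, Measurable f → (∀ s, 0 ≤ f s) →
      ∫⁻ s, ∫⁻ t, ENNReal.ofReal (f s) * (ENNReal.ofReal (f t) *
        ENNReal.ofReal (|t - s| ^ (-α))) ≤
      ENNReal.ofReal C * (∫⁻ s, ENNReal.ofReal (f s ^ r)) ^ (2 / r) := by
  have hr0 : 0 < r := by linarith
  have hα0 : 0 < α := by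
    rw [hα, sub_pos, div_lt_iff₀ hr0]; linarith
  have hα1 : α < 1 := by
    have : 1 < 2 / r := by rw [lt_div_iff₀ hr0]; linarith
    linarith
  -- This exponent identity turns the Chebyshev bound `u b ≤ Y b^(-r)` into `b^(r-2)`, which is
  -- integrable at `0` because `r > 1`.
  have h1α : r * (1 - α) = 2 - r := by rw [hα]; field_simp; ring
  set c₀ := 2 / (1 - α) + 1 with hc₀
  have hc₀0 : 0 < c₀ := by have : 0 < 1 - α := by linarith
                           positivity
  refine ⟨2 * c₀ * (1 / (r - 1)) * (1 / r), by have : 0 < r - 1 := by linarith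
                                               positivity, fun f hf hf0 => ?_⟩
  set Y := ∫⁻ s, ENNReal.ofReal (f s ^ r) with hY
  set u : ℝ → ℝ≥0∞ := fun a => volume {s | a < f s} with hu
  set k : ℝ → ℝ → ℝ≥0∞ := fun s t => ENNReal.ofReal (|t - s| ^ (-α)) with hk
  have hkm : Measurable (Function.uncurry k) := by
    simp only [hk, Function.uncurry_def]; fun_prop
  have hum : Measurable u := by
    have : Antitone u := fun a b hab => measure_mono fun s hs => lt_of_le_of_lt hab hs
    exact this.measurable
  set J : ℝ → ℝ → ℝ≥0∞ := fun a b => ∫⁻ s in {s | a < f s}, ∫⁻ t in {t | b < f t}, k s t with hJ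
  have hQ : ∫⁻ s, ∫⁻ t, ENNReal.ofReal (f s) * (ENNReal.ofReal (f t) * k s t) =
      ∫⁻ a in Ioi 0, ∫⁻ b in Ioi 0, J a b :=
    lintegral_lintegral_mul_mul_eq_layer_cake hf hf hkm
  have hJ1 : ∀ a b, J a b ≤ ENNReal.ofReal c₀ * (u a * u b ^ (1 - α)) := by
    intro a b
    calc _ ≤ ∫⁻ s in {s | a < f s}, ENNReal.ofReal c₀ * u b ^ (1 - α) := by
          refine lintegral_mono fun s => ?_
          exact lintegral_abs_sub_rpow_le hα0 hα1 s _
      _ = _ := by rw [setLIntegral_const]; ring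
  have hJsymm : ∀ a b, J a b = J b a := by
    intro a b
    simp only [hJ]
    rw [lintegral_lintegral_swap hkm.aemeasurable]
    simp only [hk, abs_sub_comm]
  have hcheb : ∀ b, 0 < b → u b ≤ Y * ENNReal.ofReal (b ^ (-r)) := by
    intro b hb
    have h := mul_meas_ge_le_lintegral (μ := volume)
      (f := fun s => ENNReal.ofReal (f s ^ r)) (by fun_prop) (ENNReal.ofReal (b ^ r))
    have hb' : u b ≤ volume {s | ENNReal.ofReal (b ^ r) ≤ ENNReal.ofReal (f s ^ r)} :=
      measure_mono fun s hs => ENNReal.ofReal_le_ofReal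
        (Real.rpow_le_rpow hb.le (le_of_lt hs) hr0.le)
    have hbr : (0 : ℝ) < b ^ r := by positivity
    calc u b = ENNReal.ofReal (b ^ (-r)) * (ENNReal.ofReal (b ^ r) * u b) := by
          rw [← mul_assoc, ← ENNReal.ofReal_mul (by positivity), ← Real.rpow_add hb]; simp
      _ ≤ ENNReal.ofReal (b ^ (-r)) * Y := by gcongr; exact (mul_le_mul_right hb' _).trans h
      _ = _ := mul_comm _ _
  have hin : ∀ a, 0 < a → ∫⁻ b in Ioc 0 a, u b ^ (1 - α) ≤
      Y ^ (1 - α) * ENNReal.ofReal (a ^ (r - 1) / (r - 1)) := by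
    intro a ha
    calc _ ≤ ∫⁻ b in Ioc 0 a, Y ^ (1 - α) * ENNReal.ofReal (b ^ (r - 2)) := by
          refine setLIntegral_mono (by fun_prop) fun b hb => ?_
          refine (ENNReal.rpow_le_rpow (hcheb b hb.1) (by linarith)).trans (le_of_eq ?_)
          rw [ENNReal.mul_rpow_of_nonneg _ _ (by linarith),
            ENNReal.ofReal_rpow_of_nonneg (by have := hb.1; positivity) (by linarith),
            ← Real.rpow_mul hb.1.le, neg_mul, h1α, neg_sub]
      _ = _ := by
          rw [lintegral_const_mul _ (by fun_prop), lintegral_Ioc_rpow (by linarith) ha.le]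
          congr 3 <;> ring_nf
  -- The inner integral leaves `a^(r-1)`, so that `u a` integrates to `Y / r` by the layer cake; the
  -- powers of `Y` add up to `(1 - α) + 1 = 2 / r`.
  have hmain : ∫⁻ a in Ioi 0, ∫⁻ b in Ioc 0 a, u a * u b ^ (1 - α) ≤
      ENNReal.ofReal (1 / (r - 1) * (1 / r)) * Y ^ (2 / r) := by
    have hYr : Y = ENNReal.ofReal r * ∫⁻ a in Ioi 0, u a * ENNReal.ofReal (a ^ (r - 1)) :=
      lintegral_rpow_eq_lintegral_meas_lt_mul volume (Filter.Eventually.of_forall hf0)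
        hf.aemeasurable hr0
    calc _ ≤ ∫⁻ a in Ioi 0, (Y ^ (1 - α) * ENNReal.ofReal (1 / (r - 1))) *
            (u a * ENNReal.ofReal (a ^ (r - 1))) := by
          refine setLIntegral_mono (by fun_prop) fun a ha => ?_
          rw [lintegral_const_mul _ (by fun_prop)]
          refine (mul_le_mul_right (hin a ha) _).trans (le_of_eq ?_)
          rw [div_eq_mul_one_div, ENNReal.ofReal_mul (by have : (0:ℝ) < a := ha
                                                         positivity)]
          ring
      _ = Y ^ (1 - α) * ENNReal.ofReal (1 / (r - 1)) * (ENNReal.ofReal (1 / r) * Y) := by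
          rw [lintegral_const_mul _ (by fun_prop)]
          congr 1
          rw [hYr, ← mul_assoc, ← ENNReal.ofReal_mul (by positivity), one_div_mul_cancel hr0.ne']
          simp
      _ = _ := by
          have h2 : 2 / r = (1 - α) + 1 := by rw [hα]; ring
          rw [h2, ENNReal.rpow_add_of_nonneg _ _ (by linarith) (by linarith), ENNReal.rpow_one,
            ENNReal.ofReal_mul (by have : 0 < r - 1 := by linarith
                                   positivity)]
          ring
  -- By symmetry of `J` the fractional power can always be put on the set at the lower level; this
  -- is the arrangement in which the integral over the lower level converges.
  have hregion : ∀ a b, 0 < a → 0 < b → J a b ≤ ENNReal.ofReal c₀ *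
      ((Ioc 0 a).indicator (fun b => u a * u b ^ (1 - α)) b +
        (Ioc 0 b).indicator (fun a => u b * u a ^ (1 - α)) a) := by
    intro a b ha hb
    rcases le_total b a with h | h
    · refine (hJ1 a b).trans (mul_le_mul_right ?_ _)
      rw [indicator_of_mem (show b ∈ Ioc 0 a from ⟨hb, h⟩)]
      exact le_self_add
    · rw [hJsymm]
      refine (hJ1 b a).trans (mul_le_mul_right ?_ _)
      rw [indicator_of_mem (show a ∈ Ioc 0 b from ⟨ha, h⟩)]
      exact le_add_self
  have hind : Measurable (fun p : ℝ × ℝ =>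
      (Ioc 0 p.1).indicator (fun b => u p.1 * u b ^ (1 - α)) p.2) := by
    have : (fun p : ℝ × ℝ => (Ioc 0 p.1).indicator (fun b => u p.1 * u b ^ (1 - α)) p.2) =
        {p : ℝ × ℝ | 0 < p.2 ∧ p.2 ≤ p.1}.indicator (fun p => u p.1 * u p.2 ^ (1 - α)) := by
      ext p; simp [indicator]
    rw [this]
    refine Measurable.indicator (by fun_prop) ?_
    exact (measurableSet_lt measurable_const measurable_snd).inter
      (measurableSet_le measurable_snd measurable_fst)
  have hone : ∀ a, ∫⁻ b in Ioi 0, (Ioc 0 a).indicator (fun b => u a * u b ^ (1 - α)) b =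
      ∫⁻ b in Ioc 0 a, u a * u b ^ (1 - α) := fun a => by
    rw [lintegral_indicator measurableSet_Ioc, Measure.restrict_restrict measurableSet_Ioc,
      inter_eq_left.2 Ioc_subset_Ioi_self]
  rw [hQ]
  calc _ ≤ ∫⁻ a in Ioi 0, ∫⁻ b in Ioi 0, ENNReal.ofReal c₀ *
      ((Ioc 0 a).indicator (fun b => u a * u b ^ (1 - α)) b +
        (Ioc 0 b).indicator (fun a => u b * u a ^ (1 - α)) a) := by
        refine lintegral_mono_ae ?_
        filter_upwards [ae_restrict_mem measurableSet_Ioi] with a ha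
        refine lintegral_mono_ae ?_
        filter_upwards [ae_restrict_mem measurableSet_Ioi] with b hb
        exact hregion a b ha hb
    _ = ENNReal.ofReal c₀ * (∫⁻ a in Ioi 0, ∫⁻ b in Ioc 0 a, u a * u b ^ (1 - α)) +
        ENNReal.ofReal c₀ * (∫⁻ a in Ioi 0, ∫⁻ b in Ioc 0 a, u a * u b ^ (1 - α)) := by
        rw [lintegral_lintegral_mul_add_swap
          (F := fun a b => (Ioc 0 a).indicator (fun b => u a * u b ^ (1 - α)) b)
          (G := fun a b => (Ioc 0 a).indicator (fun b => u a * u b ^ (1 - α)) b) hind hind]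
        simp only [hone]
    _ ≤ _ := by
        rw [← two_mul]
        refine (mul_le_mul_right (mul_le_mul_right hmain _) _).trans (le_of_eq ?_)
        rw [mul_assoc (2 * c₀), ENNReal.ofReal_mul (by positivity : (0:ℝ) ≤ 2 * c₀),
          ENNReal.ofReal_mul zero_le_two, ENNReal.ofReal_ofNat]
        ring

/-! ### Real interpolation of bilinear forms by layers -/

/-- Double integral bound from a hyperbolic truncation of the level parameters. -/
lemma lintegral_lintegral_le_of_le_mul_of_le_sqrt {r : ℝ} (hr1 : 1 < r) (hr2 : r < 2)
    {A D : ℝ} (hA : 0 < A) (hD : 0 < D) {u v : ℝ → ℝ≥0∞} (hu : Measurable u) (hv : Measurable v)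
    (hX : ∫⁻ a in Ioi (0 : ℝ), u a * ENNReal.ofReal (a ^ (r - 1)) ≤ 1)
    (hY : ∫⁻ a in Ioi (0 : ℝ), v a * ENNReal.ofReal (a ^ (r - 1)) ≤ 1)
    {M : ℝ → ℝ → ℝ≥0∞} (h1 : ∀ a b, 0 < a → 0 < b → M a b ≤ ENNReal.ofReal A * (u a * v b))
    (h2 : ∀ a b, 0 < a → 0 < b → M a b ≤ ENNReal.ofReal D * (u a * v b) ^ (1 / 2 : ℝ)) :
    ∫⁻ a in Ioi (0 : ℝ), ∫⁻ b in Ioi (0 : ℝ), M a b ≤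
      ENNReal.ofReal ((1 + 2 * D / (1 - r / 2)) * A ^ (2 / r - 1)) := by
  have hr0 : 0 < r := by linarith
  have hs0 : 0 < 1 - r / 2 := by linarith
  -- The threshold for `a * b` is chosen so that both regions cost the same: `A * L^(1-r)` and
  -- `L^(1-r/2)` are both `A^(2/r-1)`.
  set L : ℝ := A ^ (2 / r) with hL
  have hL0 : 0 < L := by positivity
  set p : ℝ → ℝ≥0∞ := fun a => ENNReal.ofReal (a ^ (r - 1)) with hp
  -- Since `w a b * w b a = 1`, the geometric mean of `u a` and `v b` is at most `u a * w a b + v b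
  -- * w b a`. The exponent `r / 2` makes the integral of `w a b` over `b ≤ L / a` a multiple of
  -- `a^(r-1)`.
  set w : ℝ → ℝ → ℝ≥0∞ := fun a b => ENNReal.ofReal (a ^ (r / 2)) * ENNReal.ofReal (b ^ (-(r / 2)))
    with hw
  set G : (ℝ → ℝ≥0∞) → ℝ → ℝ → ℝ≥0∞ := fun u a b =>
    {x : ℝ × ℝ | 0 < x.2 ∧ x.2 ≤ L / x.1}.indicator (fun x => u x.1 * w x.1 x.2) (a, b) with hG
  have hwm : Measurable (fun x : ℝ × ℝ => w x.1 x.2) := by simp only [hw]; fun_prop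
  have hGm : ∀ u : ℝ → ℝ≥0∞, Measurable u → Measurable (Function.uncurry (G u)) := by
    intro u hu
    refine Measurable.indicator ((hu.comp measurable_fst).mul hwm) ?_
    exact (measurableSet_lt measurable_const measurable_snd).inter
      (measurableSet_le measurable_snd (by fun_prop))
  have hGint : ∀ u : ℝ → ℝ≥0∞, Measurable u →
      ∫⁻ a in Ioi (0 : ℝ), u a * p a ≤ 1 →
      ∫⁻ a in Ioi (0 : ℝ), ∫⁻ b in Ioi (0 : ℝ), G u a b ≤
        ENNReal.ofReal (A ^ (2 / r - 1) / (1 - r / 2)) := by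
    intro u hu hX
    calc _ ≤ ∫⁻ a in Ioi (0 : ℝ), ENNReal.ofReal (A ^ (2 / r - 1) / (1 - r / 2)) * (u a * p a) := by
          refine lintegral_mono_ae ?_
          filter_upwards [ae_restrict_mem measurableSet_Ioi] with a ha
          have ha : 0 < a := ha
          have e : ∀ b, G u a b = (Ioc 0 (L / a)).indicator
              (fun b => u a * ENNReal.ofReal (a ^ (r / 2)) * ENNReal.ofReal (b ^ (-(r / 2)))) b := by
            intro b
            simp only [hG, indicator, mem_ofPred_eq, mem_Ioc, hw, mul_assoc]
          simp_rw [e]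
          rw [lintegral_indicator measurableSet_Ioc, Measure.restrict_restrict measurableSet_Ioc,
            inter_eq_left.2 Ioc_subset_Ioi_self, lintegral_const_mul _ (by fun_prop),
            lintegral_Ioc_rpow (by linarith) (by positivity), mul_assoc,
            ← ENNReal.ofReal_mul (by positivity), ← mul_assoc, mul_comm _ (u a), mul_assoc,
            ← ENNReal.ofReal_mul (by positivity)]
          refine mul_le_mul_right (ENNReal.ofReal_le_ofReal (le_of_eq ?_)) _
          rw [neg_add_eq_sub, Real.div_rpow hL0.le ha.le, hL, ← Real.rpow_mul hA.le]
          have e1 : 2 / r * (1 - r / 2) = 2 / r - 1 := by field_simp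
          have e2 : a ^ (r / 2) = a ^ (r - 1) * a ^ (1 - r / 2) := by
            rw [← Real.rpow_add ha]; congr 1; ring
          rw [e1, e2]
          have : a ^ (1 - r / 2) ≠ 0 := by positivity
          field_simp
      _ ≤ _ := by
          rw [lintegral_const_mul _ (by fun_prop)]
          exact (mul_le_mul_right hX _).trans (by rw [mul_one])
  have hpt : ∀ a b, 0 < a → 0 < b → M a b ≤
      ENNReal.ofReal (A * L ^ (1 - r)) * ((u a * p a) * (v b * p b)) +
        ENNReal.ofReal D * (G u a b + G v b a) := by
    intro a b ha hb
    rcases lt_or_ge L (a * b) with hab | hab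
    · refine (h1 a b ha hb).trans (le_add_right ?_)
      -- Beyond the hyperbola `(a * b / L)^(r-1) ≥ 1`, and inserting this factor makes the first
      -- bound a product of two normalized integrands.
      have : (1 : ℝ) ≤ L ^ (1 - r) * (a ^ (r - 1) * b ^ (r - 1)) := by
        rw [← Real.mul_rpow ha.le hb.le, ← neg_sub r 1, Real.rpow_neg hL0.le, inv_mul_eq_div,
          one_le_div (by positivity)]
        exact Real.rpow_le_rpow hL0.le hab.le (by linarith)
      calc ENNReal.ofReal A * (u a * v b) = ENNReal.ofReal (A * 1) * (u a * v b) := by rw [mul_one]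
        _ ≤ ENNReal.ofReal (A * (L ^ (1 - r) * (a ^ (r - 1) * b ^ (r - 1)))) * (u a * v b) := by
            gcongr
        _ = _ := by
            rw [← mul_assoc A, ENNReal.ofReal_mul (by positivity : 0 ≤ A * L ^ (1 - r)),
              ENNReal.ofReal_mul (by positivity : 0 ≤ a ^ (r - 1))]
            simp only [hp]; ring
    · refine (h2 a b ha hb).trans (le_add_left (mul_le_mul_right ?_ _))
      have hba : b ≤ L / a := by rw [le_div_iff₀ ha]; linarith
      have hab' : a ≤ L / b := by rw [le_div_iff₀ hb]; linarith
      have e1 : G u a b = u a * w a b := 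
        indicator_of_mem (s := {x : ℝ × ℝ | 0 < x.2 ∧ x.2 ≤ L / x.1}) (a := (a, b)) ⟨hb, hba⟩ _
      have e2 : G v b a = v b * w b a := 
        indicator_of_mem (s := {x : ℝ × ℝ | 0 < x.2 ∧ x.2 ≤ L / x.1}) (a := (b, a)) ⟨ha, hab'⟩ _
      have hww : w a b * w b a = 1 := by
        simp only [hw]
        rw [← ENNReal.ofReal_mul (by positivity), ← ENNReal.ofReal_mul (by positivity),
          ← ENNReal.ofReal_mul (by positivity), Real.rpow_neg ha.le, Real.rpow_neg hb.le]
        rw [ENNReal.ofReal_eq_one]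
        field_simp
      have e3 : u a * v b = (u a * w a b) * (v b * w b a) := by
        calc u a * v b = u a * v b * (w a b * w b a) := by rw [hww, mul_one]
          _ = _ := by ring
      rw [e1, e2, e3]
      set x := u a * w a b
      set y := v b * w b a
      have hxy : x * y ≤ (x + y) ^ (2 : ℝ) := by
        rw [ENNReal.rpow_two, sq]; exact mul_le_mul' le_self_add le_add_self
      calc (x * y) ^ (1 / 2 : ℝ) ≤ ((x + y) ^ (2 : ℝ)) ^ (1 / 2 : ℝ) :=
            ENNReal.rpow_le_rpow hxy (by norm_num)
        _ = x + y := by rw [← ENNReal.rpow_mul]; norm_num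
  have hAL : A * L ^ (1 - r) = A ^ (2 / r - 1) := by
    rw [hL, ← Real.rpow_mul hA.le]
    conv_lhs => rw [← Real.rpow_one A, ← Real.rpow_mul hA.le, one_mul]
    rw [← Real.rpow_add hA]
    congr 1; field_simp; ring
  calc _ ≤ ∫⁻ a in Ioi (0 : ℝ), ∫⁻ b in Ioi (0 : ℝ),
        (ENNReal.ofReal (A * L ^ (1 - r)) * ((u a * p a) * (v b * p b)) +
        ENNReal.ofReal D * (G u a b + G v b a)) := by
        refine lintegral_mono_ae ?_
        filter_upwards [ae_restrict_mem measurableSet_Ioi] with a ha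
        refine lintegral_mono_ae ?_
        filter_upwards [ae_restrict_mem measurableSet_Ioi] with b hb
        exact hpt a b ha hb
    _ = ∫⁻ a in Ioi (0 : ℝ), ((ENNReal.ofReal (A * L ^ (1 - r)) * (u a * p a)) *
          (∫⁻ b in Ioi (0 : ℝ), v b * p b) +
          ∫⁻ b in Ioi (0 : ℝ), ENNReal.ofReal D * (G u a b + G v b a)) := by
        refine lintegral_congr fun a => ?_
        rw [lintegral_add_left (by fun_prop)]
        simp_rw [← mul_assoc _ (u a * p a)]
        rw [lintegral_const_mul _ (by fun_prop)]
    _ ≤ ENNReal.ofReal (A * L ^ (1 - r)) +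
        (ENNReal.ofReal D * ENNReal.ofReal (A ^ (2 / r - 1) / (1 - r / 2)) +
        ENNReal.ofReal D * ENNReal.ofReal (A ^ (2 / r - 1) / (1 - r / 2))) := by
        rw [lintegral_add_left (by fun_prop), lintegral_mul_const _ (by fun_prop),
          lintegral_const_mul _ (by fun_prop)]
        refine add_le_add ?_ ?_
        · calc _ ≤ ENNReal.ofReal (A * L ^ (1 - r)) * 1 * 1 := by gcongr
            _ = _ := by simp
        · rw [lintegral_lintegral_mul_add_swap (hGm u hu) (hGm v hv)]
          exact add_le_add (mul_le_mul_right (hGint u hu hX) _)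
            (mul_le_mul_right (hGint v hv hY) _)
    _ = _ := by
        rw [hAL, ← ENNReal.ofReal_mul hD.le, ← ENNReal.ofReal_add (by positivity) (by positivity),
          ← ENNReal.ofReal_add (by positivity) (by positivity)]
        congr 1; ring

/-- The phase of `f` cut off to the set where `a < ‖f‖`. -/
def phaseCut {X : Type*} (f : X → ℂ) (a : ℝ) (x : X) : ℂ :=
  (Iio ‖f x‖).indicator (fun _ => f x / ‖f x‖) a

lemma phaseCut_eq {X : Type*} (f : X → ℂ) (a : ℝ) :
    phaseCut f a = {x | a < ‖f x‖}.indicator fun x => f x / ‖f x‖ := by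
  ext x; simp [phaseCut, indicator]

/-- A layer cake that keeps the phase: the constant `f x / ‖f x‖` is integrated over levels of total
length `‖f x‖`. The layers are bounded by indicators, so only restricted estimates are needed for
them. -/
lemma integral_phaseCut {X : Type*} (f : X → ℂ) (x : X) : ∫ a in Ioi (0 : ℝ), phaseCut f a x = f x := by
  simp only [phaseCut]
  rw [integral_indicator measurableSet_Iio, Measure.restrict_restrict measurableSet_Iio,
    inter_comm, Ioi_inter_Iio, setIntegral_const]
  rcases eq_or_ne (f x) 0 with h | h
  · simp [h]
  · have : (‖f x‖ : ℂ) ≠ 0 := by simpa using h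
    simp; field_simp

lemma enorm_phaseCut_le {X : Type*} (f : X → ℂ) (a : ℝ) (x : X) :
    ‖phaseCut f a x‖ₑ ≤ {x | a < ‖f x‖}.indicator 1 x := by
  rw [phaseCut_eq]
  by_cases h : a < ‖f x‖
  · simp only [indicator, mem_ofPred_eq, h, if_true, Pi.one_apply]
    rw [← ofReal_norm, ENNReal.ofReal_le_one, norm_div, Complex.norm_real, norm_norm]
    exact div_self_le_one _
  · simp [indicator, h]

section phaseCut

variable {X : Type*} [MeasurableSpace X] {μ : Measure X} {f : X → ℂ}

lemma measurable_phaseCut_uncurry (hf : Measurable f) :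
    Measurable fun p : ℝ × X => phaseCut f p.1 p.2 := by
  have : (fun p : ℝ × X => phaseCut f p.1 p.2) =
      {p : ℝ × X | p.1 < ‖f p.2‖}.indicator fun p => f p.2 / ‖f p.2‖ := by
    ext p; simp [phaseCut, indicator]
  rw [this]
  exact Measurable.indicator (by fun_prop)
    (measurableSet_lt measurable_fst (by fun_prop))

lemma measurable_phaseCut (hf : Measurable f) (a : ℝ) : Measurable (phaseCut f a) :=
  (measurable_phaseCut_uncurry hf).comp measurable_prodMk_left

lemma lintegral_meas_lt_norm (hf : Measurable f) :
    ∫⁻ a in Ioi (0 : ℝ), μ {x | a < ‖f x‖} = ∫⁻ x, ‖f x‖ₑ ∂μ := by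
  rw [← lintegral_eq_lintegral_meas_lt μ (Filter.Eventually.of_forall fun x => norm_nonneg (f x))
    hf.norm.aemeasurable]
  simp

lemma integrable_phaseCut_prod [SFinite μ] (hf : Measurable f) (hfi : Integrable f μ) :
    Integrable (fun p : ℝ × X => phaseCut f p.1 p.2) ((volume.restrict (Ioi 0)).prod μ) := by
  refine ⟨(measurable_phaseCut_uncurry hf).aestronglyMeasurable, ?_⟩
  rw [HasFiniteIntegral, lintegral_prod _ (measurable_phaseCut_uncurry hf).enorm.aemeasurable]
  calc _ ≤ ∫⁻ a in Ioi (0 : ℝ), μ {x | a < ‖f x‖} := by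
        refine lintegral_mono fun a => ?_
        rw [← lintegral_indicator_one (measurableSet_lt measurable_const hf.norm)]
        exact lintegral_mono (enorm_phaseCut_le f a)
    _ < ⊤ := by
        rw [lintegral_meas_lt_norm hf]; exact hfi.2

lemma enorm_integral_mul_le_lintegral_phaseCut [SFinite μ] (hf : Measurable f)
    (hfi : Integrable f μ) {H : X → ℂ} (hH : Measurable H) {B : ℝ} (hB : ∀ x, ‖H x‖ ≤ B) :
    ‖∫ x, f x * H x ∂μ‖ₑ ≤ ∫⁻ a in Ioi (0 : ℝ), ‖∫ x, phaseCut f a x * H x ∂μ‖ₑ := by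
  have e : ∫ x, f x * H x ∂μ = ∫ a in Ioi (0 : ℝ), ∫ x, phaseCut f a x * H x ∂μ := by
    rw [integral_integral_swap]
    · refine integral_congr_ae (Filter.Eventually.of_forall fun x => ?_)
      simp only
      rw [integral_mul_const, integral_phaseCut]
    · exact (integrable_phaseCut_prod hf hfi).mul_bdd (c := B)
        (hH.comp measurable_snd).aestronglyMeasurable
        (Filter.Eventually.of_forall fun p => hB p.2)
  rw [e]
  exact enorm_integral_le_lintegral_enorm _

/-- The bilinear form with kernel `k`. -/
def bilinKernel (μ : Measure X) (k : X → X → ℂ) (f g : X → ℂ) : ℂ :=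
  ∫ x, f x * ∫ y, g y * k x y ∂μ ∂μ

lemma bilinKernel_swap [SFinite μ] {k : X → X → ℂ} (hk : Measurable (Function.uncurry k)) {A : ℝ}
    (hA : ∀ x y, ‖k x y‖ ≤ A) {f g : X → ℂ} (hf : Integrable f μ) (hg : Integrable g μ) :
    bilinKernel μ k f g = ∫ y, g y * ∫ x, f x * k x y ∂μ ∂μ := by
  unfold bilinKernel
  simp_rw [← integral_const_mul]
  rw [integral_integral_swap]
  · simp_rw [← mul_assoc, mul_comm (f _)]
  · have := (hf.mul_prod hg).mul_bdd (c := A) hk.aestronglyMeasurable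
      (Filter.Eventually.of_forall fun p => hA p.1 p.2)
    simpa only [Function.uncurry_def, mul_assoc] using this

lemma norm_integral_mul_kernel_le {g h : X → ℂ} {A : ℝ} (hg : Integrable g μ)
    (hA : ∀ y, ‖h y‖ ≤ A) : ‖∫ y, g y * h y ∂μ‖ ≤ (∫ y, ‖g y‖ ∂μ) * A := by
  rw [← integral_mul_const]
  refine norm_integral_le_of_norm_le (hg.norm.mul_const A) (Filter.Eventually.of_forall fun y => ?_)
  rw [norm_mul]
  exact mul_le_mul_of_nonneg_left (hA y) (norm_nonneg _)

lemma lintegral_meas_lt_norm_mul_rpow (hf : Measurable f) {r : ℝ} (hr : 0 < r) :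
    ∫⁻ a in Ioi (0 : ℝ), μ {x | a < ‖f x‖} * ENNReal.ofReal (a ^ (r - 1)) =
      ENNReal.ofReal (1 / r) * ∫⁻ x, ‖f x‖ₑ ^ r ∂μ := by
  have h := lintegral_rpow_eq_lintegral_meas_lt_mul μ
    (Filter.Eventually.of_forall fun x => norm_nonneg (f x)) hf.norm.aemeasurable hr
  have e : ∀ x, ‖f x‖ₑ ^ r = ENNReal.ofReal (‖f x‖ ^ r) := fun x => by
    rw [← ofReal_norm, ENNReal.ofReal_rpow_of_nonneg (norm_nonneg _) hr.le]
  simp_rw [e]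
  rw [h, ← mul_assoc, ← ENNReal.ofReal_mul (by positivity), one_div_mul_cancel hr.ne']
  simp

lemma integrable_phaseCut [SFinite μ] (hf : Measurable f) (hfi : Integrable f μ) {a : ℝ}
    (ha : 0 < a) : Integrable (phaseCut f a) μ := by
  refine ⟨(measurable_phaseCut hf a).aestronglyMeasurable, ?_⟩
  refine (lintegral_mono (enorm_phaseCut_le f a)).trans_lt ?_
  rw [lintegral_indicator_one (measurableSet_lt measurable_const hf.norm)]
  exact hfi.measure_norm_gt_lt_top ha

/-- Cut both functions into layers. A pair of layers satisfies the trivial bound by `A` times the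
product of the measures and the assumed bound by `D` times its square root; the hyperbolic
truncation sums the smaller of the two. -/
lemma bilinKernel_le_of_normalized [SFinite μ] {r : ℝ} (hr1 : 1 < r) (hr2 : r < 2)
    {A D : ℝ} (hA0 : 0 < A) (hD : 0 < D) {k : X → X → ℂ} (hk : Measurable (Function.uncurry k))
    (hA : ∀ x y, ‖k x y‖ ≤ A)
    (hL2 : ∀ (f g : X → ℂ) (E E' : Set X), Measurable f → Measurable g → MeasurableSet E →
      MeasurableSet E' → μ E < ⊤ → μ E' < ⊤ → (∀ x, ‖f x‖ₑ ≤ E.indicator 1 x) →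
      (∀ x, ‖g x‖ₑ ≤ E'.indicator 1 x) →
      ‖bilinKernel μ k f g‖ₑ ≤ ENNReal.ofReal D * (μ E * μ E') ^ (1 / 2 : ℝ))
    {f g : X → ℂ} (hf : Measurable f) (hg : Measurable g) (hfi : Integrable f μ)
    (hgi : Integrable g μ) (hf1 : ∫⁻ x, ‖f x‖ₑ ^ r ∂μ ≤ 1) (hg1 : ∫⁻ x, ‖g x‖ₑ ^ r ∂μ ≤ 1) :
    ‖bilinKernel μ k f g‖ₑ ≤ ENNReal.ofReal ((1 + 2 * D / (1 - r / 2)) * A ^ (2 / r - 1)) := by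
  have hr0 : 0 < r := by linarith
  set u : ℝ → ℝ≥0∞ := fun a => μ {x | a < ‖f x‖} with hu
  set v : ℝ → ℝ≥0∞ := fun a => μ {x | a < ‖g x‖} with hv
  have hanti : ∀ f : X → ℂ, Measurable fun a : ℝ => μ {x | a < ‖f x‖} := fun f => by
    have : Antitone fun a : ℝ => μ {x | a < ‖f x‖} :=
      fun a b hab => measure_mono fun s hs => lt_of_le_of_lt hab hs
    exact this.measurable
  have hle : ENNReal.ofReal (1 / r) ≤ 1 := by
    rw [ENNReal.ofReal_le_one, div_le_one hr0]; exact hr1.le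
  have hHm : ∀ g : X → ℂ, Measurable g → Measurable fun x => ∫ y, g y * k x y ∂μ := fun g hg => by
    have : Measurable fun p : X × X => g p.2 * k p.1 p.2 := (hg.comp measurable_snd).mul hk
    exact this.stronglyMeasurable.integral_prod_right'.measurable
  have hHm' : ∀ f : X → ℂ, Measurable f → Measurable fun y => ∫ x, f x * k x y ∂μ := fun f hf => by
    have : Measurable fun p : X × X => f p.1 * k p.1 p.2 := (hf.comp measurable_fst).mul hk
    exact this.stronglyMeasurable.integral_prod_left'.measurable
  have step1 : ‖bilinKernel μ k f g‖ₑ ≤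
      ∫⁻ a in Ioi (0 : ℝ), ‖bilinKernel μ k (phaseCut f a) g‖ₑ :=
    enorm_integral_mul_le_lintegral_phaseCut hf hfi (hHm g hg)
      (fun x => norm_integral_mul_kernel_le hgi (hA x))
  have step2 : ∀ a, 0 < a → ‖bilinKernel μ k (phaseCut f a) g‖ₑ ≤
      ∫⁻ b in Ioi (0 : ℝ), ‖bilinKernel μ k (phaseCut f a) (phaseCut g b)‖ₑ := by
    intro a ha
    have hfa := integrable_phaseCut hf hfi ha
    -- Fubini moves the second function outside, so that the same layer decomposition applies to it.
    rw [bilinKernel_swap hk hA hfa hgi]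
    refine (enorm_integral_mul_le_lintegral_phaseCut hg hgi (hHm' _ (measurable_phaseCut hf a))
      (fun y => norm_integral_mul_kernel_le hfa (fun x => hA x y))).trans (le_of_eq ?_)
    refine setLIntegral_congr_fun measurableSet_Ioi fun b hb => ?_
    rw [bilinKernel_swap hk hA hfa (integrable_phaseCut hg hgi hb)]
  refine step1.trans ((lintegral_mono_ae ?_).trans
    (lintegral_lintegral_le_of_le_mul_of_le_sqrt hr1 hr2 hA0 hD (hanti f) (hanti g) ?_ ?_
    (M := fun a b => ‖bilinKernel μ k (phaseCut f a) (phaseCut g b)‖ₑ) ?_ ?_))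
  · filter_upwards [ae_restrict_mem measurableSet_Ioi] with a ha
    exact step2 a ha
  · rw [lintegral_meas_lt_norm_mul_rpow hf hr0]
    exact mul_le_one' hle hf1
  · rw [lintegral_meas_lt_norm_mul_rpow hg hr0]
    exact mul_le_one' hle hg1
  · intro a b ha hb
    have hE := measurableSet_lt (measurable_const (a := a)) hf.norm
    have hE' := measurableSet_lt (measurable_const (a := b)) hg.norm
    calc _ ≤ ∫⁻ x, ‖phaseCut f a x‖ₑ * (v b * ENNReal.ofReal A) ∂μ := by
          refine (enorm_integral_le_lintegral_enorm _).trans (lintegral_mono fun x => ?_)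
          rw [enorm_mul]
          refine mul_le_mul_right ((enorm_integral_le_lintegral_enorm _).trans ?_) _
          calc _ ≤ ∫⁻ y, {y | b < ‖g y‖}.indicator 1 y * ENNReal.ofReal A ∂μ := by
                refine lintegral_mono fun y => ?_
                rw [enorm_mul]
                refine mul_le_mul' (enorm_phaseCut_le g b y) ?_
                rw [← ofReal_norm]
                exact ENNReal.ofReal_le_ofReal (hA x y)
            _ = _ := by
                rw [lintegral_mul_const _ (measurable_one.indicator hE'),
                  lintegral_indicator_one hE']
      _ ≤ ∫⁻ x, {x | a < ‖f x‖}.indicator 1 x * (v b * ENNReal.ofReal A) ∂μ :=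
          lintegral_mono fun x => mul_le_mul_left (enorm_phaseCut_le f a x) _
      _ = _ := by
          rw [lintegral_mul_const _ (measurable_one.indicator hE), lintegral_indicator_one hE]
          ring
  · intro a b ha hb
    exact hL2 _ _ _ _ (measurable_phaseCut hf a) (measurable_phaseCut hg b)
      (measurableSet_lt measurable_const hf.norm) (measurableSet_lt measurable_const hg.norm)
      (hfi.measure_norm_gt_lt_top ha) (hgi.measure_norm_gt_lt_top hb) (enorm_phaseCut_le f a) (enorm_phaseCut_le g b)

/-- Interpolation of a bilinear form between `L¹ × L¹` and (restricted) `L² × L²`. -/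
theorem bilinKernel_le [SFinite μ] {r : ℝ} (hr1 : 1 < r) (hr2 : r < 2)
    {A D : ℝ} (hA0 : 0 < A) (hD : 0 < D) {k : X → X → ℂ} (hk : Measurable (Function.uncurry k))
    (hA : ∀ x y, ‖k x y‖ ≤ A)
    (hL2 : ∀ (f g : X → ℂ) (E E' : Set X), Measurable f → Measurable g → MeasurableSet E →
      MeasurableSet E' → μ E < ⊤ → μ E' < ⊤ → (∀ x, ‖f x‖ₑ ≤ E.indicator 1 x) →
      (∀ x, ‖g x‖ₑ ≤ E'.indicator 1 x) →
      ‖bilinKernel μ k f g‖ₑ ≤ ENNReal.ofReal D * (μ E * μ E') ^ (1 / 2 : ℝ))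
    {f g : X → ℂ} (hf : Measurable f) (hg : Measurable g) (hfi : Integrable f μ)
    (hgi : Integrable g μ) {a b : ℝ} (ha : 0 ≤ a) (hb : 0 ≤ b)
    (hfa : ∫⁻ x, ‖f x‖ₑ ^ r ∂μ = ENNReal.ofReal (a ^ r))
    (hgb : ∫⁻ x, ‖g x‖ₑ ^ r ∂μ = ENNReal.ofReal (b ^ r)) :
    ‖bilinKernel μ k f g‖ ≤ (1 + 2 * D / (1 - r / 2)) * A ^ (2 / r - 1) * (a * b) := by
  have hr0 : 0 < r := by linarith
  have hzero : ∀ {f : X → ℂ}, Measurable f → ∫⁻ x, ‖f x‖ₑ ^ r ∂μ = 0 → f =ᵐ[μ] 0 := by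
    intro f hf h
    rw [lintegral_eq_zero_iff (by fun_prop)] at h
    filter_upwards [h] with x hx
    simpa [hr0, hr0.le, not_lt.2 hr0.le] using hx
  -- Normalizing divides by `a` and `b`. If one of them is zero, that function vanishes almost
  -- everywhere and so does the form.
  rcases ha.eq_or_lt with rfl | ha
  · have h0 := hzero hf (by rw [hfa, Real.zero_rpow hr0.ne', ENNReal.ofReal_zero])
    have : bilinKernel μ k f g = 0 := by
      refine integral_eq_zero_of_ae ?_
      filter_upwards [h0] with x hx
      simp [hx]
    rw [this]; simp
  rcases hb.eq_or_lt with rfl | hb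
  · have h0 := hzero hg (by rw [hgb, Real.zero_rpow hr0.ne', ENNReal.ofReal_zero])
    have : bilinKernel μ k f g = 0 := by
      rw [bilinKernel_swap hk hA hfi hgi]
      refine integral_eq_zero_of_ae ?_
      filter_upwards [h0] with x hx
      simp [hx]
    rw [this]; simp
  have hscale : ∀ {f : X → ℂ} {a : ℝ}, 0 < a → ∫⁻ x, ‖f x‖ₑ ^ r ∂μ = ENNReal.ofReal (a ^ r) →
      Measurable f → ∫⁻ x, ‖((a⁻¹ : ℝ) : ℂ) * f x‖ₑ ^ r ∂μ ≤ 1 := by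
    intro f a ha h hf
    have : ‖((a⁻¹ : ℝ) : ℂ)‖ₑ = ENNReal.ofReal a⁻¹ := by
      rw [← ofReal_norm, Complex.norm_real, Real.norm_of_nonneg (by positivity)]
    simp_rw [enorm_mul, this, ENNReal.mul_rpow_of_nonneg _ _ hr0.le]
    rw [lintegral_const_mul _ (by fun_prop), h, ENNReal.ofReal_rpow_of_pos (by positivity),
      ← ENNReal.ofReal_mul (by positivity), ← Real.mul_rpow (by positivity) ha.le,
      inv_mul_cancel₀ ha.ne']
    simp
  have h := bilinKernel_le_of_normalized hr1 hr2 hA0 hD hk hA hL2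
    (f := fun x => ((a⁻¹ : ℝ) : ℂ) * f x) (g := fun x => ((b⁻¹ : ℝ) : ℂ) * g x)
    (by fun_prop) (by fun_prop) (hfi.const_mul _) (hgi.const_mul _)
    (hscale ha hfa hf) (hscale hb hgb hg)
  have e : bilinKernel μ k (fun x => ((a⁻¹ : ℝ) : ℂ) * f x) (fun x => ((b⁻¹ : ℝ) : ℂ) * g x) =
      ((a * b)⁻¹ : ℝ) * bilinKernel μ k f g := by
    unfold bilinKernel
    simp_rw [mul_assoc, integral_const_mul, mul_left_comm (f _), integral_const_mul]
    push_cast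
    rw [mul_inv]; ring
  have hc : 0 ≤ (1 + 2 * D / (1 - r / 2)) * A ^ (2 / r - 1) := by
    have : 0 < 1 - r / 2 := by linarith
    positivity
  rw [e, ← ofReal_norm, ENNReal.ofReal_le_ofReal_iff hc, norm_mul, Complex.norm_real,
    Real.norm_of_nonneg (by positivity), inv_mul_le_iff₀ (by positivity)] at h
  linarith

end phaseCut

/-! ### Invariance of surface measure under isometries -/

section Isometry

variable {d : ℕ}

/-- The action of a linear isometry on the unit sphere. -/
def sphereMap (L : EuclideanSpace ℝ (Fin d) ≃ₗᵢ[ℝ] EuclideanSpace ℝ (Fin d)) (ω : UnitSphere d) :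
    UnitSphere d :=
  ⟨L ω, by simp⟩

lemma measurable_sphereMap (L : EuclideanSpace ℝ (Fin d) ≃ₗᵢ[ℝ] EuclideanSpace ℝ (Fin d)) :
    Measurable (sphereMap L) :=
  (L.continuous.measurable.comp measurable_subtype_coe).subtype_mk

/-- Surface measure is a multiple of the volume of the cone over a set; a linear isometry maps cones
to cones and preserves volume. -/
lemma measurePreserving_sphereMap
    (L : EuclideanSpace ℝ (Fin d) ≃ₗᵢ[ℝ] EuclideanSpace ℝ (Fin d)) :
    MeasurePreserving (sphereMap L) (surfaceMeasure d) (surfaceMeasure d) := by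
  refine ⟨measurable_sphereMap L, Measure.ext fun s hs => ?_⟩
  rw [Measure.map_apply (measurable_sphereMap L) hs, Measure.toSphere_apply' _ hs,
    Measure.toSphere_apply' _ (measurable_sphereMap L hs)]
  congr 1
  conv_rhs => rw [← L.measurePreserving.measure_preimage_emb L.toHomeomorph.measurableEmbedding]
  congr 1
  ext x
  simp only [mem_smul, mem_image, mem_preimage]
  constructor
  · rintro ⟨t, ht, y, ⟨ω, hω, rfl⟩, rfl⟩
    refine ⟨t, ht, L ω, ⟨sphereMap L ω, hω, rfl⟩, ?_⟩
    exact (L.map_smul t (ω : EuclideanSpace ℝ (Fin d))).symm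
  · rintro ⟨t, ht, y, ⟨ω, hω, rfl⟩, h⟩
    refine ⟨t, ht, L.symm ω, ⟨sphereMap L.symm ω, ?_, rfl⟩, ?_⟩
    · have : sphereMap L (sphereMap L.symm ω) = ω := by
        ext1; simp [sphereMap]
      rwa [this]
    · apply L.injective
      change t • (ω : EuclideanSpace ℝ (Fin d)) = L x at h
      simpa using h

lemma integral_comp_sphereMap {G : Type*} [NormedAddCommGroup G] [NormedSpace ℝ G]
    (L : EuclideanSpace ℝ (Fin d) ≃ₗᵢ[ℝ] EuclideanSpace ℝ (Fin d)) (F : UnitSphere d → G) :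
    ∫ ω, F (sphereMap L ω) ∂(surfaceMeasure d) = ∫ ω, F ω ∂(surfaceMeasure d) := by
  refine (measurePreserving_sphereMap L).integral_comp ?_ F
  refine MeasurableEmbedding.of_measurable_inverse (g := sphereMap L.symm)
    (measurable_sphereMap L) ?_ (measurable_sphereMap _) fun ω => by ext1; simp [sphereMap]
  have : range (sphereMap L) = univ := by
    refine eq_univ_of_forall fun ω => ⟨sphereMap L.symm ω, by ext1; simp [sphereMap]⟩
  rw [this]; exact MeasurableSet.univ

/-- A one-parameter family of symmetries acting on the plane of `u` and `w`, to be differentiated in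
`φ`. The hyperplane of the reflection is orthogonal to `-sin(φ/2) u + cos(φ/2) w`; at `φ = 0` it
only changes the sign of the `w` component. -/
lemma exists_reflection (u w : EuclideanSpace ℝ (Fin d)) (hu : ‖u‖ = 1) (hw : ‖w‖ = 1)
    (huw : inner ℝ u w = 0) (φ : ℝ) :
    ∃ L : EuclideanSpace ℝ (Fin d) ≃ₗᵢ[ℝ] EuclideanSpace ℝ (Fin d), ∀ x,
      inner ℝ (L x) u = Real.cos φ * inner ℝ x u + Real.sin φ * inner ℝ x w ∧
      inner ℝ (L x) w = Real.sin φ * inner ℝ x u - Real.cos φ * inner ℝ x w := by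
  set n := (-Real.sin (φ / 2)) • u + Real.cos (φ / 2) • w with hn
  have huu : inner ℝ u u = (1 : ℝ) := by rw [real_inner_self_eq_norm_sq, hu]; norm_num
  have hww : inner ℝ w w = (1 : ℝ) := by rw [real_inner_self_eq_norm_sq, hw]; norm_num
  have hwu : inner ℝ w u = (0 : ℝ) := by rw [real_inner_comm, huw]
  have hnn : ‖n‖ = 1 := by
    have : ‖n‖ ^ 2 = 1 := by
      rw [← real_inner_self_eq_norm_sq, hn]
      simp only [inner_add_left, inner_add_right, inner_smul_left, inner_smul_right, huu, hww, hwu,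
        huw]
      simp
      nlinarith [Real.sin_sq_add_cos_sq (φ / 2)]
    nlinarith [norm_nonneg n]
  have hs : Real.sin φ = 2 * Real.sin (φ / 2) * Real.cos (φ / 2) := by
    rw [← Real.sin_two_mul]; congr 1; ring
  have hc : Real.cos φ = 1 - 2 * Real.sin (φ / 2) ^ 2 := by
    rw [← Real.cos_sq_add_sin_sq (φ / 2)]
    have := Real.cos_two_mul (φ / 2)
    rw [show 2 * (φ / 2) = φ by ring] at this
    nlinarith [Real.sin_sq_add_cos_sq (φ / 2)]
  refine ⟨(Submodule.reflection (Submodule.span ℝ {n})ᗮ), fun x => ?_⟩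
  have hL : (Submodule.reflection (Submodule.span ℝ {n})ᗮ) x = x - (2 * inner ℝ n x) • n := by
    rw [Submodule.reflection_orthogonal_apply, Submodule.reflection_singleton_apply, hnn]
    simp [two_smul, two_mul, add_smul]
  have hcs := Real.sin_sq_add_cos_sq (φ / 2)
  have hin : inner ℝ n x =
      -Real.sin (φ / 2) * inner ℝ x u + Real.cos (φ / 2) * inner ℝ x w := by
    rw [hn, inner_add_left, inner_smul_left, inner_smul_left, real_inner_comm u, real_inner_comm w]
    simp
  have hnu : inner ℝ n u = -Real.sin (φ / 2) := by
    rw [hn, inner_add_left, inner_smul_left, inner_smul_left, huu, hwu]; simp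
  have hnw : inner ℝ n w = Real.cos (φ / 2) := by
    rw [hn, inner_add_left, inner_smul_left, inner_smul_left, hww, huw]; simp
  rw [hL, inner_sub_left, inner_sub_left, inner_smul_left, inner_smul_left, hin, hnu, hnw, hs, hc]
  simp only [conj_trivial]
  constructor
  · ring
  · linear_combination (-2 * inner ℝ x w) * hcs

end Isometry

/-! ### Polar coordinates and projection of the sphere to a hyperplane -/

section Polar

variable {d : ℕ}

lemma lintegral_polar (hd : 0 < d) {g : ℝ → ℝ≥0∞} (hg : Measurable g)
    {h : EuclideanSpace ℝ (Fin d) → ℝ≥0∞} (hh : Measurable h) :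
    ∫⁻ x : EuclideanSpace ℝ (Fin d), g ‖x‖ * h (‖x‖⁻¹ • x) =
      (∫⁻ ω : UnitSphere d, h ω ∂(surfaceMeasure d)) *
        ∫⁻ r : Ioi (0 : ℝ), g r ∂(Measure.volumeIoiPow (d - 1)) := by
  have : Nontrivial (EuclideanSpace ℝ (Fin d)) := by
    have : Nonempty (Fin d) := ⟨⟨0, hd⟩⟩
    infer_instance
  rw [← lintegral_prod_mul (f := fun ω : UnitSphere d => h ω) (g := fun r : Ioi (0 : ℝ) => g r)
    (hh.comp measurable_subtype_coe).aemeasurable (hg.comp measurable_subtype_coe).aemeasurable]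
  have hmp := (volume : Measure
    (EuclideanSpace ℝ (Fin d))).measurePreserving_homeomorphUnitSphereProd
  rw [finrank_euclideanSpace, Fintype.card_fin] at hmp
  rw [← hmp.lintegral_comp_emb (Homeomorph.measurableEmbedding _)]
  rw [← lintegral_add_compl _ (measurableSet_singleton (0 : EuclideanSpace ℝ (Fin d)))]
  rw [Measure.restrict_eq_zero.2 (measure_singleton _), lintegral_zero_measure, zero_add,
    ← lintegral_subtype_comap (measurableSet_singleton _).compl]
  refine lintegral_congr fun x => ?_
  simp [mul_comm]

/-- Insertion of the coordinate `t` at the place `j`. -/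
def insertCoord {n : ℕ} (j : Fin (n + 1)) (p : ℝ × EuclideanSpace ℝ (Fin n)) :
    EuclideanSpace ℝ (Fin (n + 1)) :=
  WithLp.toLp 2 (j.insertNth p.1 (WithLp.ofLp p.2))

/-- Removal of the coordinate at the place `j`. -/
def removeCoord {n : ℕ} (j : Fin (n + 1)) (x : EuclideanSpace ℝ (Fin (n + 1))) :
    EuclideanSpace ℝ (Fin n) :=
  WithLp.toLp 2 fun i => x (j.succAbove i)

section Coord

variable {n : ℕ} (j : Fin (n + 1))

@[simp] lemma insertCoord_apply_same (p : ℝ × EuclideanSpace ℝ (Fin n)) :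
    insertCoord j p j = p.1 := by simp [insertCoord]

@[simp] lemma insertCoord_apply_succAbove (p : ℝ × EuclideanSpace ℝ (Fin n)) (i : Fin n) :
    insertCoord j p (j.succAbove i) = p.2 i := by simp [insertCoord]

@[simp] lemma removeCoord_insertCoord (p : ℝ × EuclideanSpace ℝ (Fin n)) :
    removeCoord j (insertCoord j p) = p.2 := by
  ext i; simp [removeCoord]

lemma removeCoord_smul (c : ℝ) (x : EuclideanSpace ℝ (Fin (n + 1))) :
    removeCoord j (c • x) = c • removeCoord j x := by
  ext i; simp [removeCoord]

lemma continuous_removeCoord : Continuous (removeCoord j) := by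
  unfold removeCoord; fun_prop

lemma continuous_insertCoord : Continuous (insertCoord j) := by
  unfold insertCoord
  refine (PiLp.continuous_toLp 2 _).comp ?_
  refine continuous_pi fun i => ?_
  refine Fin.succAboveCases j ?_ (fun i => ?_) i
  · simpa using continuous_fst
  · simp only [Fin.insertNth_apply_succAbove]; fun_prop

lemma inner_insertCoord (p : ℝ × EuclideanSpace ℝ (Fin n)) (x : EuclideanSpace ℝ (Fin (n + 1))) :
    inner ℝ (insertCoord j p) x = p.1 * x j + inner ℝ p.2 (removeCoord j x) := by
  simp only [PiLp.inner_apply, Fin.sum_univ_succAbove _ j]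
  simp [removeCoord, mul_comm]

lemma norm_insertCoord (p : ℝ × EuclideanSpace ℝ (Fin n)) :
    ‖insertCoord j p‖ = √(p.1 ^ 2 + ‖p.2‖ ^ 2) := by
  rw [EuclideanSpace.norm_eq, Fin.sum_univ_succAbove _ j, EuclideanSpace.norm_sq_eq]
  simp

lemma measurePreserving_insertCoord :
    MeasurePreserving (insertCoord j)
      ((volume : Measure ℝ).prod (volume : Measure (EuclideanSpace ℝ (Fin n)))) volume := by
  have h1 := (MeasurePreserving.id (volume : Measure ℝ)).prod
    (PiLp.volume_preserving_ofLp (Fin n))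
  have h2 := (volume_preserving_piFinSuccAbove (fun _ : Fin (n + 1) => ℝ) j).symm
  exact (PiLp.volume_preserving_toLp (Fin (n + 1))).comp (h2.comp h1)

lemma measurableEmbedding_insertCoord : MeasurableEmbedding (insertCoord j) := by
  refine MeasurableEmbedding.of_measurable_inverse (g := fun x => (x j, removeCoord j x))
    (continuous_insertCoord j).measurable ?_ ?_ fun p => by ext <;> simp
  · have : range (insertCoord j) = univ := by
      refine eq_univ_of_forall fun x => ⟨(x j, removeCoord j x), ?_⟩
      ext i
      refine Fin.succAboveCases j ?_ (fun i => ?_) i <;> simp [removeCoord]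
    rw [this]; exact MeasurableSet.univ
  · exact Measurable.prodMk (by fun_prop) (continuous_removeCoord j).measurable

end Coord

/-- Substitute `ρ = √(t² + c²)`, with `dρ = (t / ρ) dt`, on each half-line. The images lie in the
line, and the factor `2` counts the two signs of `t`. -/
lemma lintegral_abs_div_sqrt_mul_le (c : ℝ) {W : ℝ → ℝ≥0∞} :
    ∫⁻ t : ℝ, ENNReal.ofReal (|t| / √(t ^ 2 + c ^ 2)) * W √(t ^ 2 + c ^ 2) ≤
      2 * ∫⁻ ρ, W ρ := by
  have hpos : ∫⁻ t in Ioi (0 : ℝ), ENNReal.ofReal (|t| / √(t ^ 2 + c ^ 2)) * W √(t ^ 2 + c ^ 2) ≤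
      ∫⁻ ρ, W ρ := by
    have h := lintegral_image_eq_lintegral_abs_deriv_mul (s := Ioi (0 : ℝ))
      (f := fun t => √(t ^ 2 + c ^ 2)) (f' := fun t => t / √(t ^ 2 + c ^ 2)) measurableSet_Ioi
      (fun t ht => ?_) (fun t ht s hs hts => ?_) W
    · refine le_trans (le_of_eq ?_) (h.symm.le.trans (setLIntegral_le_lintegral _ _))
      refine setLIntegral_congr_fun measurableSet_Ioi fun t ht => ?_
      simp only [abs_div, abs_of_nonneg (Real.sqrt_nonneg _)]
    · have ht' : (0 : ℝ) < t := ht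
      have hp : t ^ 2 + c ^ 2 ≠ 0 := by positivity
      have := (((hasDerivAt_pow 2 t).add_const (c ^ 2)).sqrt hp).hasDerivWithinAt (s := Ioi 0)
      have e : ((2 : ℕ) : ℝ) * t ^ (2 - 1) / (2 * √(t ^ 2 + c ^ 2)) = t / √(t ^ 2 + c ^ 2) := by
        push_cast
        rw [pow_one, mul_div_mul_left _ _ two_ne_zero]
      rwa [e] at this
    · have ht' : (0 : ℝ) < t := ht
      have hs' : (0 : ℝ) < s := hs
      simp only at hts
      rw [Real.sqrt_inj (by positivity) (by positivity)] at hts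
      nlinarith
  have hneg : ∫⁻ t in Iio (0 : ℝ), ENNReal.ofReal (|t| / √(t ^ 2 + c ^ 2)) * W √(t ^ 2 + c ^ 2) =
      ∫⁻ t in Ioi (0 : ℝ), ENNReal.ofReal (|t| / √(t ^ 2 + c ^ 2)) * W √(t ^ 2 + c ^ 2) := by
    have := (Measure.measurePreserving_neg (volume : Measure ℝ)).setLIntegral_comp_preimage_emb
      (MeasurableEquiv.neg ℝ).measurableEmbedding
      (fun t => ENNReal.ofReal (|t| / √(t ^ 2 + c ^ 2)) * W √(t ^ 2 + c ^ 2)) (Ioi 0)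
    rw [← this]
    simp
  have hsub : (univ : Set ℝ) ⊆ Iio 0 ∪ (Ioi 0 ∪ {0}) := by
    intro t _
    rcases lt_trichotomy t 0 with h | h | h
    · exact Or.inl h
    · exact Or.inr (Or.inr h)
    · exact Or.inr (Or.inl h)
  rw [← setLIntegral_univ]
  refine (lintegral_mono_set hsub).trans ((lintegral_union_le _ _ _).trans
    ((add_le_add le_rfl (lintegral_union_le _ _ _)).trans ?_))
  rw [hneg, Measure.restrict_eq_zero.2 (measure_singleton _), lintegral_zero_measure, add_zero,
    two_mul]
  exact add_le_add hpos hpos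

lemma lintegral_comp_inv_smul {n : ℕ} {Φ : EuclideanSpace ℝ (Fin n) → ℝ≥0∞} {ρ : ℝ} (hρ : 0 < ρ) :
    ∫⁻ y, Φ (ρ⁻¹ • y) = ENNReal.ofReal (ρ ^ n) * ∫⁻ y, Φ y := by
  have h := Measure.map_addHaar_smul (volume : Measure (EuclideanSpace ℝ (Fin n)))
    (inv_ne_zero hρ.ne')
  have h2 := (Homeomorph.smulOfNeZero ρ⁻¹ (inv_ne_zero hρ.ne')).measurableEmbedding.lintegral_map
    (μ := (volume : Measure (EuclideanSpace ℝ (Fin n)))) Φ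
  simp only [Homeomorph.smulOfNeZero_apply] at h2
  rw [← h2]
  change ∫⁻ y, Φ y ∂(Measure.map (fun x => ρ⁻¹ • x) volume) = _
  rw [h, lintegral_smul_measure, finrank_euclideanSpace, Fintype.card_fin, inv_pow, inv_inv,
    abs_of_pos (by positivity), smul_eq_mul]

/-- Projection of the sphere along a coordinate. -/
theorem lintegral_sphere_abs_mul_le (n : ℕ) : ∃ C : ℝ, 0 < C ∧ ∀ (j : Fin (n + 1))
    (Φ : EuclideanSpace ℝ (Fin n) → ℝ≥0∞), Measurable Φ →
    ∫⁻ ω : UnitSphere (n + 1), ENNReal.ofReal |(ω : EuclideanSpace ℝ (Fin (n + 1))) j| *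
      Φ (removeCoord j ω) ∂(surfaceMeasure (n + 1)) ≤ ENNReal.ofReal C * ∫⁻ y, Φ y := by
  -- The `2` counts the two hemispheres over the hyperplane; `n + 1` is the inverse of `∫₀¹ ρ^n dρ`.
  refine ⟨2 * (n + 1), by positivity, fun j Φ hΦ => ?_⟩
  -- A radial cutoff to the unit ball turns the surface integral into a volume integral, where
  -- Fubini in the coordinate `j` is available. The factor `|x_j| / ‖x‖` is then the Jacobian of
  -- `x_j ↦ ‖x‖`, and rescaling the remaining variables costs `ρ^n ≤ 1`.
  set g : ℝ → ℝ≥0∞ := (Ioo 0 1).indicator 1 with hg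
  have hgm : Measurable g := measurable_one.indicator measurableSet_Ioo
  have hc₀ : ∫⁻ r : Ioi (0 : ℝ), g r ∂(Measure.volumeIoiPow n) =
      ENNReal.ofReal (1 / (n + 1)) := by
    have : (fun r : Ioi (0 : ℝ) => g r) = (Iio ⟨1, mem_Ioi.2 one_pos⟩).indicator 1 := by
      ext ⟨r, hr⟩
      have : (0 : ℝ) < r := hr
      simp [hg, indicator, this]
    rw [this, lintegral_indicator_one measurableSet_Iio, Measure.volumeIoiPow_apply_Iio, one_pow]
  set h : EuclideanSpace ℝ (Fin (n + 1)) → ℝ≥0∞ :=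
    fun x => ENNReal.ofReal |x j| * Φ (removeCoord j x) with hh
  have hhm : Measurable h :=
    Measurable.mul (by fun_prop) (hΦ.comp (continuous_removeCoord j).measurable)
  have hpolar := lintegral_polar (Nat.succ_pos n) hgm hhm
  rw [Nat.succ_sub_one, hc₀] at hpolar
  have hle : ∫⁻ x : EuclideanSpace ℝ (Fin (n + 1)), g ‖x‖ * h (‖x‖⁻¹ • x) ≤ 2 * ∫⁻ y, Φ y := by
    rw [← (measurePreserving_insertCoord j).lintegral_comp_emb (measurableEmbedding_insertCoord j)]
    have e : ∀ p : ℝ × EuclideanSpace ℝ (Fin n),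
        g ‖insertCoord j p‖ * h (‖insertCoord j p‖⁻¹ • insertCoord j p) =
        ENNReal.ofReal (|p.1| / √(p.1 ^ 2 + ‖p.2‖ ^ 2)) * (g √(p.1 ^ 2 + ‖p.2‖ ^ 2) *
          Φ ((√(p.1 ^ 2 + ‖p.2‖ ^ 2))⁻¹ • p.2)) := by
      intro p
      simp only [hh, norm_insertCoord, removeCoord_smul, removeCoord_insertCoord, PiLp.smul_apply,
        insertCoord_apply_same, smul_eq_mul, abs_mul, abs_inv, abs_of_nonneg (Real.sqrt_nonneg _)]
      rw [mul_left_comm, inv_mul_eq_div]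
    have hm : Measurable fun p : ℝ × EuclideanSpace ℝ (Fin n) => g p.1 * Φ (p.1⁻¹ • p.2) :=
      (hgm.comp measurable_fst).mul (hΦ.comp (by fun_prop))
    have hsm : Measurable fun p : ℝ × EuclideanSpace ℝ (Fin n) => √(p.1 ^ 2 + ‖p.2‖ ^ 2) := by
      fun_prop
    have hm' : Measurable fun p : ℝ × EuclideanSpace ℝ (Fin n) =>
        ENNReal.ofReal (|p.1| / √(p.1 ^ 2 + ‖p.2‖ ^ 2)) * (g √(p.1 ^ 2 + ‖p.2‖ ^ 2) *
          Φ ((√(p.1 ^ 2 + ‖p.2‖ ^ 2))⁻¹ • p.2)) :=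
      Measurable.mul (by fun_prop) (hm.comp (hsm.prodMk measurable_snd))
    simp_rw [e]
    rw [lintegral_prod_symm _ hm'.aemeasurable]
    calc _ ≤ ∫⁻ y, 2 * ∫⁻ ρ, g ρ * Φ (ρ⁻¹ • y) := by
          refine lintegral_mono fun y => ?_
          exact lintegral_abs_div_sqrt_mul_le ‖y‖ (W := fun ρ => g ρ * Φ (ρ⁻¹ • y))
      _ = 2 * ∫⁻ ρ, ∫⁻ y, g ρ * Φ (ρ⁻¹ • y) := by
          rw [lintegral_const_mul _
            (Measurable.lintegral_prod_left' (f := fun p : ℝ × EuclideanSpace ℝ (Fin n) =>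
              g p.1 * Φ (p.1⁻¹ • p.2)) hm), lintegral_lintegral_swap]
          exact (hm.comp measurable_swap).aemeasurable
      _ ≤ 2 * ∫⁻ ρ, (Ioo (0 : ℝ) 1).indicator (fun _ => ∫⁻ y, Φ y) ρ := by
          refine mul_le_mul_right (lintegral_mono fun ρ => ?_) _
          by_cases hρ : ρ ∈ Ioo (0 : ℝ) 1
          · simp only [hg, indicator_of_mem hρ, Pi.one_apply, one_mul]
            rw [lintegral_comp_inv_smul hρ.1]
            refine mul_le_of_le_one_left' ?_
            rw [ENNReal.ofReal_le_one]
            exact pow_le_one₀ hρ.1.le hρ.2.le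
          · simp [hg, indicator_of_notMem hρ]
      _ = _ := by
          rw [lintegral_indicator measurableSet_Ioo, setLIntegral_const, Real.volume_Ioo]
          simp
  rw [hpolar] at hle
  calc _ = (∫⁻ ω : UnitSphere (n + 1), h ω ∂(surfaceMeasure (n + 1))) *
        ENNReal.ofReal (1 / (n + 1)) * ENNReal.ofReal (n + 1) := by
        rw [mul_assoc, ← ENNReal.ofReal_mul (by positivity),
          one_div_mul_cancel (by positivity), ENNReal.ofReal_one, mul_one]
    _ ≤ (2 * ∫⁻ y, Φ y) * ENNReal.ofReal (n + 1) := by gcongr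
    _ = _ := by rw [ENNReal.ofReal_mul zero_le_two, ENNReal.ofReal_ofNat]; ring

end Polar

/-! ### Spherical moments of trigonometric functions and the Bessel equation -/

/-- Differentiation of a parametric integral over a finite measure, with uniform bounds. -/
lemma hasDerivAt_integral_of_bounded {X : Type*} [MeasurableSpace X] {μ : Measure X}
    [IsFiniteMeasure μ] {F F' : ℝ → X → ℝ} (hF : ∀ t, Measurable (F t))
    (hF' : ∀ t, Measurable (F' t)) {B : ℝ} (hB : ∀ t x, |F t x| ≤ B) (hB' : ∀ t x, |F' t x| ≤ B)
    (hd : ∀ t x, HasDerivAt (fun t => F t x) (F' t x) t) (t₀ : ℝ) :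
    HasDerivAt (fun t => ∫ x, F t x ∂μ) (∫ x, F' t₀ x ∂μ) t₀ := by
  refine (hasDerivAt_integral_of_dominated_loc_of_deriv_le (bound := fun _ => B) Filter.univ_mem
    (Filter.Eventually.of_forall fun t => (hF t).aestronglyMeasurable) ?_
    (hF' t₀).aestronglyMeasurable (Filter.Eventually.of_forall fun x t _ => hB' t x)
    (integrable_const B) (Filter.Eventually.of_forall fun x t _ => hd t x)).2
  exact Integrable.of_bound (hF t₀).aestronglyMeasurable B (Filter.Eventually.of_forall (hB t₀))

section Decay

variable {d : ℕ}

lemma abs_inner_sphere_le (ω : UnitSphere d) {u : EuclideanSpace ℝ (Fin d)} (hu : ‖u‖ ≤ 1) :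
    |inner ℝ (ω : EuclideanSpace ℝ (Fin d)) u| ≤ 1 := by
  refine (abs_real_inner_le_norm _ _).trans ?_
  rw [norm_eq_of_mem_sphere, one_mul]; exact hu

/-- `∫ cos(r ⟨ω, u⟩) dσ(ω)`. -/
def cosMoment (u : EuclideanSpace ℝ (Fin d)) (r : ℝ) : ℝ :=
  ∫ ω : UnitSphere d, Real.cos (r * inner ℝ (ω : EuclideanSpace ℝ (Fin d)) u) ∂(surfaceMeasure d)

/-- `∫ ⟨ω, u⟩ sin(r ⟨ω, u⟩) dσ(ω)`. -/
def sinMoment (u : EuclideanSpace ℝ (Fin d)) (r : ℝ) : ℝ :=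
  ∫ ω : UnitSphere d, inner ℝ (ω : EuclideanSpace ℝ (Fin d)) u *
    Real.sin (r * inner ℝ (ω : EuclideanSpace ℝ (Fin d)) u) ∂(surfaceMeasure d)

/-- `∫ ⟨ω, w⟩² cos(r ⟨ω, u⟩) dσ(ω)`. -/
def cosSqMoment (u w : EuclideanSpace ℝ (Fin d)) (r : ℝ) : ℝ :=
  ∫ ω : UnitSphere d, inner ℝ (ω : EuclideanSpace ℝ (Fin d)) w ^ 2 *
    Real.cos (r * inner ℝ (ω : EuclideanSpace ℝ (Fin d)) u) ∂(surfaceMeasure d)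

lemma integrable_sphere_of_continuous {G : EuclideanSpace ℝ (Fin d) → ℝ} (hG : Continuous G) :
    Integrable (fun ω : UnitSphere d => G ω) (surfaceMeasure d) :=
  (hG.comp continuous_subtype_val).integrable_of_hasCompactSupport (HasCompactSupport.of_compactSpace _)

lemma hasDerivAt_cosMoment {u : EuclideanSpace ℝ (Fin d)} (hu : ‖u‖ = 1) (r : ℝ) :
    HasDerivAt (cosMoment u) (-sinMoment u r) r := by
  unfold cosMoment sinMoment
  rw [← integral_neg]
  refine hasDerivAt_integral_of_bounded (μ := surfaceMeasure d) (B := 1)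
    (F := fun r ω => Real.cos (r * inner ℝ (ω : EuclideanSpace ℝ (Fin d)) u))
    (F' := fun r ω => -(inner ℝ (ω : EuclideanSpace ℝ (Fin d)) u *
      Real.sin (r * inner ℝ (ω : EuclideanSpace ℝ (Fin d)) u)))
    (fun t => by fun_prop) (fun t => by fun_prop) (fun t ω => Real.abs_cos_le_one _)
    (fun t ω => ?_) (fun t ω => ?_) r
  · rw [abs_neg, abs_mul]
    exact mul_le_one₀ (abs_inner_sphere_le ω hu.le) (abs_nonneg _) (Real.abs_sin_le_one _)
  · exact (hasDerivAt_mul_const (inner ℝ (ω : EuclideanSpace ℝ (Fin d)) u)).cos.congr_deriv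
      (by ring)

lemma hasDerivAt_sinMoment {u : EuclideanSpace ℝ (Fin d)} (hu : ‖u‖ = 1) (r : ℝ) :
    HasDerivAt (sinMoment u) (cosSqMoment u u r) r := by
  unfold sinMoment cosSqMoment
  refine hasDerivAt_integral_of_bounded (μ := surfaceMeasure d) (B := 1)
    (F := fun r ω => inner ℝ (ω : EuclideanSpace ℝ (Fin d)) u *
      Real.sin (r * inner ℝ (ω : EuclideanSpace ℝ (Fin d)) u))
    (F' := fun r ω => inner ℝ (ω : EuclideanSpace ℝ (Fin d)) u ^ 2 *
      Real.cos (r * inner ℝ (ω : EuclideanSpace ℝ (Fin d)) u))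
    (fun t => by fun_prop) (fun t => by fun_prop) (fun t ω => ?_)
    (fun t ω => ?_) (fun t ω => ?_) r
  · rw [abs_mul]
    exact mul_le_one₀ (abs_inner_sphere_le ω hu.le) (abs_nonneg _) (Real.abs_sin_le_one _)
  · rw [abs_mul, abs_pow]
    exact mul_le_one₀ (pow_le_one₀ (abs_nonneg _) (abs_inner_sphere_le ω hu.le)) (abs_nonneg _)
      (Real.abs_cos_le_one _)
  · exact ((hasDerivAt_mul_const (inner ℝ (ω : EuclideanSpace ℝ (Fin d)) u)).sin.const_mul
      (inner ℝ (ω : EuclideanSpace ℝ (Fin d)) u)).congr_deriv (by ring)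

lemma integral_reflection {u w : EuclideanSpace ℝ (Fin d)} (hu : ‖u‖ = 1) (hw : ‖w‖ = 1)
    (huw : inner ℝ u w = 0) (F : ℝ → ℝ → ℝ) (φ : ℝ) :
    ∫ ω : UnitSphere d, F
      (Real.cos φ * inner ℝ (ω : EuclideanSpace ℝ (Fin d)) u +
        Real.sin φ * inner ℝ (ω : EuclideanSpace ℝ (Fin d)) w)
      (Real.sin φ * inner ℝ (ω : EuclideanSpace ℝ (Fin d)) u -
        Real.cos φ * inner ℝ (ω : EuclideanSpace ℝ (Fin d)) w) ∂(surfaceMeasure d) =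
    ∫ ω : UnitSphere d, F (inner ℝ (ω : EuclideanSpace ℝ (Fin d)) u)
      (inner ℝ (ω : EuclideanSpace ℝ (Fin d)) w) ∂(surfaceMeasure d) := by
  obtain ⟨L, hL⟩ := exists_reflection u w hu hw huw φ
  rw [← integral_comp_sphereMap L (fun ω : UnitSphere d => F
    (inner ℝ (ω : EuclideanSpace ℝ (Fin d)) u) (inner ℝ (ω : EuclideanSpace ℝ (Fin d)) w))]
  refine integral_congr_ae (Filter.Eventually.of_forall fun ω => ?_)
  simp only [sphereMap, (hL ω).1, (hL ω).2]

/-- An integration by parts on the sphere: the integral of `⟨ω,w⟩ sin(r⟨ω,u⟩)` is constant along the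
family of reflections, and its derivative at `φ = 0` is the difference of the two sides. -/
lemma cosSqMoment_of_orthogonal_of_norm {u w : EuclideanSpace ℝ (Fin d)} (hu : ‖u‖ = 1)
    (hw : ‖w‖ = 1) (huw : inner ℝ u w = 0) (r : ℝ) :
    r * cosSqMoment u w r = sinMoment u r := by
  set F : ℝ → ℝ → ℝ := fun a b => b * Real.sin (r * a) with hF
  have hconst := fun φ => integral_reflection hu hw huw F φ
  set a : UnitSphere d → ℝ := fun ω => inner ℝ (ω : EuclideanSpace ℝ (Fin d)) u with ha
  set b : UnitSphere d → ℝ := fun ω => inner ℝ (ω : EuclideanSpace ℝ (Fin d)) w with hb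
  have ham : Measurable a := by fun_prop
  have hbm : Measurable b := by fun_prop
  have hab : ∀ ω, |a ω| ≤ 1 := fun ω => abs_inner_sphere_le ω hu.le
  have hbb : ∀ ω, |b ω| ≤ 1 := fun ω => abs_inner_sphere_le ω hw.le
  have hcs : ∀ (s t : ℝ) (φ : ℝ), |s| ≤ 1 → |t| ≤ 1 →
      |Real.cos φ * s + Real.sin φ * t| ≤ 2 ∧ |Real.sin φ * s - Real.cos φ * t| ≤ 2 := by
    intro s t φ hs ht
    have h1 := mul_le_one₀ (Real.abs_cos_le_one φ) (abs_nonneg s) hs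
    have h2 := mul_le_one₀ (Real.abs_sin_le_one φ) (abs_nonneg t) ht
    have h3 := mul_le_one₀ (Real.abs_sin_le_one φ) (abs_nonneg s) hs
    have h4 := mul_le_one₀ (Real.abs_cos_le_one φ) (abs_nonneg t) ht
    rw [← abs_mul] at h1 h2 h3 h4
    exact ⟨(abs_add_le _ _).trans (by linarith), (abs_sub _ _).trans (by linarith)⟩
  set G : ℝ → UnitSphere d → ℝ := fun φ ω =>
    F (Real.cos φ * a ω + Real.sin φ * b ω) (Real.sin φ * a ω - Real.cos φ * b ω) with hG
  set G' : ℝ → UnitSphere d → ℝ := fun φ ω =>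
    (Real.cos φ * a ω + Real.sin φ * b ω) * Real.sin (r * (Real.cos φ * a ω + Real.sin φ * b ω)) +
    (Real.sin φ * a ω - Real.cos φ * b ω) *
      (Real.cos (r * (Real.cos φ * a ω + Real.sin φ * b ω)) *
        (r * (-(Real.sin φ * a ω - Real.cos φ * b ω)))) with hG'
  have hder := hasDerivAt_integral_of_bounded (μ := surfaceMeasure d) (F := G) (F' := G')
    (B := 2 + 4 * |r|) (fun t => by simp only [hG, hF]; fun_prop)
    (fun t => by simp only [hG']; fun_prop)
    (fun t ω => ?_) (fun t ω => ?_) (fun t ω => ?_) 0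
  · have hG0 : (fun φ => ∫ ω, G φ ω ∂(surfaceMeasure d)) =
        fun _ => ∫ ω, F (a ω) (b ω) ∂(surfaceMeasure d) := funext hconst
    rw [hG0] at hder
    have h0 := hder.unique (hasDerivAt_const _ _)
    have e : ∀ ω, G' 0 ω = a ω * Real.sin (r * a ω) - r * (b ω ^ 2 * Real.cos (r * a ω)) := by
      intro ω; simp only [hG', Real.cos_zero, Real.sin_zero]; ring_nf
    simp_rw [e] at h0
    rw [integral_sub, integral_const_mul, sub_eq_zero] at h0
    · exact h0.symm
    · exact integrable_sphere_of_continuous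
        (G := fun x => inner ℝ x u * Real.sin (r * inner ℝ x u)) (by fun_prop)
    · exact integrable_sphere_of_continuous
        (G := fun x => r * (inner ℝ x w ^ 2 * Real.cos (r * inner ℝ x u))) (by fun_prop)
  · obtain ⟨h1, h2⟩ := hcs (a ω) (b ω) t (hab ω) (hbb ω)
    simp only [hG, hF, abs_mul]
    have := mul_le_mul h2 (Real.abs_sin_le_one (r * (Real.cos t * a ω + Real.sin t * b ω)))
      (abs_nonneg _) zero_le_two
    have := abs_nonneg r
    linarith
  · obtain ⟨h1, h2⟩ := hcs (a ω) (b ω) t (hab ω) (hbb ω)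
    simp only [hG']
    refine (abs_add_le _ _).trans (add_le_add ?_ ?_)
    · rw [abs_mul]
      have := mul_le_mul h1 (Real.abs_sin_le_one (r * (Real.cos t * a ω + Real.sin t * b ω)))
        (abs_nonneg _) zero_le_two
      linarith
    · rw [abs_mul, abs_mul, abs_mul, abs_neg]
      calc _ ≤ 2 * (1 * (|r| * 2)) := by
            gcongr
            exact Real.abs_cos_le_one _
        _ = _ := by ring
  · have h1 : HasDerivAt (fun t => Real.cos t * a ω + Real.sin t * b ω)
        (-(Real.sin t * a ω - Real.cos t * b ω)) t := by
      exact (((Real.hasDerivAt_cos t).mul_const (a ω)).fun_add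
        ((Real.hasDerivAt_sin t).mul_const (b ω))).congr_deriv (by ring)
    have h2 : HasDerivAt (fun t => Real.sin t * a ω - Real.cos t * b ω)
        (Real.cos t * a ω + Real.sin t * b ω) t := by
      exact (((Real.hasDerivAt_sin t).mul_const (a ω)).fun_sub
        ((Real.hasDerivAt_cos t).mul_const (b ω))).congr_deriv (by ring)
    exact h2.mul (h1.const_mul r).sin

lemma cosSqMoment_of_orthogonal {u w : EuclideanSpace ℝ (Fin d)} (hu : ‖u‖ = 1)
    (huw : inner ℝ u w = 0) (r : ℝ) :
    r * cosSqMoment u w r = ‖w‖ ^ 2 * sinMoment u r := by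
  rcases eq_or_ne w 0 with rfl | hw
  · simp [cosSqMoment]
  have hw0 : ‖w‖ ≠ 0 := norm_ne_zero_iff.2 hw
  have h := cosSqMoment_of_orthogonal_of_norm (w := ‖w‖⁻¹ • w) hu
    (by rw [norm_smul, norm_inv, norm_norm, inv_mul_cancel₀ hw0])
    (by rw [inner_smul_right, huw, mul_zero]) r
  have e : cosSqMoment u (‖w‖⁻¹ • w) r = (‖w‖ ^ 2)⁻¹ * cosSqMoment u w r := by
    unfold cosSqMoment
    rw [← integral_const_mul]
    refine integral_congr_ae (Filter.Eventually.of_forall fun ω => ?_)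
    simp only [inner_smul_right]
    ring
  rw [← h, e]
  field_simp

/-- The integrand is odd in `⟨ω,w⟩`, and the reflection at `φ = 0` reverses that sign. -/
lemma integral_inner_mul_inner_mul_cos {u w : EuclideanSpace ℝ (Fin d)} (hu : ‖u‖ = 1)
    (huw : inner ℝ u w = 0) (r : ℝ) :
    ∫ ω : UnitSphere d, inner ℝ (ω : EuclideanSpace ℝ (Fin d)) w *
      (inner ℝ (ω : EuclideanSpace ℝ (Fin d)) u *
        Real.cos (r * inner ℝ (ω : EuclideanSpace ℝ (Fin d)) u)) ∂(surfaceMeasure d) = 0 := by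
  rcases eq_or_ne w 0 with rfl | hw
  · simp
  have hw0 : ‖w‖ ≠ 0 := norm_ne_zero_iff.2 hw
  have h := integral_reflection (w := ‖w‖⁻¹ • w) hu
    (by rw [norm_smul, norm_inv, norm_norm, inv_mul_cancel₀ hw0])
    (by rw [inner_smul_right, huw, mul_zero]) (fun a b => b * (a * Real.cos (r * a))) 0
  simp only [Real.cos_zero, Real.sin_zero, zero_mul, one_mul, add_zero, zero_sub, neg_mul,
    integral_neg, inner_smul_right, mul_assoc, integral_const_mul] at h
  have := neg_eq_self.1 h
  exact (mul_eq_zero.1 this).resolve_left (inv_ne_zero hw0)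

lemma inner_sub_smul_self {u v : EuclideanSpace ℝ (Fin d)} (hu : ‖u‖ = 1) :
    inner ℝ u (v - (inner ℝ u v : ℝ) • u) = (0 : ℝ) := by
  rw [inner_sub_right, inner_smul_right, real_inner_self_eq_norm_sq, hu]; ring

lemma norm_sub_smul_sq {u v : EuclideanSpace ℝ (Fin d)} (hu : ‖u‖ = 1) :
    ‖v - (inner ℝ u v : ℝ) • u‖ ^ 2 = ‖v‖ ^ 2 - (inner ℝ u v : ℝ) ^ 2 := by
  rw [norm_sub_sq_real, norm_smul, hu, inner_smul_right, Real.norm_eq_abs, mul_one, sq_abs,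
    real_inner_comm]; ring

/-- The Bessel equation for the spherical mean of the cosine. -/
lemma cosSqMoment_self {u : EuclideanSpace ℝ (Fin d)} (hu : ‖u‖ = 1) (r : ℝ) :
    r * cosSqMoment u u r = r * cosMoment u r - (d - 1) * sinMoment u r := by
  set e : Fin d → EuclideanSpace ℝ (Fin d) := fun i => EuclideanSpace.single i 1 with he
  -- Projecting the standard basis to the complement of `u` replaces a choice of orthonormal basis
  -- there: the squares `⟨ω,w_i⟩²` still sum to `1 - ⟨ω,u⟩²`, and the `‖w_i‖²` sum to `d - 1`.
  set w : Fin d → EuclideanSpace ℝ (Fin d) := fun i => e i - (inner ℝ u (e i) : ℝ) • u with hw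
  have hue : ∀ (x : EuclideanSpace ℝ (Fin d)) i, inner ℝ x (e i) = x i := fun x i => by
    simp [he, EuclideanSpace.inner_single_right]
  have hsum : ∀ x : EuclideanSpace ℝ (Fin d), ∑ i, x i ^ 2 = ‖x‖ ^ 2 := fun x => by
    rw [EuclideanSpace.norm_sq_eq]; simp
  have hpt : ∀ ω : UnitSphere d, ∑ i, inner ℝ (ω : EuclideanSpace ℝ (Fin d)) (w i) ^ 2 =
      1 - inner ℝ (ω : EuclideanSpace ℝ (Fin d)) u ^ 2 := by
    intro ω
    have e1 : ∀ i, inner ℝ (ω : EuclideanSpace ℝ (Fin d)) (w i) ^ 2 =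
        (ω : EuclideanSpace ℝ (Fin d)) i ^ 2 - 2 * inner ℝ (ω : EuclideanSpace ℝ (Fin d)) u *
          ((ω : EuclideanSpace ℝ (Fin d)) i * u i) +
          inner ℝ (ω : EuclideanSpace ℝ (Fin d)) u ^ 2 * u i ^ 2 := by
      intro i
      rw [hw, inner_sub_right, inner_smul_right, hue, hue]; ring
    have e2 : ∑ i, (ω : EuclideanSpace ℝ (Fin d)) i * u i =
        inner ℝ (ω : EuclideanSpace ℝ (Fin d)) u := by
      rw [PiLp.inner_apply]; simp [mul_comm]
    simp_rw [e1]
    rw [Finset.sum_add_distrib, Finset.sum_sub_distrib, ← Finset.mul_sum, ← Finset.mul_sum, e2,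
      hsum, hsum, hu, norm_eq_of_mem_sphere]
    ring
  have hS : ∑ i, cosSqMoment u (w i) r = cosMoment u r - cosSqMoment u u r := by
    unfold cosSqMoment cosMoment
    rw [← integral_finsetSum, ← integral_sub]
    · refine integral_congr_ae (Filter.Eventually.of_forall fun ω => ?_)
      simp only
      rw [← Finset.sum_mul, hpt]; ring
    · exact integrable_sphere_of_continuous (G := fun x => Real.cos (r * inner ℝ x u)) (by fun_prop)
    · exact integrable_sphere_of_continuous
        (G := fun x => inner ℝ x u ^ 2 * Real.cos (r * inner ℝ x u)) (by fun_prop)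
    · exact fun i _ => integrable_sphere_of_continuous
        (G := fun x => inner ℝ x (w i) ^ 2 * Real.cos (r * inner ℝ x u)) (by fun_prop)
  have hN : ∑ i, ‖w i‖ ^ 2 = (d : ℝ) - 1 := by
    have : ∀ i, ‖w i‖ ^ 2 = 1 - u i ^ 2 := fun i => by
      rw [hw, norm_sub_smul_sq hu, hue]; simp [he]
    simp_rw [this]
    rw [Finset.sum_sub_distrib, hsum, hu]; simp
  have h : r * ∑ i, cosSqMoment u (w i) r = (∑ i, ‖w i‖ ^ 2) * sinMoment u r := by
    rw [Finset.mul_sum, Finset.sum_mul]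
    exact Finset.sum_congr rfl fun i _ => cosSqMoment_of_orthogonal hu (inner_sub_smul_self hu) r
  rw [hS, hN] at h
  linarith

end Decay

/-! ### Decay of the Fourier transform by an energy estimate -/

section DecayBound

lemma abs_integral_sphere_le {d : ℕ} {F : UnitSphere d → ℝ} (hF : ∀ ω, |F ω| ≤ 1) :
    |∫ ω, F ω ∂(surfaceMeasure d)| ≤ sphereArea d := by
  have := norm_integral_le_of_norm_le_const (μ := surfaceMeasure d) (f := F)
    (Filter.Eventually.of_forall hF)
  rwa [one_mul] at this

lemma abs_cosMoment_le {d : ℕ} (u : EuclideanSpace ℝ (Fin d)) (r : ℝ) :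
    |cosMoment u r| ≤ sphereArea d :=
  abs_integral_sphere_le fun _ => Real.abs_cos_le_one _

lemma abs_sinMoment_le {d : ℕ} {u : EuclideanSpace ℝ (Fin d)} (hu : ‖u‖ = 1) (r : ℝ) :
    |sinMoment u r| ≤ sphereArea d := by
  refine abs_integral_sphere_le fun ω => ?_
  rw [abs_mul]
  exact mul_le_one₀ (abs_inner_sphere_le ω hu.le) (abs_nonneg _) (Real.abs_sin_le_one _)

/-- A Grönwall bound for differential inequalities with coefficient `κ / r²`. -/
lemma le_exp_mul_of_deriv_le {E E' : ℝ → ℝ} {κ : ℝ}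
    (hE : ∀ r, 1 ≤ r → HasDerivAt E (E' r) r) (h0 : ∀ r, 1 ≤ r → 0 ≤ E r)
    (hκ : 0 ≤ κ) (hE' : ∀ r, 1 ≤ r → E' r ≤ κ * E r / r ^ 2) {r : ℝ} (hr : 1 ≤ r) :
    E r ≤ E 1 * Real.exp κ := by
  -- The factor `exp(κ / r)` has logarithmic derivative `-κ / r²`; it stays between `1` and `exp κ`
  -- for `r ≥ 1`.
  have hd : ∀ r, 1 ≤ r → HasDerivAt (fun r => E r * Real.exp (κ * r⁻¹))
      (E' r * Real.exp (κ * r⁻¹) + E r * (Real.exp (κ * r⁻¹) * (κ * -(r ^ 2)⁻¹))) r := by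
    intro r hr
    have hr0 : r ≠ 0 := by positivity
    exact (hE r hr).fun_mul (((hasDerivAt_inv hr0).const_mul κ).exp)
  have hanti : AntitoneOn (fun r => E r * Real.exp (κ * r⁻¹)) (Ici 1) := by
    refine antitoneOn_of_deriv_nonpos (convex_Ici 1)
      (fun r hr => (hd r hr).continuousAt.continuousWithinAt) (fun r hr => ?_) fun r hr => ?_
    · rw [interior_Ici] at hr
      exact (hd r (le_of_lt hr)).differentiableAt.differentiableWithinAt
    · rw [interior_Ici] at hr
      rw [(hd r (le_of_lt hr)).deriv]
      have h := hE' r (le_of_lt hr)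
      have e : E' r * Real.exp (κ * r⁻¹) + E r * (Real.exp (κ * r⁻¹) * (κ * -(r ^ 2)⁻¹)) =
          (E' r - κ * E r / r ^ 2) * Real.exp (κ * r⁻¹) := by
        rw [div_eq_mul_inv]; ring
      rw [e]
      exact mul_nonpos_of_nonpos_of_nonneg (by linarith) (Real.exp_nonneg _)
  have h := hanti (mem_Ici.2 le_rfl) hr hr
  simp only [inv_one, mul_one] at h
  refine le_trans ?_ h
  refine le_mul_of_one_le_right (h0 r hr) (Real.one_le_exp ?_)
  have : 0 ≤ r⁻¹ := by positivity
  positivity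

/-- With `m = (n+1)/2` and `c` the cosine moment, `v = r^m c` satisfies `v'' + v = (m² - m) v / r²`.
The quantity bounded here is the energy `v'² + v²`, because `c'` is minus the sine moment and `v' =
r^m (c' + m c / r)`. Its derivative is at most `κ / r²` times itself, so it remains bounded. -/
lemma energy_bound (n : ℕ) : ∃ C : ℝ, 0 < C ∧ ∀ u : EuclideanSpace ℝ (Fin (n + 2)), ‖u‖ = 1 →
    ∀ r : ℝ, 1 ≤ r → r ^ (n + 1) * ((-sinMoment u r + ((n + 1) / 2) * cosMoment u r * r⁻¹) ^ 2 +
      cosMoment u r ^ 2) ≤ C := by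
  set S := sphereArea (n + 2) with hS
  set m : ℝ := (n + 1) / 2 with hm
  have hm0 : 0 < m := by positivity
  set κ := |m ^ 2 - m| with hκ
  have hS0 : 0 ≤ S := measureReal_nonneg
  -- The first term bounds the energy at `r = 1`, uniformly in `u`, times the Grönwall factor; the
  -- `+ 1` only secures positivity.
  refine ⟨((S + m * S) ^ 2 + S ^ 2) * Real.exp κ + 1, by positivity, fun u hu r hr => ?_⟩
  set c := cosMoment u
  set s := sinMoment u
  set w : ℝ → ℝ := fun r => -s r + m * c r * r⁻¹ with hw
  set E : ℝ → ℝ := fun r => r ^ (n + 1) * (w r ^ 2 + c r ^ 2) with hE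
  have hode : ∀ r, 1 ≤ r → cosSqMoment u u r = c r - (n + 1) * s r * r⁻¹ := by
    intro r hr
    have hr0 : r ≠ 0 := by positivity
    have h := cosSqMoment_self hu r
    push_cast at h
    field_simp
    linarith
  have hdw : ∀ r, 1 ≤ r → HasDerivAt w
      (-(c r - (n + 1) * s r * r⁻¹) + (m * (-s r) * r⁻¹ + m * c r * -(r ^ 2)⁻¹)) r := by
    intro r hr
    have hr0 : r ≠ 0 := by positivity
    have h1 := hasDerivAt_sinMoment hu r
    rw [hode r hr] at h1
    exact h1.fun_neg.fun_add (((hasDerivAt_cosMoment hu r).const_mul m).fun_mul (hasDerivAt_inv hr0))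
  have hdE : ∀ r, 1 ≤ r → HasDerivAt E (r ^ (n + 1) * (2 * (m ^ 2 - m) * (c r * w r)) / r ^ 2) r := by
    intro r hr
    have hr0 : r ≠ 0 := by positivity
    refine ((hasDerivAt_pow (n + 1) r).fun_mul (((hdw r hr).fun_pow 2).fun_add
      ((hasDerivAt_cosMoment hu r).fun_pow 2))).congr_deriv ?_
    have hn : (n : ℝ) = 2 * m - 1 := by rw [hm]; ring
    have hs' : s r = m * c r * r⁻¹ - w r := by simp only [hw]; ring
    change ((n + 1 : ℕ) : ℝ) * r ^ (n + 1 - 1) * (w r ^ 2 + c r ^ 2) + r ^ (n + 1) *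
      (((2 : ℕ) : ℝ) * w r ^ (2 - 1) *
        (-(c r - (n + 1) * s r * r⁻¹) + (m * (-s r) * r⁻¹ + m * c r * -(r ^ 2)⁻¹)) +
        ((2 : ℕ) : ℝ) * c r ^ (2 - 1) * (-s r)) = _
    rw [hs']
    push_cast
    rw [hn]
    simp only [pow_succ]
    field_simp
    ring
  have hbound : ∀ r, 1 ≤ r →
      r ^ (n + 1) * (2 * (m ^ 2 - m) * (c r * w r)) / r ^ 2 ≤ κ * E r / r ^ 2 := by
    intro r hr
    have hr0 : 0 < r := by positivity
    refine div_le_div_of_nonneg_right ?_ (by positivity)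
    have h1 : 2 * (m ^ 2 - m) * (c r * w r) ≤ κ * (w r ^ 2 + c r ^ 2) := by
      calc 2 * (m ^ 2 - m) * (c r * w r) = (m ^ 2 - m) * (2 * (c r * w r)) := by ring
        _ ≤ |(m ^ 2 - m) * (2 * (c r * w r))| := le_abs_self _
        _ = κ * |2 * (c r * w r)| := abs_mul _ _
        _ ≤ _ := by
          refine mul_le_mul_of_nonneg_left ?_ (abs_nonneg _)
          rw [abs_le]
          constructor <;> nlinarith [sq_nonneg (c r + w r), sq_nonneg (c r - w r)]
    calc _ ≤ r ^ (n + 1) * (κ * (w r ^ 2 + c r ^ 2)) :=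
          mul_le_mul_of_nonneg_left h1 (by positivity)
      _ = _ := by simp only [hE]; ring
  have h := le_exp_mul_of_deriv_le hdE
    (fun r hr => by have : 0 < r := by positivity
                    simp only [hE]; positivity) (abs_nonneg _) hbound hr
  have hE1 : E 1 ≤ (S + m * S) ^ 2 + S ^ 2 := by
    simp only [hE, hw, one_pow, one_mul, inv_one, mul_one]
    have hc := abs_cosMoment_le u 1
    have hs := abs_sinMoment_le hu 1
    obtain ⟨hc1, hc2⟩ := abs_le.1 hc
    obtain ⟨hs1, hs2⟩ := abs_le.1 hs
    have h3 := mul_le_mul_of_nonneg_left hc1 hm0.le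
    have h4 := mul_le_mul_of_nonneg_left hc2 hm0.le
    refine add_le_add (sq_le_sq' ?_ ?_) (sq_le_sq' ?_ ?_) <;> linarith
  have := mul_le_mul_of_nonneg_right hE1 (Real.exp_nonneg κ)
  change E r ≤ _
  linarith

lemma abs_le_sqrt_mul_rpow {n : ℕ} {r C a : ℝ} (hr : 0 < r)
    (h : r ^ n * a ^ 2 ≤ C) : |a| ≤ √C * r ^ (-(n / 2 : ℝ)) := by
  have hrn : 0 < r ^ n := by positivity
  have e : √(r ^ n) = r ^ (n / 2 : ℝ) := by
    rw [Real.sqrt_eq_rpow, ← Real.rpow_natCast, ← Real.rpow_mul hr.le]; congr 1; ring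
  rw [Real.rpow_neg hr.le, ← div_eq_mul_inv, le_div_iff₀ (by positivity), ← e, ← Real.sqrt_sq_eq_abs,
    ← Real.sqrt_mul (sq_nonneg _), mul_comm]
  exact Real.sqrt_le_sqrt h

/-- Write `v = a u + w` with `w` orthogonal to `u`. The cross term vanishes by reflection, and the
Bessel equation and the orthogonal identity express the remaining moments through the cosine moment
and the sine moment over `r`. The energy bound makes these `O(r^(-m))` for `r ≥ 1`; for `r < 1` the
total mass suffices since `r^(-m) ≥ 1`. -/
lemma cosSqMoment_decay (n : ℕ) : ∃ C : ℝ, 0 < C ∧ ∀ u v : EuclideanSpace ℝ (Fin (n + 2)),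
    ‖u‖ = 1 → ‖v‖ = 1 → ∀ r : ℝ, 0 < r → |cosSqMoment u v r| ≤ C * r ^ (-((n + 1) / 2 : ℝ)) := by
  obtain ⟨C₀, hC₀, hE⟩ := energy_bound n
  set m : ℝ := (n + 1) / 2 with hm
  have hm0 : 0 < m := by positivity
  set S := sphereArea (n + 2) with hS
  have hS0 : 0 ≤ S := measureReal_nonneg
  refine ⟨S + √C₀ + (n + 2) * ((1 + m) * √C₀), by positivity, fun u v hu hv r hr => ?_⟩
  have hrp : 0 < r ^ (-m) := by positivity
  rcases lt_or_ge r 1 with hr1 | hr1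
  · have h1 : |cosSqMoment u v r| ≤ S := by
      refine abs_integral_sphere_le fun ω => ?_
      rw [abs_mul, abs_pow]
      exact mul_le_one₀ (pow_le_one₀ (abs_nonneg _) (abs_inner_sphere_le ω hv.le)) (abs_nonneg _)
        (Real.abs_cos_le_one _)
    have h2 : 1 ≤ r ^ (-m) := Real.one_le_rpow_of_pos_of_le_one_of_nonpos hr hr1.le (by linarith)
    have : 0 ≤ √C₀ + (n + 2) * ((1 + m) * √C₀) := by positivity
    nlinarith
  have hen := hE u hu r hr1
  have hrn : 0 ≤ r ^ (n + 1) := by positivity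
  set a := inner ℝ u v with ha
  set w := v - a • u with hw
  have hvw : v = a • u + w := by rw [hw]; abel
  have ha1 : a ^ 2 ≤ 1 := by
    have := abs_real_inner_le_norm u v
    rw [hu, hv, mul_one] at this
    rw [← sq_abs]; exact pow_le_one₀ (abs_nonneg _) this
  have huw : inner ℝ u w = (0 : ℝ) := inner_sub_smul_self hu
  have hww : ‖w‖ ^ 2 ≤ 1 := by
    rw [hw, norm_sub_smul_sq hu, hv]; nlinarith [sq_nonneg a]
  have hcast : (((n + 1 : ℕ) : ℝ) / 2) = m := by rw [hm]; push_cast; ring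
  have hc : |cosMoment u r| ≤ √C₀ * r ^ (-m) := by
    rw [← hcast]
    refine abs_le_sqrt_mul_rpow hr (le_trans ?_ hen)
    exact mul_le_mul_of_nonneg_left (le_add_of_nonneg_left (sq_nonneg _)) hrn
  have hw' : |-sinMoment u r + m * cosMoment u r * r⁻¹| ≤ √C₀ * r ^ (-m) := by
    rw [show r ^ (-m) = r ^ (-(((n + 1 : ℕ) : ℝ) / 2)) by rw [hcast]]
    refine abs_le_sqrt_mul_rpow hr (le_trans ?_ hen)
    exact mul_le_mul_of_nonneg_left (le_add_of_nonneg_right (sq_nonneg _)) hrn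
  have hri : r⁻¹ ≤ 1 := inv_le_one_of_one_le₀ hr1
  have hri0 : 0 ≤ r⁻¹ := by positivity
  have hs : |sinMoment u r| ≤ (1 + m) * √C₀ * r ^ (-m) := by
    have h1 : |m * cosMoment u r * r⁻¹| ≤ m * (√C₀ * r ^ (-m)) := by
      rw [abs_mul, abs_mul, abs_of_pos hm0, abs_of_nonneg hri0]
      calc _ ≤ m * |cosMoment u r| * 1 := by gcongr
        _ ≤ _ := by rw [mul_one]; gcongr
    have h2 : sinMoment u r = m * cosMoment u r * r⁻¹ -
      (-sinMoment u r + m * cosMoment u r * r⁻¹) := by ring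
    rw [h2]
    refine (abs_sub _ _).trans ?_
    linarith
  have hsr : |sinMoment u r * r⁻¹| ≤ (1 + m) * √C₀ * r ^ (-m) := by
    rw [abs_mul, abs_of_nonneg hri0]
    exact (mul_le_of_le_one_right (abs_nonneg _) hri).trans hs
  have hexp : cosSqMoment u v r = a ^ 2 * cosSqMoment u u r + cosSqMoment u w r := by
    have hpt : ∀ ω : UnitSphere (n + 2), inner ℝ (ω : EuclideanSpace ℝ (Fin (n + 2))) v ^ 2 *
        Real.cos (r * inner ℝ (ω : EuclideanSpace ℝ (Fin (n + 2))) u) =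
        a ^ 2 * (inner ℝ (ω : EuclideanSpace ℝ (Fin (n + 2))) u ^ 2 *
          Real.cos (r * inner ℝ (ω : EuclideanSpace ℝ (Fin (n + 2))) u)) +
        2 * a * (inner ℝ (ω : EuclideanSpace ℝ (Fin (n + 2))) w *
          (inner ℝ (ω : EuclideanSpace ℝ (Fin (n + 2))) u *
          Real.cos (r * inner ℝ (ω : EuclideanSpace ℝ (Fin (n + 2))) u))) +
        inner ℝ (ω : EuclideanSpace ℝ (Fin (n + 2))) w ^ 2 *
          Real.cos (r * inner ℝ (ω : EuclideanSpace ℝ (Fin (n + 2))) u) := by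
      intro ω
      rw [hvw, inner_add_right, inner_smul_right]; ring
    unfold cosSqMoment
    simp_rw [hpt]
    rw [integral_add, integral_add, integral_const_mul, integral_const_mul,
      integral_inner_mul_inner_mul_cos hu huw, mul_zero, add_zero]
    · exact integrable_sphere_of_continuous
        (G := fun x => a ^ 2 * (inner ℝ x u ^ 2 * Real.cos (r * inner ℝ x u))) (by fun_prop)
    · exact integrable_sphere_of_continuous
        (G := fun x => 2 * a * (inner ℝ x w * (inner ℝ x u * Real.cos (r * inner ℝ x u))))
        (by fun_prop)
    · exact integrable_sphere_of_continuous
        (G := fun x => a ^ 2 * (inner ℝ x u ^ 2 * Real.cos (r * inner ℝ x u)) +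
          2 * a * (inner ℝ x w * (inner ℝ x u * Real.cos (r * inner ℝ x u)))) (by fun_prop)
    · exact integrable_sphere_of_continuous
        (G := fun x => inner ℝ x w ^ 2 * Real.cos (r * inner ℝ x u)) (by fun_prop)
  have e1 : cosSqMoment u u r = cosMoment u r - (n + 1) * (sinMoment u r * r⁻¹) := by
    have h := cosSqMoment_self hu r
    push_cast at h
    field_simp
    linarith
  have e2 : cosSqMoment u w r = ‖w‖ ^ 2 * (sinMoment u r * r⁻¹) := by
    have h := cosSqMoment_of_orthogonal hu huw r
    field_simp
    linarith
  set q := sinMoment u r * r⁻¹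
  have e3 : cosSqMoment u v r = a ^ 2 * cosMoment u r + (‖w‖ ^ 2 - a ^ 2 * (n + 1)) * q := by
    rw [hexp, e1, e2]; ring
  have h4 : |‖w‖ ^ 2 - a ^ 2 * ((n : ℝ) + 1)| ≤ (n : ℝ) + 2 := by
    have hn : (0 : ℝ) ≤ n := n.cast_nonneg
    have h5 := mul_le_mul_of_nonneg_right ha1 (by positivity : (0 : ℝ) ≤ n + 1)
    have h6 : 0 ≤ a ^ 2 * ((n : ℝ) + 1) := by positivity
    have h7 := sq_nonneg ‖w‖
    rw [abs_le]; constructor <;> linarith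
  rw [e3]
  calc _ ≤ |a ^ 2 * cosMoment u r| + |(‖w‖ ^ 2 - a ^ 2 * (n + 1)) * q| := abs_add_le _ _
    _ ≤ 1 * (√C₀ * r ^ (-m)) + (n + 2) * ((1 + m) * √C₀ * r ^ (-m)) := by
        rw [abs_mul, abs_mul, abs_of_nonneg (sq_nonneg a)]
        gcongr
    _ ≤ _ := by nlinarith

/-- Decay of the Fourier transform of the measure `ω_j² dσ`. -/
theorem norm_integral_sq_mul_exp_le (n : ℕ) : ∃ C : ℝ, 0 < C ∧ ∀ (j : Fin (n + 2))
    (x : EuclideanSpace ℝ (Fin (n + 2))), x ≠ 0 →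
    ‖∫ ω : UnitSphere (n + 2), (((ω : EuclideanSpace ℝ (Fin (n + 2))) j ^ 2 : ℝ) : ℂ) *
      Complex.exp (-(Complex.I * ((inner ℝ x (ω : EuclideanSpace ℝ (Fin (n + 2))) : ℝ) : ℂ)))
      ∂(surfaceMeasure (n + 2))‖ ≤ C * ‖x‖ ^ (-((n + 1) / 2 : ℝ)) := by
  obtain ⟨C, hC, h⟩ := cosSqMoment_decay n
  refine ⟨C, hC, fun j x hx => ?_⟩
  have hx0 : 0 < ‖x‖ := norm_pos_iff.2 hx
  set u := ‖x‖⁻¹ • x with hu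
  set e : EuclideanSpace ℝ (Fin (n + 2)) := EuclideanSpace.single j 1 with he
  have hb := h u e (by rw [hu, norm_smul, norm_inv, norm_norm, inv_mul_cancel₀ hx0.ne'])
    (by simp [he]) ‖x‖ hx0
  have hxu : ∀ ω : EuclideanSpace ℝ (Fin (n + 2)), ‖x‖ * inner ℝ ω u = inner ℝ x ω := fun ω => by
    rw [hu, inner_smul_right, mul_inv_cancel_left₀ hx0.ne', real_inner_comm]
  have hωe : ∀ ω : EuclideanSpace ℝ (Fin (n + 2)), inner ℝ ω e = ω j := fun ω => by
    simp [he, EuclideanSpace.inner_single_right]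
  unfold cosSqMoment at hb
  simp_rw [hxu, hωe] at hb
  -- The integrand is odd under the antipodal map, so only the cosine part of the exponential
  -- survives.
  have hsin : ∫ ω : UnitSphere (n + 2), (ω : EuclideanSpace ℝ (Fin (n + 2))) j ^ 2 *
      Real.sin (inner ℝ x (ω : EuclideanSpace ℝ (Fin (n + 2)))) ∂(surfaceMeasure (n + 2)) = 0 := by
    have := integral_comp_sphereMap (LinearIsometryEquiv.neg ℝ)
      (fun ω : UnitSphere (n + 2) => (ω : EuclideanSpace ℝ (Fin (n + 2))) j ^ 2 *
      Real.sin (inner ℝ x (ω : EuclideanSpace ℝ (Fin (n + 2)))))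
    simp only [sphereMap, LinearIsometryEquiv.coe_neg, PiLp.neg_apply, neg_sq, inner_neg_right,
      Real.sin_neg, mul_neg, integral_neg] at this
    exact neg_eq_self.1 this
  have hpt : ∀ ω : UnitSphere (n + 2), (((ω : EuclideanSpace ℝ (Fin (n + 2))) j ^ 2 : ℝ) : ℂ) *
      Complex.exp (-(Complex.I * ((inner ℝ x (ω : EuclideanSpace ℝ (Fin (n + 2))) : ℝ) : ℂ))) =
      (((ω : EuclideanSpace ℝ (Fin (n + 2))) j ^ 2 *
        Real.cos (inner ℝ x (ω : EuclideanSpace ℝ (Fin (n + 2)))) : ℝ) : ℂ) -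
      Complex.I * (((ω : EuclideanSpace ℝ (Fin (n + 2))) j ^ 2 *
        Real.sin (inner ℝ x (ω : EuclideanSpace ℝ (Fin (n + 2)))) : ℝ) : ℂ) := by
    intro ω
    rw [show -(Complex.I * ((inner ℝ x (ω : EuclideanSpace ℝ (Fin (n + 2))) : ℝ) : ℂ)) =
      ((-inner ℝ x (ω : EuclideanSpace ℝ (Fin (n + 2))) : ℝ) : ℂ) * Complex.I by push_cast; ring,
      Complex.exp_mul_I, ← Complex.ofReal_cos, ← Complex.ofReal_sin, Real.cos_neg, Real.sin_neg]
    push_cast; ring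
  simp_rw [hpt]
  rw [integral_sub, integral_const_mul, integral_complex_ofReal, integral_complex_ofReal, hsin]
  · simpa using hb
  · exact (integrable_sphere_of_continuous (G := fun ω => ω j ^ 2 * Real.cos (inner ℝ x ω))
      (by fun_prop)).ofReal (𝕜 := ℂ)
  · exact ((integrable_sphere_of_continuous (G := fun ω => ω j ^ 2 * Real.sin (inner ℝ x ω))
      (by fun_prop)).ofReal (𝕜 := ℂ)).const_mul _

end DecayBound

/-! ### Plancherel for integrable square-integrable functions -/

section Plancherel

open FourierTransform SchwartzMap

variable {V : Type*} [NormedAddCommGroup V] [InnerProductSpace ℝ V] [FiniteDimensional ℝ V]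
  [MeasurableSpace V] [BorelSpace V]

lemma integral_fourier_smul_eq {f g : V → ℂ} (hf : Integrable f) (hg : Integrable g) :
    ∫ ξ, 𝓕 f ξ • g ξ = ∫ x, f x • 𝓕 g x := by
  have h := VectorFourier.integral_fourierIntegral_smul_eq_flip (L := innerₗ V) (μ := volume)
    (ν := volume) (e := Real.fourierChar) Real.continuous_fourierChar continuous_inner hf hg
  rwa [flip_innerₗ] at h

/-- On `L¹ ∩ L²` the integral Fourier transform agrees with the one on `L²`. -/
lemma fourier_ae_eq_fourier_toLp {f : V → ℂ} (hf : Integrable f) (hf2 : MemLp f 2) :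
    𝓕 f =ᵐ[volume] (𝓕 (hf2.toLp f) : Lp ℂ 2 (volume : Measure V)) := by
  have hcont : Continuous (𝓕 f) :=
    VectorFourier.fourierIntegral_continuous Real.continuous_fourierChar continuous_inner hf
  -- Both functions are compared through test functions: on each side the Fourier transform is moved
  -- to the test function, once by Fubini and once by the definition for tempered distributions.
  refine ae_eq_of_integral_contDiff_smul_eq hcont.locallyIntegrable
    ((Lp.memLp _).locallyIntegrable (by norm_num)) fun g hg hgc => ?_
  have hg₁ : HasCompactSupport (Complex.ofRealCLM ∘ g) := hgc.comp_left rfl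
  have hg₂ : ContDiff ℝ (⊤ : ℕ∞) (Complex.ofRealCLM ∘ g) := by fun_prop
  set G : 𝓢(V, ℂ) := hg₁.toSchwartzMap hg₂ with hG
  have hGg : ∀ x, G x = (g x : ℂ) := fun x => rfl
  have h1 : ∫ x, g x • (𝓕 (hf2.toLp f) : Lp ℂ 2 (volume : Measure V)) x =
      Lp.toTemperedDistribution (𝓕 (hf2.toLp f) : Lp ℂ 2 (volume : Measure V)) G := by
    rw [Lp.toTemperedDistribution_apply]
    refine integral_congr_ae (Filter.Eventually.of_forall fun x => ?_)
    simp [hGg]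
  rw [h1, ← Lp.fourier_toTemperedDistribution_eq, TemperedDistribution.fourier_apply,
    Lp.toTemperedDistribution_apply]
  have h2 : ∫ x, (𝓕 G) x • (hf2.toLp f) x = ∫ x, f x • 𝓕 (G : V → ℂ) x := by
    refine integral_congr_ae ?_
    filter_upwards [hf2.coeFn_toLp] with x hx
    rw [hx, SchwartzMap.fourier_coe, smul_eq_mul, smul_eq_mul, mul_comm]
  rw [h2, ← integral_fourier_smul_eq hf G.integrable]
  refine integral_congr_ae (Filter.Eventually.of_forall fun x => ?_)
  simp [hGg, mul_comm]

lemma lintegral_enorm_fourier_sq {f : V → ℂ} (hf : Integrable f) (hf2 : MemLp f 2) :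
    ∫⁻ ξ, ‖𝓕 f ξ‖ₑ ^ 2 = ∫⁻ x, ‖f x‖ₑ ^ 2 := by
  have hn : ∀ g : V → ℂ, ∫⁻ x, ‖g x‖ₑ ^ 2 = eLpNorm g 2 volume ^ 2 := fun g => by
    rw [eLpNorm_eq_lintegral_rpow_enorm_toReal two_ne_zero ENNReal.ofNat_ne_top,
      ← ENNReal.rpow_natCast, ← ENNReal.rpow_mul]
    simp
  rw [hn, hn, eLpNorm_congr_ae (fourier_ae_eq_fourier_toLp hf hf2)]
  have h := Lp.norm_fourier_eq (hf2.toLp f)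
  rw [Lp.norm_def, Lp.norm_def, ENNReal.toReal_eq_toReal_iff' (Lp.eLpNorm_ne_top _)
    (Lp.eLpNorm_ne_top _)] at h
  rw [h, eLpNorm_congr_ae hf2.coeFn_toLp]

end Plancherel

/-! ### Plane waves and the unnormalized Fourier transform -/

section WaveTransform

/-- The plane wave `e^{-i⟨x, ξ⟩}`. -/
def wave {V : Type*} [NormedAddCommGroup V] [InnerProductSpace ℝ V] (x ξ : V) : ℂ :=
  Complex.exp (-(Complex.I * ((inner ℝ x ξ : ℝ) : ℂ)))

/-- The Fourier transform normalized as `∫ f(x) e^{-i⟨x, ξ⟩} dx`. -/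
def waveTransform {V : Type*} [NormedAddCommGroup V] [InnerProductSpace ℝ V] [MeasureSpace V]
    (f : V → ℂ) (ξ : V) : ℂ :=
  ∫ x, f x * wave x ξ

section Wave

variable {V : Type*} [NormedAddCommGroup V] [InnerProductSpace ℝ V]

lemma norm_wave (x ξ : V) : ‖wave x ξ‖ = 1 := by
  rw [wave, show -(Complex.I * ((inner ℝ x ξ : ℝ) : ℂ)) = ((-inner ℝ x ξ : ℝ) : ℂ) * Complex.I by
    push_cast; ring, Complex.norm_exp_ofReal_mul_I]

lemma continuous_wave : Continuous fun p : V × V => wave p.1 p.2 := by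
  unfold wave; fun_prop

lemma wave_add_left (x y ξ : V) : wave (x + y) ξ = wave x ξ * wave y ξ := by
  rw [wave, wave, wave, ← Complex.exp_add, inner_add_left]; congr 1; push_cast; ring

lemma conj_wave (x ξ : V) : (starRingEnd ℂ) (wave x ξ) = wave (-x) ξ := by
  rw [wave, wave, ← Complex.exp_conj, inner_neg_left]; simp

lemma wave_neg_comm (x ξ : V) : wave (-x) ξ = wave x (-ξ) := by
  rw [wave, wave, inner_neg_left, inner_neg_right]

variable [FiniteDimensional ℝ V] [MeasurableSpace V] [BorelSpace V]

lemma continuous_waveTransform {f : V → ℂ} (hf : Integrable f) :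
    Continuous (waveTransform f) := by
  refine continuous_of_dominated (bound := fun x => ‖f x‖) (fun ξ => ?_) (fun ξ => ?_) hf.norm ?_
  · exact hf.aestronglyMeasurable.mul
      (continuous_wave.comp (Continuous.prodMk_left ξ)).aestronglyMeasurable
  · exact Filter.Eventually.of_forall fun x => by rw [norm_mul, norm_wave, mul_one]
  · exact Filter.Eventually.of_forall fun x =>
      continuous_const.mul (continuous_wave.comp (Continuous.prodMk_right x))

end Wave

lemma waveTransform_eq_fourier {n : ℕ} (f : EuclideanSpace ℝ (Fin n) → ℂ)
    (ξ : EuclideanSpace ℝ (Fin n)) :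
    waveTransform f ξ = FourierTransform.fourier f ((2 * Real.pi)⁻¹ • ξ) := by
  rw [Real.fourier_eq']
  refine integral_congr_ae (Filter.Eventually.of_forall fun x => ?_)
  simp only [wave, smul_eq_mul, inner_smul_right]
  rw [mul_comm]
  congr 2
  push_cast
  have : (Real.pi : ℂ) ≠ 0 := by exact_mod_cast Real.pi_ne_zero
  field_simp

lemma lintegral_enorm_waveTransform_sq {n : ℕ} {f : EuclideanSpace ℝ (Fin n) → ℂ}
    (hf : Integrable f) (hf2 : MemLp f 2) :
    ∫⁻ ξ, ‖waveTransform f ξ‖ₑ ^ 2 =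
      ENNReal.ofReal ((2 * Real.pi) ^ n) * ∫⁻ x, ‖f x‖ₑ ^ 2 := by
  simp_rw [waveTransform_eq_fourier]
  rw [lintegral_comp_inv_smul (Φ := fun ξ => ‖FourierTransform.fourier f ξ‖ₑ ^ 2)
    (by positivity), lintegral_enorm_fourier_sq hf hf2]

/-- Fubini for a superposition of product kernels. -/
lemma bilinKernel_superposition {X S : Type*} [MeasurableSpace X] [MeasurableSpace S]
    {μ : Measure X} [SFinite μ] {σ : Measure S} [SFinite σ] {H : S → ℂ} {e e' : X → S → ℂ}
    (hHi : Integrable H σ) (he : Measurable (Function.uncurry e))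
    (he' : Measurable (Function.uncurry e'))
    (he1 : ∀ x s, ‖e x s‖ ≤ 1) (he1' : ∀ x s, ‖e' x s‖ ≤ 1) {f g : X → ℂ} (hf : Integrable f μ)
    (hg : Integrable g μ) (hgm : Measurable g) :
    bilinKernel μ (fun x y => ∫ s, H s * (e x s * e' y s) ∂σ) f g =
      ∫ s, H s * ((∫ x, f x * e x s ∂μ) * ∫ y, g y * e' y s ∂μ) ∂σ := by
  have hg' : ∀ x, ∫ y, g y * ∫ s, H s * (e x s * e' y s) ∂σ ∂μ =
      ∫ s, (H s * ∫ y, g y * e' y s ∂μ) * e x s ∂σ := by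
    intro x
    simp_rw [← integral_const_mul]
    rw [integral_integral_swap]
    · refine integral_congr_ae (Filter.Eventually.of_forall fun s => ?_)
      simp only
      rw [← integral_mul_const]
      refine integral_congr_ae (Filter.Eventually.of_forall fun y => ?_)
      simp only
      ring
    · have hm : Measurable fun p : X × S => e x p.2 * e' p.1 p.2 :=
        (he.comp (measurable_const.prodMk measurable_snd)).mul he'
      have := (hg.mul_prod hHi).mul_bdd (c := 1) hm.aestronglyMeasurable
        (Filter.Eventually.of_forall fun p => by
          rw [norm_mul]; exact mul_le_one₀ (he1 _ _) (norm_nonneg _) (he1' _ _))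
      simpa only [Function.uncurry_def, mul_assoc] using this
  have hĝm : Measurable fun s => ∫ y, g y * e' y s ∂μ := by
    have : Measurable fun p : X × S => g p.1 * e' p.1 p.2 := (hgm.comp measurable_fst).mul he'
    exact this.stronglyMeasurable.integral_prod_left'.measurable
  set ĝ : S → ℂ := fun s => ∫ y, g y * e' y s ∂μ with hĝ
  have hg'' : ∀ x, ∫ y, g y * ∫ s, H s * (e x s * e' y s) ∂σ ∂μ = ∫ s, (H s * ĝ s) * e x s ∂σ := hg'
  unfold bilinKernel
  simp_rw [hg'', ← integral_const_mul]
  rw [integral_integral_swap]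
  · refine integral_congr_ae (Filter.Eventually.of_forall fun s => ?_)
    simp only
    have h1 : ∀ x, f x * (H s * ĝ s * e x s) = H s * ĝ s * (f x * e x s) := fun x => by ring
    simp_rw [h1]
    rw [integral_const_mul, integral_const_mul, integral_const_mul]
    simp only [hĝ]
    ring
  · have hi : Integrable (fun s => H s * ĝ s) σ := by
      refine hHi.mul_bdd (c := (∫ y, ‖g y‖ ∂μ) * 1) hĝm.aestronglyMeasurable
        (Filter.Eventually.of_forall fun s => norm_integral_mul_kernel_le hg fun y => he1' y s)
    have := (hf.mul_prod hi).mul_bdd (c := 1) he.aestronglyMeasurable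
        (Filter.Eventually.of_forall fun p => he1 p.1 p.2)
    simpa only [Function.uncurry_def, mul_assoc] using this

end WaveTransform

/-! ### Dispersive estimates between parallel slices -/

section SliceKernel

variable {n : ℕ}

/-- The Fourier transform of the measure `ω_j² dσ`. -/
def sphereKernel (j : Fin n) (z : EuclideanSpace ℝ (Fin n)) : ℂ :=
  ∫ ω : UnitSphere n, (((ω : EuclideanSpace ℝ (Fin n)) j ^ 2 : ℝ) : ℂ) *
    wave z (ω : EuclideanSpace ℝ (Fin n)) ∂(surfaceMeasure n)

lemma abs_coord_sphere_le (ω : UnitSphere n) (j : Fin n) :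
    |(ω : EuclideanSpace ℝ (Fin n)) j| ≤ 1 := by
  have := PiLp.norm_apply_le (ω : EuclideanSpace ℝ (Fin n)) j
  rwa [norm_eq_of_mem_sphere] at this

lemma norm_coord_sq_le (ω : UnitSphere n) (j : Fin n) :
    ‖(((ω : EuclideanSpace ℝ (Fin n)) j ^ 2 : ℝ) : ℂ)‖ ≤ 1 := by
  rw [Complex.norm_real, Real.norm_eq_abs, abs_pow]
  exact pow_le_one₀ (abs_nonneg _) (abs_coord_sphere_le ω j)

lemma continuous_sphereKernel (j : Fin n) : Continuous (sphereKernel j) := by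
  refine continuous_of_dominated (bound := fun _ => (1 : ℝ)) (fun z => ?_) (fun z => ?_)
    (integrable_const _) ?_
  · refine Continuous.aestronglyMeasurable (Continuous.mul (by fun_prop) ?_)
    exact (continuous_wave.comp (Continuous.prodMk_right z)).comp continuous_subtype_val
  · refine Filter.Eventually.of_forall fun ω => ?_
    rw [norm_mul, norm_wave, mul_one]
    exact norm_coord_sq_le ω j
  · exact Filter.Eventually.of_forall fun ω =>
      continuous_const.mul (continuous_wave.comp (Continuous.prodMk_left _))

lemma norm_sphereKernel_le (j : Fin n) (z : EuclideanSpace ℝ (Fin n)) :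
    ‖sphereKernel j z‖ ≤ sphereArea n := by
  have := norm_integral_le_of_norm_le_const (μ := surfaceMeasure n) (C := 1)
    (f := fun ω : UnitSphere n => (((ω : EuclideanSpace ℝ (Fin n)) j ^ 2 : ℝ) : ℂ) *
    wave z (ω : EuclideanSpace ℝ (Fin n))) (Filter.Eventually.of_forall fun ω => by
      rw [norm_mul, norm_wave, mul_one]; exact norm_coord_sq_le ω j)
  rwa [one_mul] at this

/-- A point with `j`-th coordinate `τ` has norm at least `|τ|`, so the decay is uniform within a
slice. -/
lemma norm_sphereKernel_insertCoord_le (n : ℕ) : ∃ C : ℝ, 0 < C ∧ ∀ (j : Fin (n + 2)) (τ : ℝ)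
    (x : EuclideanSpace ℝ (Fin (n + 1))), τ ≠ 0 →
    ‖sphereKernel j (insertCoord j (τ, x))‖ ≤ C * |τ| ^ (-((n + 1) / 2 : ℝ)) := by
  obtain ⟨C, hC, h⟩ := norm_integral_sq_mul_exp_le n
  refine ⟨C, hC, fun j τ x hτ => ?_⟩
  have hle : |τ| ≤ ‖insertCoord j (τ, x)‖ := by
    rw [norm_insertCoord]
    exact Real.abs_le_sqrt (le_add_of_nonneg_right (sq_nonneg _))
  have hτ0 : 0 < |τ| := abs_pos.2 hτ
  have hz : insertCoord j (τ, x) ≠ 0 := norm_pos_iff.1 (hτ0.trans_le hle)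
  refine (h j _ hz).trans (mul_le_mul_of_nonneg_left ?_ hC.le)
  exact Real.rpow_le_rpow_of_nonpos hτ0 hle (by
    have : (0 : ℝ) ≤ (n + 1) / 2 := by positivity
    linarith)

lemma wave_insertCoord_sub (j : Fin (n + 1)) (τ : ℝ) (x y : EuclideanSpace ℝ (Fin n))
    (ω : EuclideanSpace ℝ (Fin (n + 1))) :
    wave (insertCoord j (τ, x - y)) ω = Complex.exp (-(Complex.I * ((τ * ω j : ℝ) : ℂ))) *
      (wave x (removeCoord j ω) * wave y (-removeCoord j ω)) := by
  simp only [wave, ← Complex.exp_add, inner_insertCoord, inner_sub_left, inner_neg_right]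
  congr 1; push_cast; ring

lemma norm_exp_neg_I_mul (t : ℝ) : ‖Complex.exp (-(Complex.I * (t : ℂ)))‖ = 1 := by
  rw [show -(Complex.I * (t : ℂ)) = ((-t : ℝ) : ℂ) * Complex.I by push_cast; ring,
    Complex.norm_exp_ofReal_mul_I]

/-- The kernel is a superposition over `ω` of products of plane waves in `x` and `y`, so Fubini
diagonalizes the form; `τ` enters only through a unimodular factor. -/
lemma bilinKernel_slice_eq (j : Fin (n + 1)) (τ : ℝ) {f g : EuclideanSpace ℝ (Fin n) → ℂ}
    (hf : Integrable f) (hg : Integrable g) (hgm : Measurable g) :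
    bilinKernel volume (fun x y => sphereKernel j (insertCoord j (τ, x - y))) f g =
      ∫ ω : UnitSphere (n + 1), ((((ω : EuclideanSpace ℝ (Fin (n + 1))) j ^ 2 : ℝ) : ℂ) *
        Complex.exp (-(Complex.I * ((τ * (ω : EuclideanSpace ℝ (Fin (n + 1))) j : ℝ) : ℂ)))) *
        (waveTransform f (removeCoord j ω) * waveTransform g (-removeCoord j ω))
        ∂(surfaceMeasure (n + 1)) := by
  have hrm : Measurable fun ω : UnitSphere (n + 1) => removeCoord j ω :=
    (continuous_removeCoord j).measurable.comp measurable_subtype_coe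
  have hHm : Measurable fun ω : UnitSphere (n + 1) =>
      (((ω : EuclideanSpace ℝ (Fin (n + 1))) j ^ 2 : ℝ) : ℂ) *
        Complex.exp (-(Complex.I * ((τ * (ω : EuclideanSpace ℝ (Fin (n + 1))) j : ℝ) : ℂ))) := by
    fun_prop
  refine Eq.trans ?_ (bilinKernel_superposition (σ := surfaceMeasure (n + 1))
    (H := fun ω : UnitSphere (n + 1) => ((((ω : EuclideanSpace ℝ (Fin (n + 1))) j ^ 2 : ℝ) : ℂ) *
        Complex.exp (-(Complex.I * ((τ * (ω : EuclideanSpace ℝ (Fin (n + 1))) j : ℝ) : ℂ)))))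
    (e := fun x ω => wave x (removeCoord j ω)) (e' := fun x ω => wave x (-removeCoord j ω))
    (Integrable.of_bound hHm.aestronglyMeasurable 1 (Filter.Eventually.of_forall fun ω => ?_))
    ?_ ?_ (fun x ω => (norm_wave _ _).le) (fun x ω => (norm_wave _ _).le)
    hf hg hgm)
  · congr 1
    ext x y
    refine integral_congr_ae (Filter.Eventually.of_forall fun ω => ?_)
    simp only
    rw [wave_insertCoord_sub, mul_assoc]
  · rw [norm_mul, norm_exp_neg_I_mul, mul_one]
    exact norm_coord_sq_le ω j
  · exact continuous_wave.measurable.comp (measurable_fst.prodMk (hrm.comp measurable_snd))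
  · exact continuous_wave.measurable.comp (measurable_fst.prodMk (hrm.comp measurable_snd).neg)

/-- The weight `|ω_j|` makes the projected measure bounded by Lebesgue measure, and Plancherel on
the hyperplane applies. Both signs are needed for the two arguments of the slice form. -/
lemma lintegral_sphere_waveTransform_sq_le (n : ℕ) : ∃ C : ℝ, 0 < C ∧ ∀ (j : Fin (n + 1))
    (f : EuclideanSpace ℝ (Fin n) → ℂ) (E : Set (EuclideanSpace ℝ (Fin n))), Measurable f →
    MeasurableSet E → volume E < ⊤ → (∀ x, ‖f x‖ₑ ≤ E.indicator 1 x) → Integrable f ∧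
    (∫⁻ ω : UnitSphere (n + 1), ENNReal.ofReal |(ω : EuclideanSpace ℝ (Fin (n + 1))) j| *
      ‖waveTransform f (removeCoord j ω)‖ₑ ^ 2 ∂(surfaceMeasure (n + 1)) ≤
      ENNReal.ofReal C * volume E) ∧
    (∫⁻ ω : UnitSphere (n + 1), ENNReal.ofReal |(ω : EuclideanSpace ℝ (Fin (n + 1))) j| *
      ‖waveTransform f (-removeCoord j ω)‖ₑ ^ 2 ∂(surfaceMeasure (n + 1)) ≤
      ENNReal.ofReal C * volume E) := by
  obtain ⟨C, hC, h⟩ := lintegral_sphere_abs_mul_le n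
  refine ⟨C * (2 * Real.pi) ^ n, by positivity, fun j f E hf hE hEt hfE => ?_⟩
  have hfi : Integrable f := by
    refine ⟨hf.aestronglyMeasurable, (lintegral_mono hfE).trans_lt ?_⟩
    rwa [lintegral_indicator_one hE]
  have hsq : ∫⁻ x, ‖f x‖ₑ ^ 2 ≤ volume E := by
    rw [← lintegral_indicator_one hE]
    refine lintegral_mono fun x => ?_
    refine (pow_le_pow_left' (hfE x) 2).trans ?_
    by_cases hx : x ∈ E <;> simp [hx]
  have hf2 : MemLp f 2 := by
    refine ⟨hf.aestronglyMeasurable, ?_⟩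
    rw [eLpNorm_lt_top_iff_lintegral_rpow_enorm_lt_top two_ne_zero ENNReal.ofNat_ne_top]
    simpa using hsq.trans_lt hEt
  have hm : Measurable fun ξ => ‖waveTransform f ξ‖ₑ ^ 2 :=
    (continuous_waveTransform hfi).measurable.enorm.pow_const 2
  have hpl : ENNReal.ofReal C * ∫⁻ ξ, ‖waveTransform f ξ‖ₑ ^ 2 ≤
      ENNReal.ofReal (C * (2 * Real.pi) ^ n) * volume E := by
    rw [lintegral_enorm_waveTransform_sq hfi hf2, ENNReal.ofReal_mul hC.le, mul_assoc]
    gcongr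
  refine ⟨hfi, (h j _ hm).trans hpl, (h j (fun ξ => ‖waveTransform f (-ξ)‖ₑ ^ 2)
    (hm.comp measurable_neg)).trans ?_⟩
  rw [lintegral_neg_eq_self (fun ξ => ‖waveTransform f ξ‖ₑ ^ 2)]
  exact hpl

/-- Cauchy–Schwarz with respect to `|ω_j| dσ`, after `ω_j² ≤ |ω_j|`. The weight `ω_j²` is what
compensates for the projection being singular on the equator, and the bound does not see `τ`. -/
lemma enorm_bilinKernel_slice_le (n : ℕ) : ∃ D : ℝ, 0 < D ∧ ∀ (j : Fin (n + 1)) (τ : ℝ)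
    (f g : EuclideanSpace ℝ (Fin n) → ℂ) (E E' : Set (EuclideanSpace ℝ (Fin n))), Measurable f →
    Measurable g → MeasurableSet E → MeasurableSet E' → volume E < ⊤ → volume E' < ⊤ →
    (∀ x, ‖f x‖ₑ ≤ E.indicator 1 x) → (∀ x, ‖g x‖ₑ ≤ E'.indicator 1 x) →
    ‖bilinKernel volume (fun x y => sphereKernel j (insertCoord j (τ, x - y))) f g‖ₑ ≤
      ENNReal.ofReal D * (volume E * volume E') ^ (1 / 2 : ℝ) := by
  obtain ⟨C, hC, h⟩ := lintegral_sphere_waveTransform_sq_le n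
  refine ⟨C, hC, fun j τ f g E E' hf hg hE hE' hEt hEt' hfE hgE => ?_⟩
  obtain ⟨hfi, hf1, -⟩ := h j f E hf hE hEt hfE
  obtain ⟨hgi, -, hg1⟩ := h j g E' hg hE' hEt' hgE
  rw [bilinKernel_slice_eq j τ hfi hgi hg]
  have hrm : Measurable fun ω : UnitSphere (n + 1) => removeCoord j ω :=
    (continuous_removeCoord j).measurable.comp measurable_subtype_coe
  set w : UnitSphere (n + 1) → ℝ≥0∞ := fun ω =>
    ENNReal.ofReal |(ω : EuclideanSpace ℝ (Fin (n + 1))) j| with hw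
  have hwm : Measurable w := by fun_prop
  set p : UnitSphere (n + 1) → ℝ≥0∞ := fun ω =>
    w ω ^ (1 / 2 : ℝ) * ‖waveTransform f (removeCoord j ω)‖ₑ with hp
  set q : UnitSphere (n + 1) → ℝ≥0∞ := fun ω =>
    w ω ^ (1 / 2 : ℝ) * ‖waveTransform g (-removeCoord j ω)‖ₑ with hq
  have hpm : Measurable p :=
    (hwm.pow_const _).mul ((continuous_waveTransform hfi).measurable.comp hrm).enorm
  have hqm : Measurable q :=
    (hwm.pow_const _).mul ((continuous_waveTransform hgi).measurable.comp hrm.neg).enorm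
  have hww : ∀ ω, w ω ^ (1 / 2 : ℝ) * w ω ^ (1 / 2 : ℝ) = w ω := fun ω => by
    rw [← ENNReal.rpow_add_of_nonneg _ _ (by norm_num) (by norm_num)]; norm_num
  have hsq : ∀ (ω) (z : ℝ≥0∞), (w ω ^ (1 / 2 : ℝ) * z) ^ (2 : ℝ) = w ω * z ^ 2 := fun ω z => by
    rw [ENNReal.rpow_two, mul_pow, sq, hww]
  calc _ ≤ ∫⁻ ω, p ω * q ω ∂(surfaceMeasure (n + 1)) := by
        refine (enorm_integral_le_lintegral_enorm _).trans (lintegral_mono fun ω => ?_)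
        have h1 : ‖(((ω : EuclideanSpace ℝ (Fin (n + 1))) j ^ 2 : ℝ) : ℂ) *
            Complex.exp (-(Complex.I * ((τ * (ω : EuclideanSpace ℝ (Fin (n + 1))) j : ℝ) : ℂ)))‖ₑ
            ≤ w ω := by
          rw [← ofReal_norm, norm_mul, norm_exp_neg_I_mul, mul_one, Complex.norm_real,
            Real.norm_eq_abs, abs_pow]
          refine ENNReal.ofReal_le_ofReal ?_
          rw [sq]
          exact mul_le_of_le_one_left (abs_nonneg _) (abs_coord_sphere_le ω j)
        rw [enorm_mul, enorm_mul (waveTransform _ _)]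
        calc _ ≤ w ω * (‖waveTransform f (removeCoord j ω)‖ₑ *
              ‖waveTransform g (-removeCoord j ω)‖ₑ) := mul_le_mul_left h1 _
          _ = _ := by
              rw [← hww ω]; simp only [hp, hq]; ring
    _ ≤ (∫⁻ ω, p ω ^ (2 : ℝ) ∂(surfaceMeasure (n + 1))) ^ (1 / 2 : ℝ) *
        (∫⁻ ω, q ω ^ (2 : ℝ) ∂(surfaceMeasure (n + 1))) ^ (1 / 2 : ℝ) :=
        ENNReal.lintegral_mul_le_Lp_mul_Lq _ Real.HolderConjugate.two_two hpm.aemeasurable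
          hqm.aemeasurable
    _ ≤ (ENNReal.ofReal C * volume E) ^ (1 / 2 : ℝ) *
        (ENNReal.ofReal C * volume E') ^ (1 / 2 : ℝ) := by
        simp only [hp, hq, hsq]
        gcongr
    _ = _ := by
        rw [← ENNReal.mul_rpow_of_nonneg _ _ (by norm_num), mul_mul_mul_comm,
          ENNReal.mul_rpow_of_nonneg _ _ (by norm_num),
          ENNReal.mul_rpow_of_nonneg _ _ (by norm_num),
          ← ENNReal.rpow_add_of_nonneg _ _ (by norm_num) (by norm_num)]
        norm_num

/-- The interpolated dispersive estimate. -/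
theorem norm_bilinKernel_slice_le (n : ℕ) {r : ℝ} (hr1 : 1 < r) (hr2 : r < 2) : ∃ C : ℝ, 0 < C ∧
    ∀ (j : Fin (n + 2)) (τ : ℝ), τ ≠ 0 → ∀ f g : EuclideanSpace ℝ (Fin (n + 1)) → ℂ,
    Measurable f → Measurable g → Integrable f → Integrable g → ∀ a b : ℝ, 0 ≤ a → 0 ≤ b →
    ∫⁻ x, ‖f x‖ₑ ^ r = ENNReal.ofReal (a ^ r) → ∫⁻ x, ‖g x‖ₑ ^ r = ENNReal.ofReal (b ^ r) →
    ‖bilinKernel volume (fun x y => sphereKernel j (insertCoord j (τ, x - y))) f g‖ ≤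
      C * |τ| ^ (-((n + 1) / 2 * (2 / r - 1) : ℝ)) * (a * b) := by
  obtain ⟨A, hA, hA'⟩ := norm_sphereKernel_insertCoord_le n
  obtain ⟨D, hD, hD'⟩ := enorm_bilinKernel_slice_le (n + 1)
  have hs : 0 < 1 - r / 2 := by linarith
  refine ⟨(1 + 2 * D / (1 - r / 2)) * A ^ (2 / r - 1), by positivity,
    fun j τ hτ f g hf hg hfi hgi a b ha hb hfa hgb => ?_⟩
  have hτ0 : 0 < |τ| := abs_pos.2 hτ
  have hk : Measurable (Function.uncurry fun x y : EuclideanSpace ℝ (Fin (n + 1)) =>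
      sphereKernel j (insertCoord j (τ, x - y))) :=
    (continuous_sphereKernel j).measurable.comp ((continuous_insertCoord j).measurable.comp
      (measurable_const.prodMk (measurable_fst.sub measurable_snd)))
  have h := bilinKernel_le hr1 hr2 (A := A * |τ| ^ (-((n + 1) / 2 : ℝ))) (by positivity) hD hk
    (fun x y => hA' j τ (x - y) hτ) (hD' j τ) hf hg hfi hgi ha hb hfa hgb
  refine h.trans (le_of_eq ?_)
  rw [Real.mul_rpow hA.le (by positivity), ← Real.rpow_mul hτ0.le, neg_mul]
  ring

end SliceKernel

/-! ### The restriction estimate at the endpoint -/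

/-- Fubini on a product for a bounded kernel, slice by slice. -/
lemma enorm_bilinKernel_prod_le {T X : Type*} [MeasurableSpace T] [MeasurableSpace X]
    {μ : Measure T} {ν : Measure X} [SFinite μ] [SFinite ν] {K : T × X → T × X → ℂ}
    (hK : Measurable (Function.uncurry K)) {A : ℝ} (hA : ∀ p q, ‖K p q‖ ≤ A)
    {f g : T × X → ℂ} (hf : Integrable f (μ.prod ν))
    (hg : Integrable g (μ.prod ν)) (hgm : Measurable g)
    (hft : ∀ t, Integrable (fun x => f (t, x)) ν) (hgt : ∀ t, Integrable (fun x => g (t, x)) ν) :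
    ‖bilinKernel (μ.prod ν) K f g‖ₑ ≤ ∫⁻ t, ∫⁻ s,
      ‖bilinKernel ν (fun x y => K (t, x) (s, y)) (fun x => f (t, x)) (fun y => g (s, y))‖ₑ ∂μ ∂μ := by
  set G : T × X → ℂ := fun p => ∫ q, g q * K p q ∂(μ.prod ν) with hG
  have hGm : Measurable G := by
    have : Measurable fun z : (T × X) × (T × X) => g z.2 * K z.1 z.2 :=
      (hgm.comp measurable_snd).mul hK
    exact this.stronglyMeasurable.integral_prod_right'.measurable
  have hGb : ∀ p, ‖G p‖ ≤ (∫ q, ‖g q‖ ∂(μ.prod ν)) * A := fun p =>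
    norm_integral_mul_kernel_le hg (hA p)
  have hGi : Integrable (fun p => f p * G p) (μ.prod ν) :=
    hf.mul_bdd hGm.aestronglyMeasurable (Filter.Eventually.of_forall hGb)
  have h1 : bilinKernel (μ.prod ν) K f g = ∫ t, ∫ x, f (t, x) * G (t, x) ∂ν ∂μ :=
    integral_prod _ hGi
  rw [h1]
  refine (enorm_integral_le_lintegral_enorm _).trans (lintegral_mono fun t => ?_)
  have hKt : ∀ t, Measurable fun z : X × (T × X) => K (t, z.1) z.2 := fun t =>
    hK.comp ((measurable_const.prodMk measurable_fst).prodMk measurable_snd)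
  have h2 : ∀ x, G (t, x) = ∫ s, ∫ y, g (s, y) * K (t, x) (s, y) ∂ν ∂μ := by
    intro x
    refine integral_prod _ (hg.mul_bdd (c := A) ?_ (Filter.Eventually.of_forall fun q => hA _ q))
    exact ((hKt t).comp measurable_prodMk_left).aestronglyMeasurable
  have h3 : ∫ x, f (t, x) * G (t, x) ∂ν =
      ∫ s, ∫ x, f (t, x) * ∫ y, g (s, y) * K (t, x) (s, y) ∂ν ∂ν ∂μ := by
    simp_rw [h2, ← integral_const_mul (f (t, _))]
    rw [integral_integral_swap]
    have hm : Measurable fun z : X × T => ∫ y, g (z.2, y) * K (t, z.1) (z.2, y) ∂ν := by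
      have : Measurable fun z : (X × T) × X => g (z.1.2, z.2) * K (t, z.1.1) (z.1.2, z.2) := by
        refine (hgm.comp ((measurable_snd.comp measurable_fst).prodMk measurable_snd)).mul ?_
        exact (hKt t).comp ((measurable_fst.comp measurable_fst).prodMk
          ((measurable_snd.comp measurable_fst).prodMk measurable_snd))
      exact this.stronglyMeasurable.integral_prod_right'.measurable
    have hgn : Integrable (fun s => (∫ y, ‖g (s, y)‖ ∂ν) * A) μ := hg.norm.integral_prod_left.mul_const A
    simp_rw [integral_const_mul]
    refine Integrable.mono' ((hft t).norm.mul_prod hgn)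
      ((hft t).aestronglyMeasurable.comp_fst.mul hm.aestronglyMeasurable)
      (Filter.Eventually.of_forall fun z => ?_)
    simp only [Function.uncurry]
    rw [norm_mul]
    exact mul_le_mul_of_nonneg_left
      (norm_integral_mul_kernel_le (hgt z.2) fun y => hA _ _) (norm_nonneg _)
  rw [h3]
  exact enorm_integral_le_lintegral_enorm _

section Restriction

variable {n : ℕ}

lemma integrable_of_enorm_le_indicator {V : Type*} [MeasurableSpace V] {μ : Measure V} {f : V → ℂ}
    (hf : Measurable f) {E : Set V} (hE : MeasurableSet E) (hEt : μ E < ⊤) {B : ℝ}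
    (hfE : ∀ x, ‖f x‖ₑ ≤ E.indicator (fun _ => ENNReal.ofReal B) x) : Integrable f μ := by
  refine ⟨hf.aestronglyMeasurable, (lintegral_mono hfE).trans_lt ?_⟩
  rw [lintegral_indicator hE, setLIntegral_const]
  exact ENNReal.mul_lt_top ENNReal.ofReal_lt_top hEt

lemma integrable_conj {X : Type*} [MeasurableSpace X] {μ : Measure X} {f : X → ℂ}
    (hf : Integrable f μ) : Integrable (fun x => (starRingEnd ℂ) (f x)) μ :=
  (RCLike.conjLIE (K := ℂ)).toContinuousLinearEquiv.integrable_comp_iff.2 hf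

/-- The `T T*` identity: the form at `F` and its conjugate is the squared norm of the Fourier
transform of `F` in `L²(ω_j² dσ)`. -/
lemma bilinKernel_sphereKernel_sub (j : Fin n) {F : EuclideanSpace ℝ (Fin n) → ℂ}
    (hF : Integrable F) (hFm : Measurable F) :
    bilinKernel volume (fun x y => sphereKernel j (x - y)) F (fun y => (starRingEnd ℂ) (F y)) =
      ∫ ω : UnitSphere n, (((ω : EuclideanSpace ℝ (Fin n)) j ^ 2 : ℝ) : ℂ) *
        (waveTransform F ω * (starRingEnd ℂ) (waveTransform F ω)) ∂(surfaceMeasure n) := by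
  have hk : (fun x y : EuclideanSpace ℝ (Fin n) => sphereKernel j (x - y)) = fun x y =>
      ∫ ω : UnitSphere n, (((ω : EuclideanSpace ℝ (Fin n)) j ^ 2 : ℝ) : ℂ) *
        (wave x (ω : EuclideanSpace ℝ (Fin n)) * wave (-y) (ω : EuclideanSpace ℝ (Fin n)))
        ∂(surfaceMeasure n) := by
    ext x y
    simp only [sphereKernel, sub_eq_add_neg, wave_add_left]
  have hval : ∀ ω : UnitSphere n, (starRingEnd ℂ) (waveTransform F ω) =
      ∫ y, (starRingEnd ℂ) (F y) * wave (-y) (ω : EuclideanSpace ℝ (Fin n)) := by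
    intro ω
    rw [waveTransform, ← integral_conj]
    simp only [map_mul, conj_wave]
  rw [hk]
  simp_rw [hval]
  simp only [wave_neg_comm]
  have hm : Measurable fun ω : UnitSphere n => (((ω : EuclideanSpace ℝ (Fin n)) j ^ 2 : ℝ) : ℂ) := by
    fun_prop
  have hc : Measurable fun ω : UnitSphere n => (ω : EuclideanSpace ℝ (Fin n)) :=
    measurable_subtype_coe
  refine bilinKernel_superposition (Integrable.of_bound hm.aestronglyMeasurable 1
    (Filter.Eventually.of_forall fun ω => norm_coord_sq_le ω j)) ?_ ?_ (fun _ _ => (norm_wave _ _).le) (fun _ _ => (norm_wave _ _).le) hF (integrable_conj hF)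
    (Complex.continuous_conj.measurable.comp hFm)
  · exact continuous_wave.measurable.comp (measurable_fst.prodMk (hc.comp measurable_snd))
  · exact continuous_wave.measurable.comp (measurable_fst.prodMk (hc.comp measurable_snd).neg)

lemma lintegral_sphere_sq_eq_bilinKernel (j : Fin n) {F : EuclideanSpace ℝ (Fin n) → ℂ}
    (hF : Integrable F) (hFm : Measurable F) :
    ∫⁻ ω : UnitSphere n, ENNReal.ofReal ((ω : EuclideanSpace ℝ (Fin n)) j ^ 2) *
      ‖waveTransform F ω‖ₑ ^ 2 ∂(surfaceMeasure n) =
    ‖bilinKernel volume (fun x y => sphereKernel j (x - y)) F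
      (fun y => (starRingEnd ℂ) (F y))‖ₑ := by
  have hcont := continuous_waveTransform hF
  have hpt : ∀ ω : UnitSphere n, (((ω : EuclideanSpace ℝ (Fin n)) j ^ 2 : ℝ) : ℂ) *
      (waveTransform F ω * (starRingEnd ℂ) (waveTransform F ω)) =
      (((ω : EuclideanSpace ℝ (Fin n)) j ^ 2 * ‖waveTransform F ω‖ ^ 2 : ℝ) : ℂ) := by
    intro ω
    rw [Complex.mul_conj, Complex.normSq_eq_norm_sq]
    push_cast; ring
  have hcont' : Continuous fun ω : UnitSphere n =>
      (ω : EuclideanSpace ℝ (Fin n)) j ^ 2 * ‖waveTransform F ω‖ ^ 2 :=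
    Continuous.mul (by fun_prop) ((hcont.comp continuous_subtype_val).norm.pow 2)
  have h0 : ∀ ω : UnitSphere n, 0 ≤ (ω : EuclideanSpace ℝ (Fin n)) j ^ 2 * ‖waveTransform F ω‖ ^ 2 :=
    fun ω => by positivity
  rw [bilinKernel_sphereKernel_sub j hF hFm]
  simp_rw [hpt]
  rw [integral_complex_ofReal, ← ofReal_norm, Complex.norm_real,
    Real.norm_of_nonneg (integral_nonneg h0), ofReal_integral_eq_lintegral_ofReal
      (hcont'.integrable_of_hasCompactSupport (HasCompactSupport.of_compactSpace _))
      (Filter.Eventually.of_forall h0)]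
  refine lintegral_congr fun ω => ?_
  rw [ENNReal.ofReal_mul (sq_nonneg _), ENNReal.ofReal_pow (norm_nonneg _), ofReal_norm]

lemma bilinKernel_comp_insertCoord (j : Fin (n + 1))
    {K : EuclideanSpace ℝ (Fin (n + 1)) → EuclideanSpace ℝ (Fin (n + 1)) → ℂ}
    (f g : EuclideanSpace ℝ (Fin (n + 1)) → ℂ) :
    bilinKernel volume K f g = bilinKernel ((volume : Measure ℝ).prod volume)
      (fun p q => K (insertCoord j p) (insertCoord j q)) (fun p => f (insertCoord j p))
      (fun q => g (insertCoord j q)) := by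
  have hmp := measurePreserving_insertCoord j
  have hme := measurableEmbedding_insertCoord j
  unfold bilinKernel
  rw [← hmp.integral_comp hme]
  refine integral_congr_ae (Filter.Eventually.of_forall fun p => ?_)
  simp only
  rw [← hmp.integral_comp hme]

lemma insertCoord_sub (j : Fin (n + 1)) (p q : ℝ × EuclideanSpace ℝ (Fin n)) :
    insertCoord j p - insertCoord j q = insertCoord j (p.1 - q.1, p.2 - q.2) := by
  ext i
  refine Fin.succAboveCases j ?_ (fun i => ?_) i <;> simp

/-- The endpoint restriction estimate for the measure `ω_j² dσ`. -/
theorem lintegral_sphere_sq_waveTransform_le (n : ℕ) {r : ℝ} (hr : r = 2 * (n + 3) / (n + 5)) :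
    ∃ C : ℝ, 0 < C ∧ ∀ (j : Fin (n + 2)) (F : EuclideanSpace ℝ (Fin (n + 2)) → ℂ), Measurable F →
    ∀ B R : ℝ, (∀ x, ‖F x‖ₑ ≤ (Metric.closedBall 0 R).indicator (fun _ => ENNReal.ofReal B) x) →
    ∫⁻ ω : UnitSphere (n + 2), ENNReal.ofReal ((ω : EuclideanSpace ℝ (Fin (n + 2))) j ^ 2) *
      ‖waveTransform F ω‖ₑ ^ 2 ∂(surfaceMeasure (n + 2)) ≤
      ENNReal.ofReal C * (∫⁻ x, ‖F x‖ₑ ^ r) ^ (2 / r) := by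
  have hr1 : 1 < r := by
    rw [hr, lt_div_iff₀ (by positivity)]; linarith [(n.cast_nonneg : (0 : ℝ) ≤ n)]
  have hr2 : r < 2 := by
    rw [hr, div_lt_iff₀ (by positivity)]; linarith [(n.cast_nonneg : (0 : ℝ) ≤ n)]
  have hr0 : 0 < r := by linarith
  -- This is where the endpoint is determined: for this `r` the interpolated decay in `τ` has
  -- exactly the Hardy–Littlewood–Sobolev exponent.
  have hα : (n + 1) / 2 * (2 / r - 1) = 2 - 2 / r := by
    have h3 : (n : ℝ) + 3 ≠ 0 := by positivity
    have h5 : (n : ℝ) + 5 ≠ 0 := by positivity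
    rw [hr]; field_simp; ring
  obtain ⟨C₁, hC₁, h₁⟩ := norm_bilinKernel_slice_le n hr1 hr2
  obtain ⟨C₂, hC₂, h₂⟩ := lintegral_lintegral_abs_sub_rpow_le hr1 hr2 hα
  refine ⟨C₁ * C₂, by positivity, fun j F hF B R hFB => ?_⟩
  have hFi : Integrable F := integrable_of_enorm_le_indicator hF Metric.isClosed_closedBall.measurableSet
    measure_closedBall_lt_top hFB
  have hic := (continuous_insertCoord j).measurable
  have hme := measurableEmbedding_insertCoord j
  have hmp := measurePreserving_insertCoord j
  set Ft : ℝ → EuclideanSpace ℝ (Fin (n + 1)) → ℂ := fun t x => F (insertCoord j (t, x)) with hFt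
  have hFtm : Measurable (Function.uncurry Ft) := hF.comp hic
  have hFtm' : ∀ t, Measurable (Ft t) := fun t => hFtm.comp measurable_prodMk_left
  have hFtB : ∀ t x, ‖Ft t x‖ₑ ≤
      (Metric.closedBall 0 R).indicator (fun _ => ENNReal.ofReal B) x := by
    intro t x
    refine (hFB _).trans ?_
    by_cases h : insertCoord j (t, x) ∈ Metric.closedBall 0 R
    · have hx : x ∈ Metric.closedBall 0 R := by
        rw [mem_closedBall_zero_iff] at h ⊢
        refine le_trans ?_ h
        rw [norm_insertCoord]
        exact Real.le_sqrt_of_sq_le (le_add_of_nonneg_left (sq_nonneg _))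
      rw [indicator_of_mem h, indicator_of_mem hx]
    · rw [indicator_of_notMem h]; exact bot_le
  have hFti : ∀ t, Integrable (Ft t) := fun t =>
    integrable_of_enorm_le_indicator (hFtm' t) Metric.isClosed_closedBall.measurableSet
      measure_closedBall_lt_top (hFtB t)
  have hconj : Measurable (starRingEnd ℂ) := Complex.continuous_conj.measurable
  set I : ℝ → ℝ≥0∞ := fun t => ∫⁻ x, ‖Ft t x‖ₑ ^ r with hI
  have hIm : Measurable I := by
    have : Measurable fun p : ℝ × EuclideanSpace ℝ (Fin (n + 1)) => ‖Function.uncurry Ft p‖ₑ ^ r :=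
      hFtm.enorm.pow_const r
    exact this.lintegral_prod_right'
  have hIfin : ∀ t, I t ≠ ⊤ := by
    intro t
    have : I t ≤ ∫⁻ x, (Metric.closedBall (0 : EuclideanSpace ℝ (Fin (n + 1))) R).indicator
        (fun _ => ENNReal.ofReal B ^ r) x := by
      refine lintegral_mono fun x => ?_
      refine (ENNReal.rpow_le_rpow (hFtB t x) hr0.le).trans ?_
      by_cases hx : x ∈ Metric.closedBall (0 : EuclideanSpace ℝ (Fin (n + 1))) R
      · rw [indicator_of_mem hx, indicator_of_mem hx]
      · rw [indicator_of_notMem hx, indicator_of_notMem hx, ENNReal.zero_rpow_of_pos hr0]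
    refine ne_top_of_le_ne_top ?_ this
    rw [lintegral_indicator Metric.isClosed_closedBall.measurableSet, setLIntegral_const]
    exact ENNReal.mul_ne_top (ENNReal.rpow_ne_top_of_nonneg hr0.le ENNReal.ofReal_ne_top)
      measure_closedBall_lt_top.ne
  -- The `L^r` norm of the slice at height `t`; the one-dimensional inequality is applied to this
  -- function.
  set φ : ℝ → ℝ := fun t => (I t).toReal ^ (1 / r) with hφ
  have hφ0 : ∀ t, 0 ≤ φ t := fun t => Real.rpow_nonneg ENNReal.toReal_nonneg _
  have hφm : Measurable φ := hIm.ennreal_toReal.pow_const _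
  have hφr : ∀ t, ENNReal.ofReal (φ t ^ r) = I t := by
    intro t
    rw [hφ, ← Real.rpow_mul ENNReal.toReal_nonneg, one_div_mul_cancel hr0.ne', Real.rpow_one,
      ENNReal.ofReal_toReal (hIfin t)]
  have hItot : ∫⁻ t, I t = ∫⁻ x, ‖F x‖ₑ ^ r := by
    rw [← hmp.lintegral_comp_emb hme]
    exact (lintegral_prod _ (hFtm.enorm.pow_const r).aemeasurable).symm
  rw [lintegral_sphere_sq_eq_bilinKernel j hFi hF, bilinKernel_comp_insertCoord j]
  have hFp : Integrable (fun p => F (insertCoord j p))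
      ((volume : Measure ℝ).prod (volume : Measure (EuclideanSpace ℝ (Fin (n + 1))))) :=
    (hmp.integrable_comp_emb hme).2 hFi
  have hKm : Measurable (Function.uncurry fun p q : ℝ × EuclideanSpace ℝ (Fin (n + 1)) =>
      sphereKernel j (insertCoord j p - insertCoord j q)) :=
    (continuous_sphereKernel j).measurable.comp
      ((hic.comp measurable_fst).sub (hic.comp measurable_snd))
  refine (enorm_bilinKernel_prod_le hKm (fun p q => norm_sphereKernel_le j _) hFp
    (integrable_conj hFp) (hconj.comp hFtm) hFti (fun t => integrable_conj (hFti t))).trans ?_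
  calc _ ≤ ∫⁻ t, ∫⁻ s, ENNReal.ofReal C₁ * (ENNReal.ofReal (φ t) * (ENNReal.ofReal (φ s) *
        ENNReal.ofReal (|s - t| ^ (-((n + 1) / 2 * (2 / r - 1) : ℝ))))) := by
        refine lintegral_mono fun t => lintegral_mono_ae ?_
        -- The dispersive bound says nothing for coinciding slices, a null set of pairs.
        have hne : ∀ᵐ s : ℝ, s ≠ t := by
          simp [ae_iff]
        filter_upwards [hne] with s hs
        have h := h₁ j (t - s) (sub_ne_zero.2 hs.symm) (Ft t) (fun y => (starRingEnd ℂ) (Ft s y))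
          (hFtm' t) (hconj.comp (hFtm' s)) (hFti t) (integrable_conj (hFti s)) (φ t) (φ s)
          (hφ0 t) (hφ0 s) (hφr t).symm (by rw [hφr s]; simp [hI])
        simp only [insertCoord_sub]
        rw [← ofReal_norm]
        refine (ENNReal.ofReal_le_ofReal h).trans (le_of_eq ?_)
        rw [← ENNReal.ofReal_mul (hφ0 s), ← ENNReal.ofReal_mul (hφ0 t), ← ENNReal.ofReal_mul hC₁.le,
          abs_sub_comm s t]
        congr 1; ring
    _ = ENNReal.ofReal C₁ * ∫⁻ t, ∫⁻ s, ENNReal.ofReal (φ t) * (ENNReal.ofReal (φ s) *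
        ENNReal.ofReal (|s - t| ^ (-((n + 1) / 2 * (2 / r - 1) : ℝ)))) := by
        have hm : Measurable fun p : ℝ × ℝ => ENNReal.ofReal (φ p.1) * (ENNReal.ofReal (φ p.2) *
          ENNReal.ofReal (|p.2 - p.1| ^ (-((n + 1) / 2 * (2 / r - 1) : ℝ)))) := by fun_prop
        rw [← lintegral_const_mul _ hm.lintegral_prod_right']
        refine lintegral_congr fun t => ?_
        rw [lintegral_const_mul _ (by fun_prop)]
    _ ≤ ENNReal.ofReal C₁ * (ENNReal.ofReal C₂ * (∫⁻ s, ENNReal.ofReal (φ s ^ r)) ^ (2 / r)) := by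
        gcongr
        exact h₂ φ hφm hφ0
    _ = _ := by
        simp_rw [hφr]
        rw [hItot, ← mul_assoc, ← ENNReal.ofReal_mul hC₁.le]

end Restriction

/-! ### The extension theorem by duality -/

section SphereTransform

variable {n : ℕ}

/-- The Fourier transform of the measure `h dσ` on the sphere. -/
def sphereTransform (h : UnitSphere n → ℂ) (x : EuclideanSpace ℝ (Fin n)) : ℂ :=
  ∫ ω : UnitSphere n, h ω * wave x (ω : EuclideanSpace ℝ (Fin n)) ∂(surfaceMeasure n)

lemma continuous_wave_sphere (x : EuclideanSpace ℝ (Fin n)) :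
    Continuous fun ω : UnitSphere n => wave x (ω : EuclideanSpace ℝ (Fin n)) :=
  (continuous_wave.comp (Continuous.prodMk_right x)).comp continuous_subtype_val

lemma measurable_uncurry_wave_sphere : Measurable (Function.uncurry
    fun (x : EuclideanSpace ℝ (Fin n)) (ω : UnitSphere n) =>
      wave x (ω : EuclideanSpace ℝ (Fin n))) := by
  have hc : Measurable fun ω : UnitSphere n => (ω : EuclideanSpace ℝ (Fin n)) :=
    measurable_subtype_coe
  exact continuous_wave.measurable.comp (measurable_fst.prodMk (hc.comp measurable_snd))

lemma continuous_sphereTransform {h : UnitSphere n → ℂ} (hh : Integrable h (surfaceMeasure n)) :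
    Continuous (sphereTransform h) := by
  refine continuous_of_dominated (bound := fun ω => ‖h ω‖) (fun x => ?_) (fun x => ?_) hh.norm ?_
  · exact hh.aestronglyMeasurable.mul (continuous_wave_sphere x).aestronglyMeasurable
  · exact Filter.Eventually.of_forall fun ω => by rw [norm_mul, norm_wave, mul_one]
  · exact Filter.Eventually.of_forall fun ω =>
      continuous_const.mul (continuous_wave.comp (Continuous.prodMk_left _))

lemma norm_sphereTransform_le (h : UnitSphere n → ℂ) (x : EuclideanSpace ℝ (Fin n)) :
    ‖sphereTransform h x‖ ≤ ∫ ω, ‖h ω‖ ∂(surfaceMeasure n) := by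
  refine (norm_integral_le_integral_norm _).trans (le_of_eq ?_)
  simp only [norm_mul, norm_wave, mul_one]

/-- The sphere transform is the transpose of the restricted Fourier transform. -/
lemma integral_mul_sphereTransform {F : EuclideanSpace ℝ (Fin n) → ℂ} (hF : Integrable F)
    {h : UnitSphere n → ℂ} (hh : Integrable h (surfaceMeasure n)) :
    ∫ x, F x * sphereTransform h x =
      ∫ ω : UnitSphere n, h ω * waveTransform F ω ∂(surfaceMeasure n) := by
  simp only [sphereTransform, waveTransform, ← integral_const_mul]
  rw [integral_integral_swap]
  · refine integral_congr_ae (Filter.Eventually.of_forall fun ω => ?_)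
    refine integral_congr_ae (Filter.Eventually.of_forall fun x => ?_)
    simp only
    ring
  · have := (hF.mul_prod hh).mul_bdd (c := 1)
      measurable_uncurry_wave_sphere.aestronglyMeasurable
        (Filter.Eventually.of_forall fun p => (norm_wave p.1 _).le)
    simpa only [Function.uncurry_def, mul_assoc] using this

/-- Cauchy–Schwarz with the coordinate attached to `W`: one factor `ω_j` becomes the weight `ω_j²`
of the restriction estimate. -/
lemma enorm_integral_mul_coord_le (j : Fin n) {h W : UnitSphere n → ℂ} (hh : Measurable h)
    (hW : Measurable W) :
    ‖∫ ω, (h ω * (((ω : EuclideanSpace ℝ (Fin n)) j : ℝ) : ℂ)) * W ω ∂(surfaceMeasure n)‖ₑ ≤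
      (∫⁻ ω, ‖h ω‖ₑ ^ 2 ∂(surfaceMeasure n)) ^ (1 / 2 : ℝ) *
      (∫⁻ ω, ENNReal.ofReal ((ω : EuclideanSpace ℝ (Fin n)) j ^ 2) * ‖W ω‖ₑ ^ 2
        ∂(surfaceMeasure n)) ^ (1 / 2 : ℝ) := by
  have hcm : Measurable fun ω : UnitSphere n => (((ω : EuclideanSpace ℝ (Fin n)) j : ℝ) : ℂ) := by
    fun_prop
  have hm : Measurable fun ω : UnitSphere n =>
      ‖(((ω : EuclideanSpace ℝ (Fin n)) j : ℝ) : ℂ) * W ω‖ₑ := (hcm.mul hW).enorm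
  have h1 := ENNReal.lintegral_mul_le_Lp_mul_Lq (surfaceMeasure n)
    Real.HolderConjugate.two_two hh.enorm.aemeasurable hm.aemeasurable
  refine (enorm_integral_le_lintegral_enorm _).trans ?_
  refine le_trans (le_of_eq ?_) (h1.trans (le_of_eq ?_))
  · refine lintegral_congr fun ω => ?_
    rw [mul_assoc, enorm_mul]; rfl
  · simp only [ENNReal.rpow_two]
    congr 2
    refine lintegral_congr fun ω => ?_
    rw [enorm_mul, mul_pow, ← ofReal_norm (((_ : ℝ) : ℂ)), Complex.norm_real, Real.norm_eq_abs,
      ← ENNReal.ofReal_pow (abs_nonneg _), sq_abs]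

/-- Absorption of `I^(1/r)` into the left side, legitimate only because `I` is known to be finite.
-/
lemma le_rpow_of_le_mul_rpow {I A : ℝ≥0∞} {p r : ℝ} (hpr : p.HolderConjugate r) (hI : I ≠ ⊤)
    (h : I ≤ A * I ^ (1 / r)) : I ≤ A ^ p := by
  rcases eq_or_ne I 0 with rfl | hI0
  · exact bot_le
  have h1 : I = I ^ (1 / p) * I ^ (1 / r) := by
    rw [← ENNReal.rpow_add _ _ hI0 hI, one_div, one_div, hpr.inv_add_inv_eq_one, ENNReal.rpow_one]
  have h2 : I ^ (1 / p) ≤ A := by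
    have h0 : I ^ (1 / r) ≠ 0 := by simp [ENNReal.rpow_eq_zero_iff, hI0, hI]
    have ht : I ^ (1 / r) ≠ ⊤ := ENNReal.rpow_ne_top_of_nonneg (by
      have := hpr.symm.pos; positivity) hI
    exact (ENNReal.mul_le_mul_iff_left h0 ht).1 (h1.ge.trans h)
  calc I = (I ^ (1 / p)) ^ p := by
        rw [← ENNReal.rpow_mul, one_div_mul_cancel hpr.ne_zero, ENNReal.rpow_one]
    _ ≤ A ^ p := ENNReal.rpow_le_rpow h2 hpr.nonneg

/-- The extension estimate on balls, by duality with the restriction estimate. -/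
lemma lintegral_closedBall_sphereTransform_le (n : ℕ) {p : ℝ} (hp : p = 2 * (n + 3) / (n + 1)) :
    ∃ C : ℝ, 0 < C ∧ ∀ (j : Fin (n + 2)) (h : UnitSphere (n + 2) → ℂ), Measurable h →
    Integrable h (surfaceMeasure (n + 2)) → ∀ R : ℝ,
    ∫⁻ x in Metric.closedBall 0 R, ‖sphereTransform
      (fun ω => h ω * (((ω : EuclideanSpace ℝ (Fin (n + 2))) j : ℝ) : ℂ)) x‖ₑ ^ p ≤
      ((∫⁻ ω, ‖h ω‖ₑ ^ 2 ∂(surfaceMeasure (n + 2))) ^ (1 / 2 : ℝ) *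
        ENNReal.ofReal C ^ (1 / 2 : ℝ)) ^ p := by
  set r : ℝ := 2 * (n + 3) / (n + 5) with hr
  have hn : (0 : ℝ) ≤ n := n.cast_nonneg
  have hp2 : 2 < p := by rw [hp, lt_div_iff₀ (by positivity)]; linarith
  have hpr : p.HolderConjugate r := by
    rw [Real.holderConjugate_iff]
    refine ⟨by linarith, ?_⟩
    rw [hp, hr]; field_simp; ring
  obtain ⟨C, hC, hST⟩ := lintegral_sphere_sq_waveTransform_le n hr
  refine ⟨C, hC, fun j h hh hhi R => ?_⟩
  set h' : UnitSphere (n + 2) → ℂ :=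
    fun ω => h ω * (((ω : EuclideanSpace ℝ (Fin (n + 2))) j : ℝ) : ℂ) with hh'
  have hh'i : Integrable h' (surfaceMeasure (n + 2)) := by
    refine hhi.mul_bdd (c := 1) ?_ (Filter.Eventually.of_forall fun ω => ?_)
    · exact Continuous.aestronglyMeasurable (by fun_prop)
    · rw [Complex.norm_real]; exact abs_coord_sphere_le ω j
  set G := sphereTransform h' with hG
  have hGc : Continuous G := continuous_sphereTransform hh'i
  set Q : ℝ := ∫ ω, ‖h' ω‖ ∂(surfaceMeasure (n + 2)) with hQ
  have hQ0 : 0 ≤ Q := integral_nonneg fun _ => norm_nonneg _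
  have hGb : ∀ x, ‖G x‖ ≤ Q := norm_sphereTransform_le h'
  set S : Set (EuclideanSpace ℝ (Fin (n + 2))) := Metric.closedBall 0 R with hS
  have hSm : MeasurableSet S := Metric.isClosed_closedBall.measurableSet
  have hSt : volume S < ⊤ := measure_closedBall_lt_top
  -- The extremizer in Hölder's inequality: on the ball `F * G = ‖G‖^p` and `‖F‖^r = ‖G‖^p`, so
  -- duality bounds the integral by a constant times its own power `1 / r`.
  set F : EuclideanSpace ℝ (Fin (n + 2)) → ℂ :=
    S.indicator fun x => (starRingEnd ℂ) (G x) * ((‖G x‖ ^ (p - 2) : ℝ) : ℂ) with hF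
  have hFm : Measurable F := by
    refine Measurable.indicator ?_ hSm
    refine (Complex.continuous_conj.measurable.comp hGc.measurable).mul ?_
    exact Complex.measurable_ofReal.comp (hGc.measurable.norm.pow_const _)
  have hpow : ∀ z : ℂ, ‖z‖ * ‖z‖ ^ (p - 2) = ‖z‖ ^ (p - 1) := fun z => by
    rcases eq_or_ne ‖z‖ 0 with hz | hz
    · rw [hz, zero_mul, Real.zero_rpow (by linarith)]
    · rw [← Real.rpow_one_add' (norm_nonneg _) (by linarith)]; congr 1; ring
  have hpow' : ∀ z : ℂ, ‖z‖ * ‖z‖ ^ (p - 1) = ‖z‖ ^ p := fun z => by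
    rw [← Real.rpow_one_add' (norm_nonneg _) (by linarith)]; congr 1; ring
  have hFn : ∀ x, ‖F x‖ₑ = S.indicator (fun x => ‖G x‖ₑ ^ (p - 1)) x := by
    intro x
    by_cases hx : x ∈ S
    · rw [hF, indicator_of_mem hx, indicator_of_mem hx, ← ofReal_norm, norm_mul,
        RCLike.norm_conj, Complex.norm_real, Real.norm_of_nonneg (by positivity), hpow,
        ← ENNReal.ofReal_rpow_of_nonneg (norm_nonneg _) (by linarith), ofReal_norm]
    · rw [hF, indicator_of_notMem hx, indicator_of_notMem hx, enorm_zero]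
  have hFB : ∀ x, ‖F x‖ₑ ≤ S.indicator (fun _ => ENNReal.ofReal (Q ^ (p - 1))) x := by
    intro x
    rw [hFn]
    refine indicator_le_indicator ?_
    rw [← ENNReal.ofReal_rpow_of_nonneg hQ0 (by linarith), ← ofReal_norm]
    exact ENNReal.rpow_le_rpow (ENNReal.ofReal_le_ofReal (hGb x)) (by linarith)
  have hFi : Integrable F := integrable_of_enorm_le_indicator hFm hSm hSt hFB
  have hFr : ∫⁻ x, ‖F x‖ₑ ^ r = ∫⁻ x in S, ‖G x‖ₑ ^ p := by
    rw [← lintegral_indicator hSm]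
    refine lintegral_congr fun x => ?_
    rw [hFn]
    by_cases hx : x ∈ S
    · rw [indicator_of_mem hx, indicator_of_mem hx, ← ENNReal.rpow_mul, hpr.sub_one_mul_conj]
    · rw [indicator_of_notMem hx, indicator_of_notMem hx, ENNReal.zero_rpow_of_pos hpr.symm.pos]
  -- The cutoff to a ball is there to give this finiteness and the integrability of `F`; the final
  -- bound is independent of `R`.
  have hItop : ∫⁻ x in S, ‖G x‖ₑ ^ p ≠ ⊤ := by
    refine ne_top_of_le_ne_top (ENNReal.mul_ne_top (ENNReal.ofReal_ne_top (r := Q ^ p)) hSt.ne) ?_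
    rw [← setLIntegral_const]
    refine lintegral_mono fun x => ?_
    rw [← ENNReal.ofReal_rpow_of_nonneg hQ0 (by linarith), ← ofReal_norm]
    exact ENNReal.rpow_le_rpow (ENNReal.ofReal_le_ofReal (hGb x)) (by linarith)
  have hIeq : ∫⁻ x in S, ‖G x‖ₑ ^ p = ‖∫ x, F x * G x‖ₑ := by
    have hpt : ∀ x, F x * G x = ((S.indicator (fun x => ‖G x‖ ^ p) x : ℝ) : ℂ) := by
      intro x
      by_cases hx : x ∈ S
      · rw [hF, indicator_of_mem hx, indicator_of_mem hx, ← hpow', ← hpow]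
        have := Complex.conj_mul' (G x)
        push_cast
        linear_combination ((‖G x‖ ^ (p - 2) : ℝ) : ℂ) * this
      · rw [hF, indicator_of_notMem hx, indicator_of_notMem hx]; simp
    simp_rw [hpt]
    have h0 : ∀ x, 0 ≤ ‖G x‖ ^ p := fun x => by positivity
    have hcp : Continuous fun x => ‖G x‖ ^ p := hGc.norm.rpow_const fun _ => Or.inr (by linarith)
    rw [integral_complex_ofReal, ← ofReal_norm, Complex.norm_real, integral_indicator hSm,
      Real.norm_of_nonneg (integral_nonneg h0), ofReal_integral_eq_lintegral_ofReal
      (hcp.continuousOn.integrableOn_compact (isCompact_closedBall _ _))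
      (Filter.Eventually.of_forall h0)]
    refine lintegral_congr fun x => ?_
    rw [← ENNReal.ofReal_rpow_of_nonneg (norm_nonneg _) (by linarith), ofReal_norm]
  refine le_rpow_of_le_mul_rpow hpr hItop ?_
  have hWm : Measurable fun ω : UnitSphere (n + 2) => waveTransform F ω :=
    (continuous_waveTransform hFi).measurable.comp measurable_subtype_coe
  calc ∫⁻ x in S, ‖G x‖ₑ ^ p = _ := hIeq
    _ ≤ (∫⁻ ω, ‖h ω‖ₑ ^ 2 ∂(surfaceMeasure (n + 2))) ^ (1 / 2 : ℝ) *
        (∫⁻ ω : UnitSphere (n + 2), ENNReal.ofReal ((ω : EuclideanSpace ℝ (Fin (n + 2))) j ^ 2) *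
          ‖waveTransform F ω‖ₑ ^ 2 ∂(surfaceMeasure (n + 2))) ^ (1 / 2 : ℝ) := by
        rw [hG, integral_mul_sphereTransform hFi hh'i]
        exact enorm_integral_mul_coord_le j hh hWm
    _ ≤ (∫⁻ ω, ‖h ω‖ₑ ^ 2 ∂(surfaceMeasure (n + 2))) ^ (1 / 2 : ℝ) *
        (ENNReal.ofReal C * (∫⁻ x in S, ‖G x‖ₑ ^ p) ^ (2 / r)) ^ (1 / 2 : ℝ) := by
        gcongr
        rw [← hFr]
        exact hST j F hFm _ R hFB
    _ = _ := by
        rw [ENNReal.mul_rpow_of_nonneg _ _ (by norm_num), ← ENNReal.rpow_mul, mul_assoc]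
        congr 3; ring

/-- The bounds on balls are uniform in the radius, so monotone convergence over an exhaustion gives
the whole space. -/
lemma memLp_sphereTransform_mul_coord (n : ℕ) {p : ℝ} (hp : p = 2 * (n + 3) / (n + 1))
    (j : Fin (n + 2)) {h : UnitSphere (n + 2) → ℂ} (hh : Measurable h)
    (h2 : MemLp h 2 (surfaceMeasure (n + 2))) :
    MemLp (sphereTransform (fun ω => h ω * (((ω : EuclideanSpace ℝ (Fin (n + 2))) j : ℝ) : ℂ)))
      (ENNReal.ofReal p) := by
  obtain ⟨C, hC, hle⟩ := lintegral_closedBall_sphereTransform_le n hp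
  have hp0 : 0 < p := by rw [hp]; positivity
  have hhi : Integrable h (surfaceMeasure (n + 2)) := h2.integrable (by norm_num)
  have hh'i : Integrable (fun ω => h ω * (((ω : EuclideanSpace ℝ (Fin (n + 2))) j : ℝ) : ℂ))
      (surfaceMeasure (n + 2)) := by
    refine hhi.mul_bdd (c := 1) ?_ (Filter.Eventually.of_forall fun ω => ?_)
    · exact Continuous.aestronglyMeasurable (by fun_prop)
    · rw [Complex.norm_real]; exact abs_coord_sphere_le ω j
  refine ⟨(continuous_sphereTransform hh'i).aestronglyMeasurable, ?_⟩
  rw [eLpNorm_lt_top_iff_lintegral_rpow_enorm_lt_top (by simpa using hp0) ENNReal.ofReal_ne_top,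
    ENNReal.toReal_ofReal hp0.le]
  have hU : (⋃ k : ℕ, Metric.closedBall (0 : EuclideanSpace ℝ (Fin (n + 2))) k) = univ :=
    Metric.iUnion_closedBall_nat 0
  rw [← setLIntegral_univ, ← hU, setLIntegral_iUnion_of_directed]
  · refine (iSup_le fun k : ℕ => hle j h hh hhi k).trans_lt ?_
    refine ENNReal.rpow_lt_top_of_nonneg hp0.le (ENNReal.mul_ne_top
      (ENNReal.rpow_ne_top_of_nonneg (by norm_num) ?_)
      (ENNReal.rpow_ne_top_of_nonneg (by norm_num) ENNReal.ofReal_ne_top))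
    have := (eLpNorm_lt_top_iff_lintegral_rpow_enorm_lt_top two_ne_zero ENNReal.ofNat_ne_top).1 h2.2
    simpa using this.ne
  · refine (Monotone.directed_le fun a b hab => Metric.closedBall_subset_closedBall ?_)
    exact_mod_cast hab

/-- The extension theorem for the sphere at the endpoint exponent. -/
theorem memLp_sphereTransform (n : ℕ) {p : ℝ} (hp : p = 2 * (n + 3) / (n + 1))
    {h : UnitSphere (n + 2) → ℂ} (hh : Measurable h) (h2 : MemLp h 2 (surfaceMeasure (n + 2))) :
    MemLp (sphereTransform h) (ENNReal.ofReal p) := by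
  set c : Fin (n + 2) → UnitSphere (n + 2) → ℂ :=
    fun j ω => (((ω : EuclideanSpace ℝ (Fin (n + 2))) j : ℝ) : ℂ) with hc
  have hcc : ∀ j, Continuous (c j) := fun j => by simp only [hc]; fun_prop
  have hc1 : ∀ j ω, ‖c j ω‖ ≤ 1 := fun j ω => by
    simp only [hc, Complex.norm_real]; exact abs_coord_sphere_le ω j
  have hhc : ∀ j, MemLp (fun ω => h ω * c j ω) 2 (surfaceMeasure (n + 2)) := fun j =>
    h2.mono (h2.1.mul (hcc j).aestronglyMeasurable) (Filter.Eventually.of_forall fun ω => by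
      rw [norm_mul]; exact mul_le_of_le_one_right (norm_nonneg _) (hc1 j ω))
  -- Since `∑ ω_j² = 1`, `h` is the sum of the `(h ω_j) ω_j`. One factor `ω_j` stays with the
  -- density and the other feeds the weighted estimate.
  have hsum : sphereTransform h = fun x => ∑ j, sphereTransform (fun ω => (h ω * c j ω) * c j ω) x := by
    ext x
    simp only [sphereTransform]
    rw [← integral_finsetSum]
    · refine integral_congr_ae (Filter.Eventually.of_forall fun ω => ?_)
      have h1 : ∑ j, c j ω * c j ω = 1 := by
        have := EuclideanSpace.real_norm_sq_eq (ω : EuclideanSpace ℝ (Fin (n + 2)))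
        rw [norm_eq_of_mem_sphere] at this
        simp only [hc, ← sq]
        exact_mod_cast this.symm.trans (one_pow 2)
      simp only [mul_assoc]
      rw [← Finset.mul_sum]
      simp only [← mul_assoc, ← Finset.sum_mul, h1, one_mul]
    · intro j _
      refine Integrable.mul_bdd (c := 1) (Integrable.mul_bdd (c := 1) ((hhc j).integrable
        (by norm_num)) (hcc j).aestronglyMeasurable (Filter.Eventually.of_forall (hc1 j)))
        (continuous_wave_sphere x).aestronglyMeasurable
        (Filter.Eventually.of_forall fun ω => (norm_wave _ _).le)
  rw [hsum]
  exact memLp_finsetSum _ fun j _ =>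
    memLp_sphereTransform_mul_coord n hp j (hh.mul (hcc j).measurable) (hhc j)

/-- From `‖g‖^s ≤ B^(s-p) ‖g‖^p`; this carries the endpoint to all larger exponents. -/
lemma memLp_of_norm_le_of_le {X : Type*} [MeasurableSpace X] {μ : Measure X} {g : X → ℂ}
    {p s B : ℝ} (hp : 0 < p) (hps : p ≤ s) (hB : ∀ x, ‖g x‖ ≤ B)
    (hg : MemLp g (ENNReal.ofReal p) μ) : MemLp g (ENNReal.ofReal s) μ := by
  have hs : 0 < s := hp.trans_le hps
  refine ⟨hg.1, ?_⟩
  have h := hg.2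
  rw [eLpNorm_lt_top_iff_lintegral_rpow_enorm_lt_top (by simpa) ENNReal.ofReal_ne_top,
    ENNReal.toReal_ofReal hp.le] at h
  rw [eLpNorm_lt_top_iff_lintegral_rpow_enorm_lt_top (by simpa) ENNReal.ofReal_ne_top,
    ENNReal.toReal_ofReal hs.le]
  refine (lintegral_mono (g := fun x => ENNReal.ofReal B ^ (s - p) * ‖g x‖ₑ ^ p)
    fun x => ?_).trans_lt ?_
  · calc ‖g x‖ₑ ^ s = ‖g x‖ₑ ^ (s - p) * ‖g x‖ₑ ^ p := by
          rw [← ENNReal.rpow_add_of_nonneg _ _ (by linarith) hp.le, sub_add_cancel]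
      _ ≤ _ := by
          refine mul_le_mul_left (ENNReal.rpow_le_rpow ?_ (by linarith)) _
          rw [← ofReal_norm]; exact ENNReal.ofReal_le_ofReal (hB x)
  · rw [lintegral_const_mul' _ _ (ENNReal.rpow_ne_top_of_nonneg (by linarith)
      ENNReal.ofReal_ne_top)]
    exact ENNReal.mul_lt_top (ENNReal.rpow_lt_top_of_nonneg (by linarith)
      ENNReal.ofReal_ne_top) h

end SphereTransform

universe u

/-! ### Orthonormal bases and positive operators -/

section Hilbert

/-- Distinct members are at distance `√2`, so balls of radius `1/2` around them are disjoint. -/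
lemma Orthonormal.countable_of_separable {ι H : Type*} [NormedAddCommGroup H]
    [InnerProductSpace ℂ H] [TopologicalSpace.SeparableSpace H] {e : ι → H}
    (he : Orthonormal ℂ e) : Countable ι := by
  refine Pairwise.countable_of_isOpen_disjoint (s := fun i => Metric.ball (e i) (1 / 2))
    (fun i j hij => Metric.ball_disjoint_ball ?_) (fun i => Metric.isOpen_ball)
    (fun i => Metric.nonempty_ball.2 (by norm_num))
  have h := norm_sub_sq (𝕜 := ℂ) (e i) (e j)
  rw [he.2 hij, he.1 i, he.1 j] at h
  rw [dist_eq_norm]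
  have h2 : ‖e i - e j‖ ^ 2 = 2 := by rw [h]; norm_num
  nlinarith [norm_nonneg (e i - e j)]

lemma inner_self_eq_ofReal_norm_sq {H : Type*} [NormedAddCommGroup H] [InnerProductSpace ℂ H]
    (x : H) : inner ℂ x x = ((‖x‖ ^ 2 : ℝ) : ℂ) := by
  rw [inner_self_eq_norm_sq_to_K, Complex.ofReal_pow]; rfl

lemma isTraceClass_of_nonneg {H : Type u} [NormedAddCommGroup H] [InnerProductSpace ℂ H]
    [CompleteSpace H] {T : H →L[ℂ] H} (hT : 0 ≤ T) (h : ∀ (ι : Type u) (e : HilbertBasis ι ℂ H),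
      Summable fun i : ι => (inner ℂ (e i) (T (e i))).re) : IsTraceClass T := by
  intro ι e
  rw [CFC.abs_of_nonneg T hT]
  exact h ι e

lemma HilbertBasis.hasSum_norm_inner_sq {ι H : Type*} [NormedAddCommGroup H]
    [InnerProductSpace ℂ H] (e : HilbertBasis ι ℂ H) (x : H) :
    HasSum (fun i => ‖inner ℂ x (e i)‖ ^ 2) (‖x‖ ^ 2) := by
  have h := e.hasSum_inner_mul_inner x x
  have h' : (fun i => inner ℂ x (e i) * inner ℂ (e i) x) =
      fun i => ((‖inner ℂ x (e i)‖ ^ 2 : ℝ) : ℂ) := by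
    ext i
    rw [← inner_conj_symm (e i) x, Complex.mul_conj, Complex.normSq_eq_norm_sq]
  rw [h', inner_self_eq_ofReal_norm_sq] at h
  exact_mod_cast h

end Hilbert

variable {d : ℕ}

/-! ### Convolution operators on the sphere and their traces -/

section ConvolutionOperator

lemma SphereL2.integrable (g : SphereL2 d) : Integrable g (surfaceMeasure d) :=
  (Lp.memLp g).integrable (by norm_num)

lemma SphereL2.integral_norm_le (d : ℕ) : ∃ c : ℝ, 0 ≤ c ∧ ∀ g : SphereL2 d,
    ∫ ω, ‖g ω‖ ∂(surfaceMeasure d) ≤ c * ‖g‖ := by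
  refine ⟨((surfaceMeasure d) univ ^ (1 / 2 : ℝ)).toReal, ENNReal.toReal_nonneg, fun g => ?_⟩
  have h := eLpNorm_le_eLpNorm_mul_rpow_measure_univ (μ := surfaceMeasure d)
    (p := 1) (q := 2) (by norm_num) (Lp.aestronglyMeasurable g)
  have hpow : (1 / (1 : ℝ≥0∞).toReal - 1 / (2 : ℝ≥0∞).toReal : ℝ) = 1 / 2 := by norm_num
  rw [hpow, eLpNorm_one_eq_lintegral_enorm] at h
  rw [integral_norm_eq_lintegral_enorm (Lp.aestronglyMeasurable g), Lp.norm_def, mul_comm,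
    ← ENNReal.toReal_mul]
  exact ENNReal.toReal_mono (ENNReal.mul_ne_top (Lp.eLpNorm_ne_top _)
    (ENNReal.rpow_ne_top_of_nonneg (by norm_num) (measure_ne_top _ _))) h

/-- On a finite measure space `L²` embeds in `L¹`, so a bounded continuous kernel sends `g` to a
continuous function bounded by a multiple of `‖g‖`. -/
lemma exists_isConvolutionOperator {K : EuclideanSpace ℝ (Fin d) → ℂ} (hK : Continuous K) {A : ℝ}
    (hA : ∀ ξ, ‖K ξ‖ ≤ A) : ∃ T : SphereL2 d →L[ℂ] SphereL2 d, IsConvolutionOperator K T := by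
  have hA0 : 0 ≤ A := (norm_nonneg _).trans (hA 0)
  have hint : ∀ (g : SphereL2 d) (ω : UnitSphere d), Integrable (fun ν : UnitSphere d =>
      g ν * K ((ω : EuclideanSpace ℝ (Fin d)) - (ν : EuclideanSpace ℝ (Fin d))))
      (surfaceMeasure d) := fun g ω =>
    (SphereL2.integrable g).mul_bdd (c := A)
      (hK.comp (by fun_prop)).aestronglyMeasurable (Filter.Eventually.of_forall fun ν => hA _)
  set v : SphereL2 d → UnitSphere d → ℂ := fun g ω => ∫ ν : UnitSphere d,
    g ν * K ((ω : EuclideanSpace ℝ (Fin d)) - (ν : EuclideanSpace ℝ (Fin d)))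
    ∂(surfaceMeasure d) with hv
  have hvc : ∀ g, Continuous (v g) := by
    intro g
    refine continuous_of_dominated (bound := fun ν => ‖g ν‖ * A) (fun ω => (hint g ω).1)
      (fun ω => ?_) ((SphereL2.integrable g).norm.mul_const A) ?_
    · refine Filter.Eventually.of_forall fun ν => ?_
      rw [norm_mul]
      exact mul_le_mul_of_nonneg_left (hA _) (norm_nonneg _)
    · exact Filter.Eventually.of_forall fun ν => continuous_const.mul (hK.comp (by fun_prop))
  have hvb : ∀ g ω, ‖v g ω‖ ≤ (∫ ν, ‖g ν‖ ∂(surfaceMeasure d)) * A := fun g ω =>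
    norm_integral_mul_kernel_le (SphereL2.integrable g) fun ν => hA _
  have hv2 : ∀ g, MemLp (v g) 2 (surfaceMeasure d) := fun g =>
    MemLp.of_bound (hvc g).aestronglyMeasurable _ (Filter.Eventually.of_forall (hvb g))
  obtain ⟨c, hc, hcg⟩ := SphereL2.integral_norm_le d
  let L : SphereL2 d →ₗ[ℂ] SphereL2 d :=
    { toFun := fun g => (hv2 g).toLp (v g)
      map_add' := fun g h => by
        have hgh : v (g + h) = v g + v h := by
          ext ω
          rw [Pi.add_apply]
          simp only [hv]
          rw [← integral_add (hint g ω) (hint h ω)]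
          refine integral_congr_ae ?_
          filter_upwards [Lp.coeFn_add g h] with ν hν
          rw [hν, Pi.add_apply, add_mul]
        rw [← MemLp.toLp_add]
        exact MemLp.toLp_congr _ _ (Filter.EventuallyEq.of_eq hgh)
      map_smul' := fun a g => by
        have hag : v (a • g) = a • v g := by
          ext ω
          rw [Pi.smul_apply]
          simp only [hv]
          rw [← integral_smul]
          refine integral_congr_ae ?_
          filter_upwards [Lp.coeFn_smul a g] with ν hν
          rw [hν, Pi.smul_apply, smul_mul_assoc]
        rw [RingHom.id_apply, ← MemLp.toLp_const_smul]
        exact MemLp.toLp_congr _ _ (Filter.EventuallyEq.of_eq hag) }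
  have hL : ∀ g, L g = (hv2 g).toLp (v g) := fun _ => rfl
  refine ⟨L.mkContinuous
    ((measureUnivNNReal (surfaceMeasure d) : ℝ) ^ (2 : ℝ≥0∞).toReal⁻¹ * (c * A)) fun g => ?_,
    fun g => ⟨Filter.Eventually.of_forall (hint g), ?_⟩⟩
  · rw [hL, mul_assoc]
    refine Lp.norm_le_of_ae_bound (by positivity) ?_
    filter_upwards [(hv2 g).coeFn_toLp] with ω hω
    rw [hω, mul_right_comm]
    exact (hvb g ω).trans (mul_le_mul_of_nonneg_right (hcg g) hA0)
  · rw [LinearMap.mkContinuous_apply, hL]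
    exact (hv2 g).coeFn_toLp

/-- The quadratic form of the convolution with the inverse Fourier transform of a weight. -/
lemma inner_isConvolutionOperator {w : EuclideanSpace ℝ (Fin d) → ℝ} (hw : Integrable w)
    {T : SphereL2 d →L[ℂ] SphereL2 d}
    (hT : IsConvolutionOperator (fun ξ => ∫ z : EuclideanSpace ℝ (Fin d),
      Complex.exp (Complex.I * ((inner ℝ z ξ : ℝ) : ℂ)) * ((w z : ℝ) : ℂ)) T) (g : SphereL2 d) :
    inner ℂ g (T g) = ((∫ z, w z * ‖sphereTransform g z‖ ^ 2 : ℝ) : ℂ) := by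
  have hgi := SphereL2.integrable g
  have hker : ∀ ω ν : UnitSphere d, (∫ z : EuclideanSpace ℝ (Fin d),
      Complex.exp (Complex.I * ((inner ℝ z ((ω : EuclideanSpace ℝ (Fin d)) - ν) : ℝ) : ℂ)) *
        ((w z : ℝ) : ℂ)) =
      ∫ z, ((w z : ℝ) : ℂ) * (wave (-z) (ω : EuclideanSpace ℝ (Fin d)) *
        wave z (ν : EuclideanSpace ℝ (Fin d))) := by
    intro ω ν
    refine integral_congr_ae (Filter.Eventually.of_forall fun z => ?_)
    simp only [wave]
    rw [← Complex.exp_add, mul_comm, inner_sub_right, inner_neg_left]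
    congr 2; push_cast; ring
  have hc : Measurable fun ω : UnitSphere d => (ω : EuclideanSpace ℝ (Fin d)) :=
    measurable_subtype_coe
  have h1 : inner ℂ g (T g) = bilinKernel (surfaceMeasure d) (fun ω ν =>
      ∫ z, ((w z : ℝ) : ℂ) * (wave (-z) (ω : EuclideanSpace ℝ (Fin d)) *
        wave z (ν : EuclideanSpace ℝ (Fin d)))) (fun ω => (starRingEnd ℂ) (g ω)) g := by
    rw [L2.inner_def, bilinKernel]
    refine integral_congr_ae ?_
    filter_upwards [(hT g).2] with ω hω
    rw [RCLike.inner_apply', hω]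
    simp only [hker]
  have hm1 : Measurable (Function.uncurry fun (ω : UnitSphere d) (z : EuclideanSpace ℝ (Fin d)) =>
      wave (-z) (ω : EuclideanSpace ℝ (Fin d))) :=
    continuous_wave.measurable.comp (measurable_snd.neg.prodMk (hc.comp measurable_fst))
  have hm2 : Measurable (Function.uncurry fun (ν : UnitSphere d) (z : EuclideanSpace ℝ (Fin d)) =>
      wave z (ν : EuclideanSpace ℝ (Fin d))) :=
    continuous_wave.measurable.comp (measurable_snd.prodMk (hc.comp measurable_fst))
  have hw' : Integrable fun z => ((w z : ℝ) : ℂ) := hw.ofReal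
  rw [h1, bilinKernel_superposition hw' hm1 hm2 (fun _ _ => (norm_wave _ _).le)
    (fun _ _ => (norm_wave _ _).le) (integrable_conj hgi) hgi (Lp.stronglyMeasurable g).measurable,
    ← integral_complex_ofReal]
  refine integral_congr_ae (Filter.Eventually.of_forall fun z => ?_)
  have h2 : ∫ ω, (starRingEnd ℂ) (g ω) * wave (-z) (ω : EuclideanSpace ℝ (Fin d))
      ∂(surfaceMeasure d) = (starRingEnd ℂ) (sphereTransform g z) := by
    rw [sphereTransform, ← integral_conj]
    simp only [map_mul, conj_wave]
  simp only
  rw [h2, ← sphereTransform, Complex.conj_mul']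
  push_cast; rfl

/-- Evaluation at `z` is represented by the conjugate plane wave, which has modulus one and hence
squared norm the area of the sphere. -/
lemma exists_sphereTransform_eq_inner (z : EuclideanSpace ℝ (Fin d)) : ∃ u : SphereL2 d,
    ‖u‖ ^ 2 = sphereArea d ∧ ∀ g : SphereL2 d, sphereTransform g z = inner ℂ u g := by
  have hu : MemLp (fun ω : UnitSphere d => (starRingEnd ℂ)
      (wave z (ω : EuclideanSpace ℝ (Fin d)))) 2 (surfaceMeasure d) :=
    MemLp.of_bound (Complex.continuous_conj.comp (continuous_wave_sphere z)).aestronglyMeasurable 1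
      (Filter.Eventually.of_forall fun ω => by rw [RCLike.norm_conj, norm_wave])
  refine ⟨hu.toLp _, ?_, fun g => ?_⟩
  · have h : (inner ℂ (hu.toLp _) (hu.toLp _) : ℂ) = (sphereArea d : ℂ) := by
      rw [L2.inner_def]
      calc _ = ∫ _ω : UnitSphere d, (1 : ℂ) ∂(surfaceMeasure d) := by
            refine integral_congr_ae ?_
            filter_upwards [hu.coeFn_toLp] with ω hω
            rw [hω, RCLike.inner_apply', Complex.conj_mul', RCLike.norm_conj, norm_wave]
            norm_num
        _ = _ := by simp [sphereArea]
    rw [inner_self_eq_ofReal_norm_sq] at h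
    exact_mod_cast h
  · rw [L2.inner_def]
    refine integral_congr_ae ?_
    filter_upwards [hu.coeFn_toLp] with ω hω
    rw [hω, RCLike.inner_apply', Complex.conj_conj, mul_comm]

/-- Parseval at each `z`, applied to the representing vector of evaluation, gives the constant sum
`sphereArea d`; nonnegativity permits integration term by term. -/
lemma hasSum_integral_sphereTransform_sq {w : EuclideanSpace ℝ (Fin d) → ℝ} (hw : Integrable w)
    (hw0 : ∀ z, 0 ≤ w z) {ι : Type*} (e : HilbertBasis ι ℂ (SphereL2 d)) :
    HasSum (fun i => ∫ z, w z * ‖sphereTransform (e i) z‖ ^ 2) (sphereArea d * ∫ z, w z) := by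
  have : Fact ((2 : ℝ≥0∞) ≠ ⊤) := ⟨ENNReal.ofNat_ne_top⟩
  have : IsSeparable (surfaceMeasure d) := isSeparable_of_sigmaFinite _
  have : SecondCountableTopology (SphereL2 d) := Lp.SecondCountableTopology
  -- Interchanging sum and integral requires a countable index set; the basis is arbitrary, but the
  -- space is separable.
  have : Countable ι := Orthonormal.countable_of_separable e.orthonormal
  have hs : ∀ z, HasSum (fun i => w z * ‖sphereTransform (e i) z‖ ^ 2) (sphereArea d * w z) := by
    intro z
    obtain ⟨u, hu, hg⟩ := exists_sphereTransform_eq_inner z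
    simp only [hg]
    rw [mul_comm, ← hu]
    exact (HilbertBasis.hasSum_norm_inner_sq e u).mul_left (w z)
  have hnn : ∀ i z, 0 ≤ w z * ‖sphereTransform (e i) z‖ ^ 2 := fun i z =>
    mul_nonneg (hw0 z) (sq_nonneg _)
  have hint : ∀ i, Integrable fun z => w z * ‖sphereTransform (e i) z‖ ^ 2 := by
    intro i
    refine (hw.const_mul (sphereArea d)).mono' (hw.1.mul
      ((continuous_sphereTransform (SphereL2.integrable (e i))).norm.pow 2).aestronglyMeasurable)
      (Filter.Eventually.of_forall fun z => ?_)
    rw [Real.norm_of_nonneg (hnn i z)]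
    exact le_hasSum (hs z) i fun k _ => hnn k z
  have hsum : Summable fun i => ∫ z, ‖w z * ‖sphereTransform (e i) z‖ ^ 2‖ := by
    simp only [Real.norm_of_nonneg (hnn _ _)]
    refine summable_of_sum_le (c := sphereArea d * ∫ z, w z)
      (fun i => integral_nonneg (hnn i)) fun s => ?_
    rw [← integral_finsetSum _ fun i _ => hint i, ← integral_const_mul]
    exact integral_mono (integrable_finsetSum _ fun i _ => hint i) (hw.const_mul _)
      fun z => sum_le_hasSum s (fun k _ => hnn k z) (hs z)
  have h := hasSum_integral_of_summable_integral_norm hint hsum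
  simp only [(hs _).tsum_eq] at h
  rwa [integral_const_mul] at h

end ConvolutionOperator

/-! ### Conclusion -/

/-- With `d = n + 2` one has `4d/(d-1) - 2 = 2(n+3)/(n+1)`, so the hypothesis on `q` says precisely
that `q - 2` is at least the endpoint exponent. -/
lemma memLp_extension (hd : 2 ≤ d) {q : ℝ} (hq : 4 * (d : ℝ) / ((d : ℝ) - 1) ≤ q)
    (f : SphereL2 d) : 0 < q - 2 ∧ MemLp (extension f) (ENNReal.ofReal (q - 2)) := by
  obtain ⟨n, rfl⟩ := Nat.exists_eq_add_of_le' hd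
  have hn : (0 : ℝ) ≤ n := n.cast_nonneg
  have hle : (2 * (n + 3) / (n + 1) : ℝ) ≤ q - 2 := by
    have : (2 * (n + 3) / (n + 1) : ℝ) = 4 * ((n + 2 : ℕ) : ℝ) / (((n + 2 : ℕ) : ℝ) - 1) - 2 := by
      push_cast
      rw [show (n : ℝ) + 2 - 1 = n + 1 by ring]
      field_simp; ring
    linarith
  have hp : (0 : ℝ) < 2 * (n + 3) / (n + 1) := by positivity
  exact ⟨hp.trans_le hle, memLp_of_norm_le_of_le hp hle (norm_sphereTransform_le f)
    (memLp_sphereTransform n rfl (Lp.stronglyMeasurable f).measurable (Lp.memLp f))⟩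

lemma kernel_eq_waveTransform (q : ℝ) (f : SphereL2 d) (ξ : EuclideanSpace ℝ (Fin d)) :
    kernel q f ξ = waveTransform (fun z => ((‖extension f z‖ ^ (q - 2) : ℝ) : ℂ)) (-ξ) := by
  refine integral_congr_ae (Filter.Eventually.of_forall fun z => ?_)
  simp only [wave, inner_neg_right]
  rw [mul_comm]
  congr 2; push_cast; ring

end FourierExtension

end

theorem mainTheorem10 (d : ℕ) (hd : 2 ≤ d) (q : ℝ) (hq : 4 * (d : ℝ) / ((d : ℝ) - 1) ≤ q)
    (f : FourierExtension.SphereL2 d) (hf : f ≠ 0) :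
    MemLp (FourierExtension.extension f) (ENNReal.ofReal (q - 2)) volume ∧
    ∃ T : FourierExtension.SphereL2 d →L[ℂ] FourierExtension.SphereL2 d,
      FourierExtension.IsConvolutionOperator (FourierExtension.kernel q f) T ∧
      FourierExtension.IsTraceClass T ∧
      FourierExtension.HasTrace T
        ((FourierExtension.sphereArea d *
          (eLpNorm (FourierExtension.extension f) (ENNReal.ofReal (q - 2)) volume).toReal
            ^ (q - 2) : ℝ) : ℂ) := by
  obtain ⟨hq0, hmem⟩ := FourierExtension.memLp_extension hd hq f
  have hp0 : ENNReal.ofReal (q - 2) ≠ 0 := by simpa using hq0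
  set w : EuclideanSpace ℝ (Fin d) → ℝ := fun z => ‖FourierExtension.extension f z‖ ^ (q - 2) with hw
  have hwi : Integrable w := by
    have h := hmem.integrable_norm_rpow hp0 ENNReal.ofReal_ne_top
    rwa [ENNReal.toReal_ofReal hq0.le] at h
  have hw0 : ∀ z, 0 ≤ w z := fun z => Real.rpow_nonneg (norm_nonneg _) _
  have hwint : ∫ z, w z =
      (eLpNorm (FourierExtension.extension f) (ENNReal.ofReal (q - 2)) volume).toReal ^ (q - 2) := by
    rw [hmem.eLpNorm_eq_integral_rpow_norm hp0 ENNReal.ofReal_ne_top,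
      ENNReal.toReal_ofReal hq0.le, ENNReal.toReal_ofReal
        (Real.rpow_nonneg (integral_nonneg hw0) _), ← Real.rpow_mul (integral_nonneg hw0),
      inv_mul_cancel₀ hq0.ne', Real.rpow_one]
  have hKc : Continuous (FourierExtension.kernel q f) := by
    have h : FourierExtension.kernel q f = fun ξ => FourierExtension.waveTransform
        (fun z => ((w z : ℝ) : ℂ)) (-ξ) :=
      funext (FourierExtension.kernel_eq_waveTransform q f)
    rw [h]
    exact (FourierExtension.continuous_waveTransform (hwi.ofReal (𝕜 := ℂ))).comp continuous_neg
  have hKb : ∀ ξ, ‖FourierExtension.kernel q f ξ‖ ≤ (∫ z, ‖((w z : ℝ) : ℂ)‖) * 1 := fun ξ => by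
    rw [FourierExtension.kernel_eq_waveTransform]
    exact FourierExtension.norm_integral_mul_kernel_le (hwi.ofReal (𝕜 := ℂ))
      fun z => (FourierExtension.norm_wave _ _).le
  obtain ⟨T, hT⟩ := FourierExtension.exists_isConvolutionOperator hKc hKb
  have hinner : ∀ g : FourierExtension.SphereL2 d, inner ℂ g (T g) =
      ((∫ z, w z * ‖FourierExtension.sphereTransform g z‖ ^ 2 : ℝ) : ℂ) :=
    FourierExtension.inner_isConvolutionOperator hwi hT
  -- The quadratic form is the integral of a nonnegative function; positivity identifies `|T|` with
  -- `T`, so trace class reduces to the summability already contained in the trace formula.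
  have hpos : 0 ≤ T := by
    rw [ContinuousLinearMap.nonneg_iff_isPositive, ContinuousLinearMap.isPositive_iff_complex]
    intro g
    have h : inner ℂ (T g) g =
        ((∫ z, w z * ‖FourierExtension.sphereTransform g z‖ ^ 2 : ℝ) : ℂ) := by
      rw [← inner_conj_symm, hinner, Complex.conj_ofReal]
    rw [h]
    refine ⟨rfl, ?_⟩
    exact integral_nonneg fun z => mul_nonneg (hw0 z) (sq_nonneg _)
  have hsum : ∀ (ι : Type) (e : HilbertBasis ι ℂ (FourierExtension.SphereL2 d)), HasSum
      (fun i => ∫ z, w z * ‖FourierExtension.sphereTransform (e i) z‖ ^ 2)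
      (FourierExtension.sphereArea d * ∫ z, w z) := fun ι e =>
    FourierExtension.hasSum_integral_sphereTransform_sq hwi hw0 e
  refine ⟨hmem, T, hT, FourierExtension.isTraceClass_of_nonneg hpos fun ι e => ?_, fun ι e => ?_⟩
  · simp only [hinner, Complex.ofReal_re]
    exact (hsum ι e).summable
  · simp only [hinner]
    rw [← hwint]
    exact_mod_cast hsum ι e
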